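/- Let $k$ be an algebraically closed field, $N\cong\mathbb Z^r$ a lattice with dual $M=\operatorname{Hom}(N,\mathbb Z)$, and $\Delta$ a fan in $N$ (a finite collection of strongly convex rational polyhedral cones in $N_{\mathbb R}$, closed under taking faces, any two of which meet in a common face). Let $X=X(\Delta)$ be the associated toric variety over $k$, glued from the affine charts $U_\sigma=\operatorname{Spec}k[\sigma^\vee\cap M]$, $\sigma\in\Delta$, and assume that $X$ is proper over $k$. (Once $X$ carries an ample line bundle this is the same as $X$ being projective.) Let $\Delta(1)$ be the set of rays of $\Delta$, each identified with its primitive generator $v\in N$, and let $Y(v)\subset X$ be the torus-invariant prime divisor of $v$: it is the closure of the closed subset of $U_v$ defined by the ideal generated by the $x^u$, $u\in v^\vee\cap M$, with $\langle u,v\rangle>0$. Let $\operatorname{Cox}(X)=k[v : v\in\Delta(1)]$ be the polynomial ring with one variable for each ray, and let $$J_X=\Bigl(\prod_{v\in\Delta(1),\,v\notin\sigma}v \ :\ \sigma\in\Delta\Bigr)\subseteq \operatorname{Cox}(X)$$ be the irrelevant ideal. Let $D$ be any Weil divisor on $X$ such that $\mathcal O_X(D)$ is an ample line bundle, and write $$D=\sum_{v\in\Delta(1)}a_v\,Y(v)+\operatorname{div}(g)$$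 with $a_v\in\mathbb Z$ and $g\neq0$ a rational function on $X$ (every divisor can be written in this way). If $f\in H^0(X,\mathcal O_X(D))$, then $fg$ is a Laurent polynomial $\sum_u c_u x^u\in k[M]$, and $c_u\ne 0$ implies $\langle u,v\rangle+a_v\ge0$ for all $v\in\Delta(1)$. The image of $f$ in $\operatorname{Cox}(X)$ is defined to be $$\sum_u c_u\prod_{v\in\Delta(1)}v^{\langle u,v\rangle+a_v}.$$ Let $\bigl(H^0(X,D)\bigr)\subseteq\operatorname{Cox}(X)$ be the ideal generated by the images of all $f\in H^0(X,\mathcal O_X(D))$. Then $$J_X=\sqrt{\bigl(H^0(X,D)\bigr)} .$$ -/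

import Mathlib

universe u

namespace Toric

open CategoryTheory AlgebraicGeometry TensorProduct

section Lattice

variable {N : Type u} [AddCommGroup N]

/-- The image `1 ⊗ v` of a lattice vector `v ∈ N` in the real vector space `N_ℝ = ℝ ⊗ N`. -/
noncomputable def latticeVec (v : N) : ℝ ⊗[ℤ] N := 1 ⊗ₜ[ℤ] v

/-- The real pairing `⟨u, -⟩ : N_ℝ → ℝ` with an element `u` of the dual lattice
`M = Hom(N, ℤ)`. -/
noncomputable def pairing (u : Module.Dual ℤ N) : ℝ ⊗[ℤ] N →ₗ[ℝ] ℝ :=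
  (AlgebraTensorModule.rid ℤ ℝ ℝ).toLinearMap ∘ₗ LinearMap.baseChange ℝ u

@[simp] lemma pairing_latticeVec (u : Module.Dual ℤ N) (v : N) :
    pairing u (latticeVec v) = (u v : ℝ) := by
  simp [pairing, latticeVec]

lemma pairing_add (u v : Module.Dual ℤ N) (x : ℝ ⊗[ℤ] N) :
    pairing (u + v) x = pairing u x + pairing v x := by
  simp [pairing, LinearMap.baseChange_add]

lemma pairing_zero (x : ℝ ⊗[ℤ] N) : pairing (0 : Module.Dual ℤ N) x = 0 := by
  simp [pairing]

lemma pairing_neg (u : Module.Dual ℤ N) (x : ℝ ⊗[ℤ] N) : pairing (-u) x = - pairing u x := by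
  have h := pairing_add u (-u) x
  rw [add_neg_cancel, pairing_zero] at h
  linarith

/-- `τ` is a face of `σ`: the intersection of `σ` with a hyperplane `w = 0` such that `w ≥ 0` on
`σ` (with `w = 0` allowed, so that `σ` is a face of itself). -/
def IsFace (τ σ : PointedCone ℝ (ℝ ⊗[ℤ] N)) : Prop :=
  ∃ w : Module.Dual ℝ (ℝ ⊗[ℤ] N), (∀ x ∈ σ, 0 ≤ w x) ∧ ∀ x, x ∈ τ ↔ x ∈ σ ∧ w x = 0

/-- A rational polyhedral cone: the cone generated by finitely many lattice vectors. -/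
def IsRationalPolyhedral (σ : PointedCone ℝ (ℝ ⊗[ℤ] N)) : Prop :=
  ∃ s : Finset N, σ = PointedCone.hull ℝ (latticeVec '' (s : Set N))

/-- The monoid `σ^∨ ∩ M` of those `u ∈ M` that are nonnegative on the cone `σ`. -/
def dualMonoid (σ : PointedCone ℝ (ℝ ⊗[ℤ] N)) : AddSubmonoid (Module.Dual ℤ N) where
  carrier := {u | ∀ x ∈ σ, 0 ≤ pairing u x}
  add_mem' ha hb x hx := by rw [pairing_add]; exact add_nonneg (ha x hx) (hb x hx)
  zero_mem' x _ := by rw [pairing_zero]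

lemma mem_dualMonoid {σ : PointedCone ℝ (ℝ ⊗[ℤ] N)} {u : Module.Dual ℤ N} :
    u ∈ dualMonoid σ ↔ ∀ x ∈ σ, 0 ≤ pairing u x := Iff.rfl

lemma dualMonoid_anti {σ τ : PointedCone ℝ (ℝ ⊗[ℤ] N)} (h : τ ≤ σ) :
    dualMonoid σ ≤ dualMonoid τ := fun _ hu x hx => hu x (h hx)

lemma mem_dualMonoid_hull {s : Set N} {u : Module.Dual ℤ N} :
    u ∈ dualMonoid (PointedCone.hull ℝ (latticeVec '' s)) ↔ ∀ v ∈ s, 0 ≤ u v := by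
  constructor
  · intro h v hv
    have := h _ (Submodule.subset_span ⟨v, hv, rfl⟩)
    rw [pairing_latticeVec] at this
    exact_mod_cast this
  · intro h x hx
    induction hx using Submodule.span_induction with
    | mem x hx =>
      obtain ⟨v, hv, rfl⟩ := hx
      rw [pairing_latticeVec]
      exact_mod_cast h v hv
    | zero => simp
    | add x y _ _ hx hy => rw [map_add]; exact add_nonneg hx hy
    | smul c x _ hx =>
      have : pairing u (c • x) = (c : ℝ) * pairing u x := by
        rw [← smul_eq_mul, ← map_smul]; rfl
      rw [this]; exact mul_nonneg c.2 hx

/-- A real functional that is nonnegative on finitely many lattice vectors can be replaced by an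
integral one with the same zeros among them. -/
lemma exists_integral [Module.Finite ℤ N] (s : Finset N) (w : Module.Dual ℝ (ℝ ⊗[ℤ] N))
    (hw : ∀ v ∈ s, 0 ≤ w (latticeVec v)) :
    ∃ u : Module.Dual ℤ N, ∀ v ∈ s, 0 ≤ u v ∧ (u v = 0 ↔ w (latticeVec v) = 0) := by
  classical
  let φ : N →ₗ[ℤ] ℝ := (w.restrictScalars ℤ) ∘ₗ (TensorProduct.mk ℤ ℝ N 1)
  have hφ : ∀ v, φ v = w (latticeVec v) := fun v => rfl
  let G := LinearMap.range φ
  have : Module.Free ℤ G := Module.free_of_finite_type_torsion_free'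
  let b := Module.finBasis ℤ G
  let n := Module.finrank ℤ G
  let c : N → Fin n → ℤ := fun v i => b.repr (φ.rangeRestrict v) i
  have hsum : ∀ v, φ v = ∑ i, (c v i : ℝ) * (b i : ℝ) := by
    intro v
    have := congrArg (Subtype.val) (b.sum_repr (φ.rangeRestrict v))
    simp only [AddSubmonoidClass.coe_finsetSum, Submodule.coe_smul] at this
    rw [show φ v = ((φ.rangeRestrict v : G) : ℝ) from rfl, ← this]
    refine Finset.sum_congr rfl fun i _ => ?_
    simp [c]
  let U : Set (Fin n → ℝ) := {x | ∀ v ∈ s.filter (fun v => 0 < φ v), 0 < ∑ i, (c v i : ℝ) * x i}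
  have hU : IsOpen U := by
    have : U = ⋂ v ∈ s.filter (fun v => 0 < φ v), {x | 0 < ∑ i, (c v i : ℝ) * x i} := by
      ext x; simp [U]
    rw [this]
    refine isOpen_biInter_finset fun v _ => ?_
    exact isOpen_lt continuous_const (by fun_prop)
  have hne : U.Nonempty := ⟨fun i => (b i : ℝ), fun v hv => by
    rw [← hsum]; exact (Finset.mem_filter.mp hv).2⟩
  have hd : DenseRange (fun (q : Fin n → ℚ) (i : Fin n) => ((q i : ℚ) : ℝ)) :=
    DenseRange.piMap (fun _ => Rat.denseRange_cast)
  obtain ⟨q, hq⟩ := hd.exists_mem_open hU hne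
  let D : ℕ := ∏ i, (q i).den
  have hD : 0 < D := Finset.prod_pos fun i _ => (q i).den_pos
  have hm : ∀ i, ∃ m : ℤ, (m : ℚ) = D * q i := by
    intro i
    obtain ⟨e, he⟩ : (q i).den ∣ D := Finset.dvd_prod_of_mem _ (Finset.mem_univ i)
    refine ⟨e * (q i).num, ?_⟩
    rw [he]; push_cast
    have := Rat.den_mul_eq_num (q i)
    linear_combination (-(e : ℚ)) * this
  choose m hm using hm
  refine ⟨(b.constr ℤ m) ∘ₗ φ.rangeRestrict, fun v hv => ?_⟩
  have hu : (((b.constr ℤ m) (φ.rangeRestrict v) : ℤ) : ℝ) =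
      D * ∑ i, (c v i : ℝ) * ((q i : ℚ) : ℝ) := by
    rw [Module.Basis.constr_apply_fintype, Finset.mul_sum]
    push_cast
    refine Finset.sum_congr rfl fun i _ => ?_
    have : ((m i : ℤ) : ℝ) = D * ((q i : ℚ) : ℝ) := by exact_mod_cast congrArg (Rat.cast (K := ℝ)) (hm i)
    simp only [smul_eq_mul, Int.cast_mul]
    rw [this]
    simp only [c, Module.Basis.equivFun_apply]
    ring
  rcases (hw v hv).eq_or_lt with h0 | hpos
  · have : φ.rangeRestrict v = 0 := Subtype.ext (show φ v = 0 by rw [hφ, ← h0])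
    simp [this, ← h0]
  · have h1 := hq v (Finset.mem_filter.mpr ⟨hv, hpos⟩)
    have h2 : (0 : ℝ) < (((b.constr ℤ m) (φ.rangeRestrict v) : ℤ) : ℝ) := by
      rw [hu]; exact mul_pos (by exact_mod_cast hD) h1
    have h3 : 0 < (b.constr ℤ m) (φ.rangeRestrict v) := by exact_mod_cast h2
    exact ⟨h3.le, ⟨fun h => absurd h h3.ne', fun h => absurd h hpos.ne'⟩⟩

/-- A face of a rational polyhedral cone `σ` is cut out by an element of `σ^∨ ∩ M`. -/
lemma IsFace.exists_dual [Module.Finite ℤ N] {τ σ : PointedCone ℝ (ℝ ⊗[ℤ] N)} (h : IsFace τ σ)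
    (hσ : IsRationalPolyhedral σ) :
    ∃ u ∈ dualMonoid σ, ∀ x, x ∈ τ ↔ x ∈ σ ∧ pairing u x = 0 := by
  obtain ⟨s, rfl⟩ := hσ
  obtain ⟨w, hw, hτ⟩ := h
  obtain ⟨u, hu⟩ := exists_integral s w fun v hv => hw _ (Submodule.subset_span ⟨v, hv, rfl⟩)
  have hmem := mem_dualMonoid_hull.mpr fun v hv => (hu v hv).1
  refine ⟨u, hmem, fun x => ?_⟩
  rw [hτ]
  refine and_congr_right fun hx => ?_
  induction hx using Submodule.span_induction with
  | mem x hx =>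
    obtain ⟨v, hv, rfl⟩ := hx
    rw [pairing_latticeVec, ← (hu v hv).2]
    norm_cast
  | zero => simp
  | add x y hx hy ihx ihy =>
    rw [map_add, map_add, add_eq_zero_iff_of_nonneg (hw x hx) (hw y hy),
      add_eq_zero_iff_of_nonneg (hmem x hx) (hmem y hy), ihx, ihy]
  | smul c x _ ih =>
    have h1 : pairing u (c • x) = (c : ℝ) * pairing u x := by
      rw [← smul_eq_mul, ← map_smul]; rfl
    have h2 : w (c • x) = (c : ℝ) * w x := by
      rw [← smul_eq_mul, ← map_smul]; rfl
    rw [h1, h2, mul_eq_zero, mul_eq_zero, ih]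

/-- If `u` cuts out the face `τ` of `σ`, every element of `τ^∨ ∩ M` can be moved into
`σ^∨ ∩ M` by adding a multiple of `u`. -/
lemma exists_add_nsmul_mem {τ σ : PointedCone ℝ (ℝ ⊗[ℤ] N)} (hσ : IsRationalPolyhedral σ)
    {u : Module.Dual ℤ N} (hu : u ∈ dualMonoid σ) (hτ : ∀ x, x ∈ τ ↔ x ∈ σ ∧ pairing u x = 0)
    {m : Module.Dual ℤ N} (hm : m ∈ dualMonoid τ) : ∃ n : ℕ, m + n • u ∈ dualMonoid σ := by
  obtain ⟨s, rfl⟩ := hσ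
  refine ⟨∑ v ∈ s, (m v).natAbs, mem_dualMonoid_hull.mpr fun v hv => ?_⟩
  have h0 := mem_dualMonoid_hull.mp hu v hv
  have hle : (m v).natAbs ≤ ∑ v ∈ s, (m v).natAbs :=
    Finset.single_le_sum (f := fun v => (m v).natAbs) (fun _ _ => Nat.zero_le _) hv
  rcases h0.eq_or_lt with h | h
  · have hvτ : latticeVec v ∈ τ :=
      (hτ _).mpr ⟨Submodule.subset_span ⟨v, hv, rfl⟩, by rw [pairing_latticeVec, ← h]; simp⟩
    have := hm _ hvτ
    rw [pairing_latticeVec] at this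
    have h' : 0 ≤ m v := by exact_mod_cast this
    simp [← h, h']
  · simp only [LinearMap.add_apply, LinearMap.smul_apply, nsmul_eq_mul]
    have h1 : ((m v).natAbs : ℤ) ≤ ((∑ v ∈ s, (m v).natAbs : ℕ) : ℤ) := by exact_mod_cast hle
    have h2 : -(m v) ≤ ((m v).natAbs : ℤ) := by omega
    nlinarith

/-- Gordan's lemma. -/
lemma dualMonoid_fg [Module.Free ℤ N] [Module.Finite ℤ N] {σ : PointedCone ℝ (ℝ ⊗[ℤ] N)}
    (hσ : IsRationalPolyhedral σ) : (dualMonoid σ).FG := by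
  classical
  obtain ⟨s, rfl⟩ := hσ
  let L : Module.Dual ℤ N →ₗ[ℤ] (s → ℤ) := LinearMap.pi fun v => LinearMap.applyₗ (v : N)
  let ι : (s → ℕ) →+ (s → ℤ) := (Nat.castAddMonoidHom ℤ).compLeft s
  let P : AddSubmonoid (s → ℕ) := (LinearMap.range L).toAddSubmonoid.comap ι
  have hP : P.FG := by
    refine AddSubmonoid.fg_of_subtractive fun x hx y hxy => ?_
    have h1 : ι x ∈ LinearMap.range L := hx
    have h2 : ι (x + y) ∈ LinearMap.range L := hxy
    rw [map_add] at h2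
    exact (Submodule.add_mem_iff_right _ h1).mp h2
  obtain ⟨t, ht⟩ := hP
  have hker : (LinearMap.ker L).toAddSubmonoid.FG := by
    have h1 : (LinearMap.ker L).FG := IsNoetherian.noetherian _
    have h2 : (LinearMap.ker L).toAddSubgroup.FG := by
      rwa [← Submodule.fg_iff_addSubgroup_fg]
    exact (AddSubgroup.fg_iff_addSubmonoid_fg _).mp h2
  obtain ⟨t', ht'⟩ := hker
  have hlift : ∀ x : s → ℕ, x ∈ P → ∃ m : Module.Dual ℤ N, L m = ι x := fun x hx => hx
  choose! g hg using hlift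
  have htP : ∀ x ∈ t, x ∈ P := fun x hx => ht ▸ AddSubmonoid.subset_closure hx
  refine ⟨t.image g ∪ t', le_antisymm ?_ ?_⟩
  · rw [AddSubmonoid.closure_le]
    intro m hm
    rw [SetLike.mem_coe, mem_dualMonoid_hull]
    intro v hv
    simp only [Finset.coe_union, Finset.coe_image, Set.mem_union, Set.mem_image,
      Finset.mem_coe] at hm
    rcases hm with ⟨x, hx, rfl⟩ | hm
    · have := congrFun (hg x (htP x hx)) ⟨v, hv⟩
      change g x v = (x ⟨v, hv⟩ : ℤ) at this
      rw [this]; positivity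
    · have hm' : m ∈ (LinearMap.ker L).toAddSubmonoid := ht' ▸ AddSubmonoid.subset_closure hm
      have : L m = 0 := hm'
      have := congrFun this ⟨v, hv⟩
      change m v = 0 at this
      rw [this]
  · intro m hm
    rw [mem_dualMonoid_hull] at hm
    have key : ∀ x ∈ P, ∀ m, L m = ι x →
        m ∈ AddSubmonoid.closure ((t.image g ∪ t' : Finset _) : Set (Module.Dual ℤ N)) := by
      intro x hx
      rw [← ht] at hx
      have hkey0 : ∀ m, L m = 0 →
          m ∈ AddSubmonoid.closure ((t.image g ∪ t' : Finset _) : Set (Module.Dual ℤ N)) := by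
        intro m hm0
        have : m ∈ (LinearMap.ker L).toAddSubmonoid := hm0
        rw [← ht'] at this
        exact AddSubmonoid.closure_mono (by simp) this
      have hex : ∃ m ∈ AddSubmonoid.closure
          ((t.image g ∪ t' : Finset _) : Set (Module.Dual ℤ N)), L m = ι x := by
        induction hx using AddSubmonoid.closure_induction with
        | mem x hx => 
          refine ⟨g x, AddSubmonoid.subset_closure ?_, hg x (htP x hx)⟩
          simp only [Finset.coe_union, Finset.coe_image]
          exact Or.inl ⟨x, hx, rfl⟩
        | zero => exact ⟨0, zero_mem _, by simp⟩
        | add x y _ _ ihx ihy =>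
          obtain ⟨a, ha, hax⟩ := ihx
          obtain ⟨b, hb, hby⟩ := ihy
          exact ⟨a + b, add_mem ha hb, by rw [map_add, map_add, hax, hby]⟩
      intro m hmx
      obtain ⟨a, ha, hax⟩ := hex
      have := add_mem ha (hkey0 (m - a) (by rw [map_sub, hmx, hax, sub_self]))
      simpa using this
    have hx : L m = ι (fun v => (m v).toNat) := by
      funext v
      change m v = ((m v).toNat : ℤ)
      rw [Int.toNat_of_nonneg (hm v v.2)]
    exact key _ ⟨m, hx⟩ m hx

end Lattice

section Fan

variable (N : Type u) [AddCommGroup N]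

/-- A fan in the lattice `N`: a finite collection of rational polyhedral cones in `N_ℝ`, closed
under taking faces, any two of which meet along a common face. The zero cone belongs to the fan; by
`inter_face` it is then a face of every cone, i.e. all cones of the fan are strongly convex. -/
structure Fan where
  /-- the cones of the fan -/
  cones : Set (PointedCone ℝ (ℝ ⊗[ℤ] N))
  finite : cones.Finite
  zero_mem : ⊥ ∈ cones
  rational : ∀ σ ∈ cones, IsRationalPolyhedral σ
  face_mem : ∀ σ ∈ cones, ∀ τ, IsFace τ σ → τ ∈ cones
  inter_face : ∀ σ ∈ cones, ∀ τ ∈ cones, IsFace (σ ⊓ τ) σ ∧ IsFace (σ ⊓ τ) τ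

variable {N}

/-- The cones of a fan, partially ordered by inclusion. -/
abbrev Fan.Cone (Δ : Fan N) : Type u := {σ : PointedCone ℝ (ℝ ⊗[ℤ] N) // σ ∈ Δ.cones}

lemma Fan.isFace_of_le (Δ : Fan N) {τ σ : Δ.Cone} (h : τ ≤ σ) : IsFace τ.1 σ.1 := by
  have := (Δ.inter_face τ.1 τ.2 σ.1 σ.2).2
  rwa [inf_eq_left.mpr h] at this

end Fan

section Charts

variable (k : Type u) [Field k] {N : Type u} [AddCommGroup N]

/-- The coordinate ring `k[σ^∨ ∩ M]` of the affine toric variety `U_σ`. -/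
abbrev ChartRing (σ : PointedCone ℝ (ℝ ⊗[ℤ] N)) : Type u := AddMonoidAlgebra k (dualMonoid σ)

/-- The inclusion `k[σ^∨ ∩ M] → k[τ^∨ ∩ M]` for `τ ⊆ σ`. -/
noncomputable def chartMap {τ σ : PointedCone ℝ (ℝ ⊗[ℤ] N)} (h : τ ≤ σ) :
    ChartRing k σ →+* ChartRing k τ :=
  AddMonoidAlgebra.mapDomainRingHom k (AddSubmonoid.inclusion (dualMonoid_anti h))

lemma chartMap_single {τ σ : PointedCone ℝ (ℝ ⊗[ℤ] N)} (h : τ ≤ σ) (u : dualMonoid σ) (c : k) :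
    chartMap k h (.single u c) = .single (AddSubmonoid.inclusion (dualMonoid_anti h) u) c := by
  simp [chartMap]

lemma chartMap_injective {τ σ : PointedCone ℝ (ℝ ⊗[ℤ] N)} (h : τ ≤ σ) :
    Function.Injective (chartMap k h) :=
  AddMonoidAlgebra.mapDomain_injective (AddSubmonoid.inclusion_injective _)

lemma chartMap_isLocalization {τ σ : PointedCone ℝ (ℝ ⊗[ℤ] N)} (hσ : IsRationalPolyhedral σ)
    (h : τ ≤ σ) (u : dualMonoid σ) (hu : ∀ x, x ∈ τ ↔ x ∈ σ ∧ pairing u.1 x = 0) :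
    letI := (chartMap k h).toAlgebra
    IsLocalization.Away (.single u 1 : ChartRing k σ) (ChartRing k τ) := by
  let := (chartMap k h).toAlgebra
  have hneg : -u.1 ∈ dualMonoid τ := fun x hx => by
    rw [pairing_neg, ((hu x).mp hx).2, neg_zero]
  have hpow : ∀ n : ℕ, (.single u 1 : ChartRing k σ) ^ n = .single (n • u) 1 := fun n => by
    rw [AddMonoidAlgebra.single_pow, one_pow]
  refine IsLocalization.Away.mk _ ?_ ?_ ?_
  · refine IsUnit.of_mul_eq_one (.single ⟨-u.1, hneg⟩ 1) ?_
    change chartMap k h _ * _ = 1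
    rw [chartMap_single, AddMonoidAlgebra.single_mul_single, AddMonoidAlgebra.one_def]
    congr 1
    · ext1; simp
    · simp
  · intro s
    change ∃ n a, s * (chartMap k h _) ^ n = chartMap k h a
    induction s using AddMonoidAlgebra.induction_on with
    | of m =>
      obtain ⟨n, hn⟩ := exists_add_nsmul_mem hσ u.2 hu m.2
      refine ⟨n, .single ⟨_, hn⟩ 1, ?_⟩
      rw [← map_pow, hpow, chartMap_single, chartMap_single]
      simp only [AddMonoidAlgebra.of_apply, AddMonoidAlgebra.single_mul_single, mul_one]
      congr 1
    | add x y hx hy =>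
      obtain ⟨n, a, ha⟩ := hx
      obtain ⟨m, b, hb⟩ := hy
      refine ⟨n + m, a * (.single u 1) ^ m + b * (.single u 1) ^ n, ?_⟩
      rw [map_add, map_mul, map_mul, ← ha, ← hb, map_pow, map_pow]
      ring
    | smul r x hx =>
      obtain ⟨n, a, ha⟩ := hx
      refine ⟨n, .single 0 r * a, ?_⟩
      have hr : chartMap k h (.single 0 r) = algebraMap k _ r := by
        rw [chartMap_single, map_zero]; rfl
      rw [map_mul, ← ha, hr, smul_mul_assoc, Algebra.smul_def]
  · intro a b hab
    exact ⟨0, by rw [chartMap_injective k h hab]⟩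

end Charts

section Scheme

variable (k : Type u) [Field k] {N : Type u} [AddCommGroup N] (Δ : Fan N)

/-- The diagram `σ ↦ U_σ = Spec k[σ^∨ ∩ M]` of affine charts, indexed by the cones of the fan. -/
noncomputable def chartDiagram : Δ.Cone ⥤ Scheme.{u} where
  obj σ := Spec (.of (ChartRing k σ.1))
  map f := Spec.map (CommRingCat.ofHom (chartMap k (leOfHom f)))
  map_id σ := by
    rw [← Spec.map_id]
    congr 1
    exact congrArg CommRingCat.ofHom
      (AddMonoidAlgebra.mapDomainRingHom_id (R := k) (M := dualMonoid σ.1))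
  map_comp {ρ τ σ} f g := by
    rw [← Spec.map_comp, ← CommRingCat.ofHom_comp]
    congr 2
    exact AddMonoidAlgebra.mapDomainRingHom_comp (R := k)
      (AddSubmonoid.inclusion (dualMonoid_anti (leOfHom f)))
      (AddSubmonoid.inclusion (dualMonoid_anti (leOfHom g)))

lemma chartDiagram_range {τ σ : Δ.Cone} (f : τ ⟶ σ) (u : dualMonoid σ.1)
    (hu : ∀ x, x ∈ τ.1 ↔ x ∈ σ.1 ∧ pairing u.1 x = 0) :
    Set.range ((chartDiagram k Δ).map f) =
      (PrimeSpectrum.basicOpen (.single u 1 : ChartRing k σ.1) : Set (PrimeSpectrum _)) := by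
  let := (chartMap k (leOfHom f)).toAlgebra
  have := chartMap_isLocalization k (Δ.rational _ σ.2) (leOfHom f) u hu
  exact PrimeSpectrum.localization_away_comap_range _ _

lemma uniqueSums_dualMonoid (σ : PointedCone ℝ (ℝ ⊗[ℤ] N)) : UniqueSums (dualMonoid σ) :=
  UniqueSums.of_injective_addHom
    ({ toFun := fun u v => u.1 v, map_add' := fun _ _ => rfl } : dualMonoid σ →ₙ+ (N → ℤ))
    (fun _ _ h => Subtype.ext (LinearMap.ext fun v => congrFun h v)) inferInstance

instance chartRing_isDomain (σ : PointedCone ℝ (ℝ ⊗[ℤ] N)) : IsDomain (ChartRing k σ) := by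
  have := uniqueSums_dualMonoid σ
  have : NoZeroDivisors (ChartRing k σ) := inferInstance
  exact NoZeroDivisors.to_isDomain _

variable [Module.Finite ℤ N]

instance chartDiagram_isOpenImmersion {τ σ : Δ.Cone} (f : τ ⟶ σ) :
    IsOpenImmersion ((chartDiagram k Δ).map f) := by
  obtain ⟨u, hu, hτ⟩ := (Δ.isFace_of_le (leOfHom f)).exists_dual (Δ.rational _ σ.2)
  let := (chartMap k (leOfHom f)).toAlgebra
  have := chartMap_isLocalization k (Δ.rational _ σ.2) (leOfHom f) ⟨u, hu⟩ hτ
  exact IsOpenImmersion.of_isLocalization (.single ⟨u, hu⟩ 1 : ChartRing k σ.1)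

instance chartDiagram_isLocallyDirected :
    (chartDiagram k Δ ⋙ Scheme.forget).IsLocallyDirected where
  cond {i j σ} fi fj xi xj h := by
    obtain ⟨u, hu, hi⟩ := (Δ.isFace_of_le (leOfHom fi)).exists_dual (Δ.rational _ σ.2)
    obtain ⟨v, hv, hj⟩ := (Δ.isFace_of_le (leOfHom fj)).exists_dual (Δ.rational _ σ.2)
    let l : Δ.Cone := ⟨i.1 ⊓ j.1, Δ.face_mem _ i.2 _ (Δ.inter_face _ i.2 _ j.2).1⟩
    have hli : l ≤ i := inf_le_left (a := i.1) (b := j.1)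
    have hlj : l ≤ j := inf_le_right (a := i.1) (b := j.1)
    have hl : ∀ x, x ∈ l.1 ↔ x ∈ σ.1 ∧ pairing (u + v) x = 0 := by
      intro x
      rw [pairing_add]
      change x ∈ i.1 ⊓ j.1 ↔ _
      rw [Submodule.mem_inf, hi, hj]
      constructor
      · rintro ⟨⟨h1, h2⟩, -, h3⟩
        exact ⟨h1, by rw [h2, h3, add_zero]⟩
      · rintro ⟨h1, h2⟩
        have := (add_eq_zero_iff_of_nonneg (hu x h1) (hv x h1)).mp h2
        exact ⟨⟨h1, this.1⟩, h1, this.2⟩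
    have hmi := chartDiagram_range k Δ fi ⟨u, hu⟩ hi
    have hmj := chartDiagram_range k Δ fj ⟨v, hv⟩ hj
    have hml := chartDiagram_range k Δ (homOfLE hli ≫ fi) ⟨u + v, add_mem hu hv⟩ hl
    have h' : (chartDiagram k Δ).map fi xi = (chartDiagram k Δ).map fj xj := h
    have hx : (chartDiagram k Δ).map fi xi ∈
        Set.range ((chartDiagram k Δ).map (homOfLE hli ≫ fi)) := by
      have h1 : (chartDiagram k Δ).map fi xi ∈ Set.range ((chartDiagram k Δ).map fi) := ⟨_, rfl⟩
      have h2 : (chartDiagram k Δ).map fi xi ∈ Set.range ((chartDiagram k Δ).map fj) :=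
        ⟨_, h'.symm⟩
      rw [hmi] at h1
      rw [hmj] at h2
      rw [hml]
      have : (.single ⟨u + v, add_mem hu hv⟩ 1 : ChartRing k σ.1) =
          .single ⟨u, hu⟩ 1 * .single ⟨v, hv⟩ 1 := by
        rw [AddMonoidAlgebra.single_mul_single, mul_one]; rfl
      rw [this, PrimeSpectrum.basicOpen_mul]
      exact ⟨h1, h2⟩
    obtain ⟨x, hx⟩ := hx
    refine ⟨l, homOfLE hli, homOfLE hlj, x, ?_, ?_⟩
    · apply ((chartDiagram k Δ).map fi).isOpenEmbedding.injective
      rw [← hx, Functor.map_comp]; rfl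
    · apply ((chartDiagram k Δ).map fj).isOpenEmbedding.injective
      rw [← h', ← hx, show homOfLE hli ≫ fi = homOfLE hlj ≫ fj from Subsingleton.elim _ _,
        Functor.map_comp]; rfl

/-- The toric variety `X(Δ)` over `k`: the scheme obtained by gluing the affine charts
`U_σ = Spec k[σ^∨ ∩ M]`, `σ ∈ Δ`, along the open subschemes `U_τ ⊆ U_σ` for `τ ⊆ σ`. -/
noncomputable def toricVariety : Scheme.{u} := Limits.colimit (chartDiagram k Δ)

/-- The inclusion of the affine chart `U_σ` into `X(Δ)`. -/
noncomputable def chart (σ : Δ.Cone) : Spec (.of (ChartRing k σ.1)) ⟶ toricVariety k Δ :=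
  Limits.colimit.ι (chartDiagram k Δ) σ

instance chart_isOpenImmersion (σ : Δ.Cone) : IsOpenImmersion (chart k Δ σ) :=
  inferInstanceAs (IsOpenImmersion (Limits.colimit.ι (chartDiagram k Δ) σ))

lemma chartDiagram_map_chart {τ σ : Δ.Cone} (f : τ ⟶ σ) :
    (chartDiagram k Δ).map f ≫ chart k Δ σ = chart k Δ τ :=
  Limits.colimit.w (chartDiagram k Δ) f

lemma exists_chart (x : toricVariety k Δ) : ∃ σ y, chart k Δ σ y = x :=
  Scheme.IsLocallyDirected.ι_jointly_surjective (chartDiagram k Δ) x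

/-- The structure morphism `X(Δ) → Spec k`. -/
noncomputable def toricVarietyToSpec : toricVariety k Δ ⟶ Spec (.of k) :=
  Limits.colimit.desc (chartDiagram k Δ)
    { pt := Spec (.of k)
      ι :=
        { app σ := Spec.map (CommRingCat.ofHom (algebraMap k (ChartRing k σ.1)))
          naturality τ σ f := by
            change Spec.map _ ≫ Spec.map _ = Spec.map _ ≫ 𝟙 _
            rw [Category.comp_id, ← Spec.map_comp, ← CommRingCat.ofHom_comp]
            congr 2
            refine RingHom.ext fun r => ?_
            change chartMap k (leOfHom f) (.single 0 r) = .single 0 r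
            rw [chartMap_single, map_zero] } }

/-- The cone `{0}` of the fan. -/
def Fan.zeroCone (Δ : Fan N) : Δ.Cone := ⟨⊥, Δ.zero_mem⟩

instance toricVariety_isIntegral : AlgebraicGeometry.IsIntegral (toricVariety k Δ) := by
  have hred : AlgebraicGeometry.IsReduced (toricVariety k Δ) := by
    apply +allowSynthFailures isReduced_of_isReduced_stalk
    intro x
    obtain ⟨σ, y, rfl⟩ := exists_chart k Δ x
    exact isReduced_of_injective ((chart k Δ σ).stalkMap y).hom
      (ConcreteCategory.bijective_of_isIso ((chart k Δ σ).stalkMap y)).1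
  have hirr : IrreducibleSpace (toricVariety k Δ) := by
    have h0 : IsIrreducible (Set.range (chart k Δ Δ.zeroCone)) := by
      rw [← Set.image_univ]
      exact (IrreducibleSpace.isIrreducible_univ _).image _
        (chart k Δ Δ.zeroCone).continuous.continuousOn
    have hd : closure (Set.range (chart k Δ Δ.zeroCone)) = Set.univ := by
      refine Set.eq_univ_of_forall fun x => ?_
      obtain ⟨σ, y, rfl⟩ := exists_chart k Δ x
      have hle : Δ.zeroCone ≤ σ := bot_le (a := σ.1)
      rw [← chartDiagram_map_chart k Δ (homOfLE hle)]
      have hy : y ∈ closure (Set.range ((chartDiagram k Δ).map (homOfLE hle))) := by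
        have hop := ((chartDiagram k Δ).map (homOfLE hle)).isOpenEmbedding.isOpen_range
        have : IrreducibleSpace ((chartDiagram k Δ).obj σ) :=
          inferInstanceAs (IrreducibleSpace (Spec (.of (ChartRing k σ.1))))
        have : Nonempty ((chartDiagram k Δ).obj Δ.zeroCone) :=
          inferInstanceAs (Nonempty (Spec (.of (ChartRing k Δ.zeroCone.1))))
        exact hop.dense (Set.range_nonempty _) y
      refine closure_mono ?_ (image_closure_subset_closure_image
        (chart k Δ σ).continuous ⟨y, hy, rfl⟩)
      rintro _ ⟨_, ⟨z, rfl⟩, rfl⟩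
      exact ⟨z, rfl⟩
    rw [irreducibleSpace_def, Set.top_eq_univ, ← hd]
    exact h0.closure
  exact isIntegral_of_irreducibleSpace_of_isReduced _

instance toricVariety_isLocallyNoetherian [Module.Free ℤ N] :
    IsLocallyNoetherian (toricVariety k Δ) := by
  refine (isLocallyNoetherian_iff_openCover
    (Scheme.IsLocallyDirected.openCover (chartDiagram k Δ))).mpr fun σ => ?_
  have h1 : (dualMonoid σ.1).FG := dualMonoid_fg (Δ.rational _ σ.2)
  have : AddMonoid.FG (dualMonoid σ.1) := (AddMonoid.fg_iff_addSubmonoid_fg _).mpr h1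
  have : IsNoetherianRing (ChartRing k σ.1) := Algebra.FiniteType.isNoetherianRing k _
  change IsLocallyNoetherian (Spec (.of (ChartRing k σ.1)))
  infer_instance

end Scheme

section Rays

variable {N : Type u} [AddCommGroup N]

/-- A primitive lattice vector: one that is not a multiple of a lattice vector by a non-unit. -/
def IsPrimitiveVec (v : N) : Prop := ∀ (n : ℤ) (w : N), v = n • w → IsUnit n

lemma IsPrimitiveVec.exists_dual [Module.Free ℤ N] [Module.Finite ℤ N] {v : N}
    (hv : IsPrimitiveVec v) : ∃ u : Module.Dual ℤ N, u v = 1 := by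
  let b := Module.finBasis ℤ N
  let I : Ideal ℤ := LinearMap.range (LinearMap.applyₗ (R := ℤ) (M₂ := ℤ) v)
  obtain ⟨n, hn⟩ := (IsPrincipalIdealRing.principal I).principal
  have hc : ∀ i, ∃ c : ℤ, c * n = b.coord i v := by
    intro i
    have : b.coord i v ∈ I := ⟨b.coord i, rfl⟩
    rw [hn] at this
    exact Submodule.mem_span_singleton.mp this
  choose c hc using hc
  have hu : IsUnit n := by
    refine hv n (∑ i, c i • b i) ?_
    rw [Finset.smul_sum]
    conv_lhs => rw [← b.sum_repr v]
    refine Finset.sum_congr rfl fun i _ => ?_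
    rw [smul_smul, mul_comm n, hc]; rfl
  have h1 : (1 : ℤ) ∈ I := by
    have hI : I = ⊤ := by
      rw [hn]; exact Ideal.span_singleton_eq_top.mpr hu
    rw [hI]; trivial
  exact h1

/-- The set `Δ(1)` of rays of the fan; a ray is identified with its primitive generator. -/
abbrev Fan.Ray (Δ : Fan N) : Type u :=
  {v : N // IsPrimitiveVec v ∧ PointedCone.hull ℝ {latticeVec v} ∈ Δ.cones}

/-- The ray as a cone of the fan. -/
noncomputable def Fan.rayCone (Δ : Fan N) (v : Δ.Ray) : Δ.Cone :=
  ⟨PointedCone.hull ℝ {latticeVec v.1}, v.2.2⟩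

lemma hull_injective_of_isPrimitiveVec [Module.Free ℤ N] [Module.Finite ℤ N] {v w : N}
    (hv : IsPrimitiveVec v) (hw : IsPrimitiveVec w)
    (h : PointedCone.hull ℝ {latticeVec v} = PointedCone.hull ℝ {latticeVec w}) : v = w := by
  have key : ∀ {v w : N}, PointedCone.hull ℝ {latticeVec v} = PointedCone.hull ℝ {latticeVec w} →
      ∃ c : ℝ, 0 ≤ c ∧ ∀ u : Module.Dual ℤ N, c * u w = u v := by
    intro v w h
    have : latticeVec v ∈ PointedCone.hull ℝ {latticeVec w} := h ▸ Submodule.mem_span_singleton_self _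
    obtain ⟨c, hc⟩ := Submodule.mem_span_singleton.mp this
    refine ⟨c, c.2, fun u => ?_⟩
    rw [← pairing_latticeVec u v, ← hc, ← pairing_latticeVec u w]
    change _ = pairing u ((c : ℝ) • latticeVec w)
    rw [map_smul, smul_eq_mul]
  obtain ⟨c, hc0, hc⟩ := key h
  obtain ⟨d, hd0, hd⟩ := key h.symm
  obtain ⟨u, hu⟩ := hv.exists_dual
  obtain ⟨t, ht⟩ := hw.exists_dual
  have h1 : c = (t v : ℝ) := by rw [← hc t, ht]; simp
  have h2 : d = (u w : ℝ) := by rw [← hd u, hu]; simp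
  have h3 : c * d = 1 := by
    rw [h2, hc u, hu]; simp
  have h4 : c = 1 := by
    rw [h1, h2] at h3
    have h3' : t v * u w = 1 := by exact_mod_cast h3
    have h5 : 0 ≤ t v := by rw [h1] at hc0; exact_mod_cast hc0
    rw [h1]
    rcases Int.eq_one_or_neg_one_of_mul_eq_one h3' with h | h
    · rw [h]; simp
    · omega
  have h6 : ∀ u : Module.Dual ℤ N, u (v - w) = 0 := by
    intro u
    have := hc u
    rw [h4, one_mul] at this
    have : u w = u v := by exact_mod_cast this
    rw [map_sub, this, sub_self]
  exact sub_eq_zero.mp ((Module.forall_dual_apply_eq_zero_iff ℤ _).mp h6)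

instance Fan.finite_ray [Module.Free ℤ N] [Module.Finite ℤ N] (Δ : Fan N) : Finite Δ.Ray := by
  have : Finite Δ.Cone := Δ.finite.to_subtype
  refine Finite.of_injective Δ.rayCone fun v w h => Subtype.ext ?_
  exact hull_injective_of_isPrimitiveVec v.2.1 w.2.1 (congrArg Subtype.val h)

noncomputable instance Fan.fintype_ray [Module.Free ℤ N] [Module.Finite ℤ N] (Δ : Fan N) :
    Fintype Δ.Ray := Fintype.ofFinite _

variable (k : Type u) [Field k] (Δ : Fan N)

/-- The ideal of the divisor `Y(v)` in `U_v = Spec k[v^∨ ∩ M]`, generated by the characters `x^u`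
with `⟨u, v⟩ > 0`. -/
noncomputable def rayIdeal (v : Δ.Ray) : Ideal (ChartRing k (Δ.rayCone v).1) :=
  Ideal.span {x | ∃ u : dualMonoid (Δ.rayCone v).1, 0 < u.1 v.1 ∧ x = .single u 1}

lemma nonneg_of_mem_rayCone (v : Δ.Ray) (u : dualMonoid (Δ.rayCone v).1) : 0 ≤ u.1 v.1 := by
  have := u.2 _ (Submodule.mem_span_singleton_self _)
  rw [pairing_latticeVec] at this
  exact_mod_cast this

instance rayIdeal_isPrime (v : Δ.Ray) : (rayIdeal k Δ v).IsPrime := by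
  classical
  let R := ChartRing k (Δ.rayCone v).1
  let e : Multiplicative (dualMonoid (Δ.rayCone v).1) →* R :=
    { toFun := fun u => if u.toAdd.1 v.1 = 0 then .single u.toAdd 1 else 0
      map_one' := by simp; rfl
      map_mul' := fun x y => by
        have hx := nonneg_of_mem_rayCone Δ v x.toAdd
        have hy := nonneg_of_mem_rayCone Δ v y.toAdd
        by_cases h1 : x.toAdd.1 v.1 = 0
        · by_cases h2 : y.toAdd.1 v.1 = 0
          · simp only [toAdd_mul, AddSubmonoid.coe_add, LinearMap.add_apply, h1, h2, add_zero,
              if_true]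
            rw [AddMonoidAlgebra.single_mul_single, mul_one]
          · simp [h1, h2]
        · have : x.toAdd.1 v.1 + y.toAdd.1 v.1 ≠ 0 := by omega
          simp [h1, this] }
  let E : R →ₐ[k] R := AddMonoidAlgebra.lift k R _ e
  have hE : ∀ u c, E (.single u c) = if u.1 v.1 = 0 then .single u c else 0 := by
    intro u c
    have : E (.single u c) = c • e (Multiplicative.ofAdd u) := AddMonoidAlgebra.lift_single _ _ _
    rw [this]
    change c • (if u.1 v.1 = 0 then (.single u 1 : R) else 0) = _
    split_ifs
    · rw [AddMonoidAlgebra.smul_single, smul_eq_mul, mul_one]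
    · rw [smul_zero]
  have hsub : ∀ x : R, x - E x ∈ rayIdeal k Δ v := by
    intro x
    induction x using AddMonoidAlgebra.induction_on with
    | of u =>
      rw [AddMonoidAlgebra.of_apply, hE]
      split_ifs with h
      · rw [sub_self]; exact zero_mem _
      · rw [sub_zero]
        refine Ideal.subset_span ⟨_, ?_, rfl⟩
        exact lt_of_le_of_ne (nonneg_of_mem_rayCone Δ v _) (Ne.symm h)
    | add x y hx hy =>
      rw [map_add, add_sub_add_comm]; exact add_mem hx hy
    | smul r x hx =>
      rw [map_smul, ← smul_sub]
      rw [Algebra.smul_def]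
      exact Ideal.mul_mem_left _ _ hx
  have : rayIdeal k Δ v = RingHom.ker E.toRingHom := by
    refine le_antisymm (Ideal.span_le.mpr ?_) fun x hx => ?_
    · rintro _ ⟨u, hu, rfl⟩
      change E _ = 0
      rw [hE, if_neg hu.ne']
    · have h0 : E x = 0 := hx
      have := hsub x
      rwa [h0, sub_zero] at this
  rw [this]
  exact RingHom.ker_isPrime _

end Rays

section Divisors

variable {X : Scheme.{u}} [AlgebraicGeometry.IsIntegral X] [IsLocallyNoetherian X]

/-- The sections over `U` of the sheaf `O_X(D)` associated to a Weil divisor `D`: the rational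
functions `f` with `f = 0` or `div f + D ≥ 0` on `U`. Only the coefficients of `D` at points of
codimension one are used. -/
def divisorSections (D : AlgebraicCycle X ℤ) (U : X.Opens) : Set X.functionField :=
  {f | f = 0 ∨ ∀ z ∈ U, Order.coheight z = 1 → 0 ≤ Scheme.ord f z + D z}

/-- The rational function `g` generates `O_X(D)` on a neighbourhood of `x`, i.e. `O_X(D)` agrees
with `g O_X` as a subsheaf of the sheaf of rational functions there. -/
def GeneratesAt (D : AlgebraicCycle X ℤ) (x : X) (g : X.functionField) : Prop :=
  ∃ U : X.Opens, x ∈ U ∧ ∀ V ≤ U, ∀ f : X.functionField,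
    f ∈ divisorSections D V ↔
      ∀ y ∈ V, ∃ r : X.presheaf.stalk y, f = algebraMap (X.presheaf.stalk y) X.functionField r * g

/-- `D` is ample: `X` is quasi-compact, `O_X(D)` is a line bundle, and every point `x` lies in an
affine open set of the form `X_s = {y | s generates O_X(nD) at y}` with `n ≥ 1` and `s` a global
section of `O_X(nD) = O_X(D)^{⊗ n}`. -/
structure IsAmple (D : AlgebraicCycle X ℤ) : Prop where
  compactSpace : CompactSpace X
  isLineBundle : ∀ x : X, ∃ g : X.functionField, GeneratesAt D x g
  exists_affine : ∀ x : X, ∃ n : ℕ, 0 < n ∧ ∃ s ∈ divisorSections (n • D) ⊤,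
    ∃ U : X.Opens, IsAffineOpen U ∧ x ∈ U ∧ ∀ y, y ∈ U ↔ GeneratesAt (n • D) y s

end Divisors

section Cox

variable (k : Type u) [Field k] {N : Type u} [AddCommGroup N] [Module.Free ℤ N]
  [Module.Finite ℤ N] (Δ : Fan N)

/-- The generic point of the torus-invariant prime divisor `Y(v)` of `X(Δ)`. -/
noncomputable def divisorPoint (v : Δ.Ray) : toricVariety k Δ :=
  chart k Δ (Δ.rayCone v) (⟨rayIdeal k Δ v, inferInstance⟩ : PrimeSpectrum _)

open Classical in
/-- The torus-invariant Weil divisor `∑ a_v Y(v)` on `X(Δ)`. -/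
noncomputable def toricDivisor (a : Δ.Ray → ℤ) : AlgebraicCycle (toricVariety k Δ) ℤ :=
  ∑ v, Function.locallyFinsuppWithin.single (divisorPoint k Δ v) (a v)

/-- The Cox ring of `X(Δ)`: the polynomial ring on the rays of the fan. -/
abbrev CoxRing : Type u := MvPolynomial Δ.Ray k

open Classical in
/-- The irrelevant ideal `J_X`, generated by the monomials `v^{σ̄} = ∏_{v ∉ σ} v`, `σ ∈ Δ`. -/
noncomputable def irrelevantIdeal : Ideal (CoxRing k Δ) :=
  Ideal.span (Set.range fun σ : Δ.Cone =>
    ∏ v with latticeVec v.1 ∉ σ.1, (MvPolynomial.X v : CoxRing k Δ))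

instance chart_image_nonempty (σ : Δ.Cone) : Nonempty ↥(chart k Δ σ ''ᵁ ⊤) := by
  obtain ⟨y⟩ : Nonempty (Spec (.of (ChartRing k σ.1))) := inferInstance
  exact ⟨⟨_, y, trivial, rfl⟩⟩

/-- Regular functions on the chart `U_σ`, as rational functions on `X(Δ)`. For `σ = {0}` this is
the map from the Laurent polynomial ring `k[M]` to the function field of `X(Δ)`. -/
noncomputable def chartToFunctionField (σ : Δ.Cone) :
    ChartRing k σ.1 →+* (toricVariety k Δ).functionField :=
  haveI : Nonempty (chart k Δ σ ''ᵁ ⊤) := chart_image_nonempty k Δ σ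
  (((Scheme.ΓSpecIso (.of (ChartRing k σ.1))).inv ≫ ((chart k Δ σ).appIso ⊤).inv) ≫
    (toricVariety k Δ).germToFunctionField (chart k Δ σ ''ᵁ ⊤)).hom

/-- Homogenization with respect to `∑ a_v Y(v)`: the `k`-linear map from `k[M]` to the Cox ring
sending a character `x^u` with `⟨u, v⟩ + a_v ≥ 0` for all rays `v` to `∏ v^(⟨u, v⟩ + a_v)`.
(It is only used on combinations of such characters.) -/
noncomputable def homogenize (a : Δ.Ray → ℤ) (p : ChartRing k Δ.zeroCone.1) : CoxRing k Δ :=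
  p.coeff.sum fun u c =>
    MvPolynomial.monomial (Finsupp.equivFunOnFinite.symm fun v => (u.1 v.1 + a v).toNat) c

/-- The ideal of the Cox ring generated by the images of the global sections of `O_X(D)`, where
`D = ∑ a_v Y(v) + div g`: a section `f` of `O_X(D)` gives the section `f g` of
`O_X(∑ a_v Y(v))`, which is a Laurent polynomial and is then homogenized. -/
noncomputable def sectionIdeal (D : AlgebraicCycle (toricVariety k Δ) ℤ) (a : Δ.Ray → ℤ)
    (g : (toricVariety k Δ).functionField) : Ideal (CoxRing k Δ) :=
  Ideal.span {F | ∃ f ∈ divisorSections D ⊤, ∃ p : ChartRing k Δ.zeroCone.1,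
    chartToFunctionField k Δ Δ.zeroCone p = f * g ∧ F = homogenize k Δ a p}

end Cox

end Toric

set_option linter.unusedSectionVars false

namespace Toric

open CategoryTheory AlgebraicGeometry TensorProduct

/-! ### Rational cones: supporting functionals, faces and rays. -/

section Convex

variable {N : Type u} [AddCommGroup N] [Module.Free ℤ N] [Module.Finite ℤ N]

/-! Multiplication by `g` identifies `O_X(D)` with `O_X(D')`, where `D' = ∑ a_v Y(v)`, so `g` drops
out (`mul_mem_divisorSections_iff`, `IsAmple.of_linearEquiv`). Global sections of `O_X(D')` are
Laurent polynomials with exponents in the polytope `P = {u | ⟨u, v⟩ + a_v ≥ 0 for all v}`, and each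
character with exponent in `P` is a section. The theorem thus becomes a question about the monomials
`∏ v^(⟨u, v⟩ + a_v)`, `u ∈ P`: on which sets of rays can `⟨u, v⟩ = -a_v` hold simultaneously?

Geometry supplies three facts. Properness gives completeness of the fan: every weight on `M`, with
values in any ordered group, is nonnegative on some `σ^∨ ∩ M` (`exists_cone_weight_nonneg`). Since
`O_X(D')` is a line bundle, each `σ` has an integral `u` with `⟨u, v⟩ = -a_v` on its rays
(`exists_exponent_eq_of_isLineBundle`). Ampleness gives strict convexity: for some `n > 0` there is
`u` with `⟨u, v⟩ = -n a_v` on the rays of `σ` and `⟨u, v⟩ > -n a_v` on all others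
(`exists_exponent_of_isAmple`). The last two replace rational functions by characters without a
torus action: at the distinguished point of `U_σ`, if a sum of regular monomial terms is a unit in
the local ring, one of the terms is (`exists_exponent_eq`).

The rest is combinatorial (`irrelevantIdeal_eq_radical_span`). The ideal `J_X` is generated by
squarefree monomials, hence radical. If `u ∈ P`, completeness finds a cone `σ` for the sum of the
rays with `⟨u, v⟩ = -a_v`; strict convexity forces these rays into `σ`, so the monomial of `u` is a
multiple of the generator of `σ`. Conversely, push the sum of the rays of `σ` infinitesimally in a
generic direction and let `σ'` be a cone for the resulting weight. The character attached to `σ'`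
lies in `P` and attains equality on all rays of `σ`, so its monomial divides a power of the
generator of `σ`. -/

lemma eq_of_forall_dual_eq {v w : N} (h : ∀ u : Module.Dual ℤ N, u v = u w) : v = w :=
  sub_eq_zero.mp ((Module.forall_dual_apply_eq_zero_iff ℤ _).mp fun u => by
    rw [map_sub, h, sub_self])

lemma latticeVec_eq_zero {v : N} : latticeVec v = 0 ↔ v = 0 := by
  refine ⟨fun h => (Module.forall_dual_apply_eq_zero_iff ℤ _).mp fun u => ?_, fun h => ?_⟩
  · have := pairing_latticeVec u v
    rw [h, map_zero] at this
    exact_mod_cast this.symm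
  · rw [h, latticeVec, TensorProduct.tmul_zero]

lemma nonneg_of_mem_dualMonoid {σ : PointedCone ℝ (ℝ ⊗[ℤ] N)} {u : Module.Dual ℤ N}
    (hu : u ∈ dualMonoid σ) {v : N} (hv : latticeVec v ∈ σ) : 0 ≤ u v := by
  have := hu _ hv
  rw [pairing_latticeVec] at this
  exact_mod_cast this

/-- The intersection of a cone with the hyperplane `w = 0`. -/
noncomputable def faceCone (σ : PointedCone ℝ (ℝ ⊗[ℤ] N)) (w : Module.Dual ℤ N) :
    PointedCone ℝ (ℝ ⊗[ℤ] N) :=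
  σ ⊓ (LinearMap.ker (pairing w)).restrictScalars _

lemma mem_faceCone {σ : PointedCone ℝ (ℝ ⊗[ℤ] N)} {w : Module.Dual ℤ N} {x : ℝ ⊗[ℤ] N} :
    x ∈ faceCone σ w ↔ x ∈ σ ∧ pairing w x = 0 := Iff.rfl

lemma latticeVec_mem_faceCone {σ : PointedCone ℝ (ℝ ⊗[ℤ] N)} {w : Module.Dual ℤ N} {v : N} :
    latticeVec v ∈ faceCone σ w ↔ latticeVec v ∈ σ ∧ w v = 0 := by
  rw [mem_faceCone, pairing_latticeVec]; norm_cast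

lemma Fan.faceCone_mem (Δ : Fan N) {σ : PointedCone ℝ (ℝ ⊗[ℤ] N)} (hσ : σ ∈ Δ.cones)
    {w : Module.Dual ℤ N} (hw : w ∈ dualMonoid σ) : faceCone σ w ∈ Δ.cones :=
  Δ.face_mem σ hσ _ ⟨pairing w, hw, fun _ => mem_faceCone⟩

/-- Strong convexity in usable form: `{0}` is a face of every cone of the fan, hence cut out by an
integral functional. -/
lemma Fan.exists_strictly_positive (Δ : Fan N) {σ : PointedCone ℝ (ℝ ⊗[ℤ] N)}
    (hσ : σ ∈ Δ.cones) :
    ∃ u ∈ dualMonoid σ, ∀ v : N, latticeVec v ∈ σ → v ≠ 0 → 0 < u v := by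
  obtain ⟨u, hu, h⟩ := (Δ.isFace_of_le (τ := Δ.zeroCone) (σ := ⟨σ, hσ⟩) (bot_le (a := σ))).exists_dual
    (Δ.rational _ hσ)
  refine ⟨u, hu, fun v hv hv0 => lt_of_le_of_ne (nonneg_of_mem_dualMonoid hu hv) fun h0 => hv0 ?_⟩
  rw [← latticeVec_eq_zero]
  have : latticeVec v ∈ (⊥ : PointedCone ℝ (ℝ ⊗[ℤ] N)) := (h _).mpr ⟨hv, by
    rw [pairing_latticeVec, ← h0, Int.cast_zero]⟩
  exact (Submodule.mem_bot _).mp this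

/-- Minimizing `m / u` over the nonzero generators of a cone yields a supporting functional. -/
lemma exists_min_ratio {s : Finset N} {u : Module.Dual ℤ N} (hu : ∀ v ∈ s, v ≠ 0 → 0 < u v)
    {v₀ : N} (hv₀ : v₀ ∈ s) (h0 : v₀ ≠ 0) (m : Module.Dual ℤ N) :
    ∃ v ∈ s, v ≠ 0 ∧ m v * u v₀ ≤ m v₀ * u v ∧
      u v • m - m v • u ∈ dualMonoid (PointedCone.hull ℝ (latticeVec '' (s : Set N))) := by
  classical
  obtain ⟨v, hv, hmin⟩ := (s.filter (· ≠ 0)).exists_min_image (fun v => (m v : ℚ) / u v)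
    ⟨v₀, Finset.mem_filter.mpr ⟨hv₀, h0⟩⟩
  rw [Finset.mem_filter] at hv
  have key : ∀ w ∈ s, w ≠ 0 → m v * u w ≤ m w * u v := by
    intro w hw hw0
    have h := hmin w (Finset.mem_filter.mpr ⟨hw, hw0⟩)
    have h1 : (0 : ℚ) < u v := by exact_mod_cast hu v hv.1 hv.2
    have h2 : (0 : ℚ) < u w := by exact_mod_cast hu w hw hw0
    rw [div_le_div_iff₀ h1 h2] at h
    exact_mod_cast h
  refine ⟨v, hv.1, hv.2, key v₀ hv₀ h0, mem_dualMonoid_hull.mpr fun w hw => ?_⟩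
  by_cases hw0 : w = 0
  · simp [hw0]
  · have := key w hw hw0
    simp only [LinearMap.sub_apply, LinearMap.smul_apply, smul_eq_mul]
    linarith [mul_comm (u v) (m w)]

/-- The values of all functionals at `v` form an ideal generated by the gcd `d` of the coordinates.
The quotient `v / d` is primitive because `d` itself is a value at `v`. -/
lemma exists_primitive {v : N} (hv : v ≠ 0) :
    ∃ w : N, IsPrimitiveVec w ∧ ∃ d : ℤ, 0 < d ∧ v = d • w := by
  let b := Module.finBasis ℤ N
  let I : Ideal ℤ := LinearMap.range (LinearMap.applyₗ (R := ℤ) (M₂ := ℤ) v)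
  obtain ⟨n, hn⟩ := (IsPrincipalIdealRing.principal I).principal
  have hI : I = Ideal.span {|n|} := by
    rw [hn]; exact (Ideal.span_singleton_eq_span_singleton.mpr (by simp))
  have hc : ∀ i, ∃ c : ℤ, c * |n| = b.coord i v := by
    intro i
    have : b.coord i v ∈ I := ⟨b.coord i, rfl⟩
    rw [hI] at this
    exact Ideal.mem_span_singleton'.mp this
  choose c hc using hc
  have hvw : v = |n| • ∑ i, c i • b i := by
    rw [Finset.smul_sum]
    conv_lhs => rw [← b.sum_repr v]
    refine Finset.sum_congr rfl fun i _ => ?_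
    rw [smul_smul, mul_comm, hc]; rfl
  have hd : 0 < |n| := by
    refine lt_of_le_of_ne (abs_nonneg _) fun h => hv ?_
    rw [hvw, ← h, zero_smul]
  obtain ⟨u, hu⟩ : |n| ∈ I := hI ▸ Ideal.mem_span_singleton_self _
  refine ⟨_, fun k w hw => ?_, |n|, hd, hvw⟩
  have h1 : u v = |n| := hu
  rw [hvw, hw, map_smul, map_smul, smul_eq_mul, smul_eq_mul] at h1
  exact IsUnit.of_mul_eq_one (u w) (mul_left_cancel₀ hd.ne' (by rw [h1, mul_one]))

lemma hull_singleton_smul {w : N} {d : ℤ} (hd : 0 < d) :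
    PointedCone.hull ℝ {latticeVec (d • w)} = PointedCone.hull ℝ {latticeVec w} := by
  have h : latticeVec (d • w) = (d : ℝ) • latticeVec w := by
    rw [latticeVec, latticeVec, TensorProduct.tmul_smul, Int.cast_smul_eq_zsmul]
  rw [h]
  have hd' : (0 : ℝ) < d := by exact_mod_cast hd
  refine le_antisymm (Submodule.span_le.mpr ?_) (Submodule.span_le.mpr ?_)
  · rintro _ rfl
    exact Submodule.smul_mem _ (⟨(d : ℝ), hd'.le⟩ : {x : ℝ // 0 ≤ x})
      (Submodule.mem_span_singleton_self _)
  · rintro _ rfl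
    have := Submodule.smul_mem _ (⟨(d : ℝ)⁻¹, (inv_pos.mpr hd').le⟩ : {x : ℝ // 0 ≤ x})
      (Submodule.mem_span_singleton_self (R := {x : ℝ // 0 ≤ x}) ((d : ℝ) • latticeVec w))
    change (d : ℝ)⁻¹ • (d : ℝ) • latticeVec w ∈ _ at this
    rwa [smul_smul, inv_mul_cancel₀ hd'.ne', one_smul] at this

/-- Every nonzero cone of a fan contains a ray of the fan. -/
lemma Fan.exists_ray_mem (Δ : Fan N) {σ : PointedCone ℝ (ℝ ⊗[ℤ] N)} (hσ : σ ∈ Δ.cones)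
    (h0 : σ ≠ ⊥) : ∃ v : Δ.Ray, latticeVec v.1 ∈ σ := by
  have hfin : {τ | τ ∈ Δ.cones ∧ τ ≠ ⊥}.Finite := Δ.finite.subset fun _ h => h.1
  -- A minimal nonzero cone `τ` of the fan below `σ` will turn out to be a ray.
  obtain ⟨τ, hτσ, ⟨hτ, hτ0⟩, hmin⟩ := hfin.exists_le_minimal ⟨hσ, h0⟩
  obtain ⟨s, hs⟩ := Δ.rational τ hτ
  have hsτ : ∀ v ∈ s, latticeVec v ∈ τ := fun v hv => hs ▸ Submodule.subset_span ⟨v, hv, rfl⟩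
  obtain ⟨u, hu, hpos⟩ := Δ.exists_strictly_positive hτ
  have hpos' : ∀ v ∈ s, v ≠ 0 → 0 < u v := fun v hv => hpos v (hsτ v hv)
  obtain ⟨v₁, hv₁, hv₁0⟩ : ∃ v ∈ s, v ≠ 0 := by
    by_contra! h
    refine hτ0 (hs.trans (Submodule.span_eq_bot.mpr ?_))
    rintro _ ⟨v, hv, rfl⟩
    exact latticeVec_eq_zero.mpr (h v hv)
  -- Every `m` is proportional to `u` on `τ`: the face where `m / u` is minimal is a nonzero cone of
  -- the fan, so by minimality it is all of `τ`. Hence the generators of `τ` are proportional to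
  -- each other.
  have hprop : ∀ v ∈ s, v ≠ 0 → ∀ m : Module.Dual ℤ N, u v₁ * m v = u v * m v₁ := by
    intro v hv hv0 m
    obtain ⟨w, hw, hw0, -, hd⟩ := exists_min_ratio hpos' hv₁ hv₁0 m
    rw [← hs] at hd
    have hwτ : latticeVec w ∈ faceCone τ (u w • m - m w • u) := by
      rw [latticeVec_mem_faceCone]
      refine ⟨hsτ w hw, ?_⟩
      simp [mul_comm]
    have hle := hmin (y := faceCone τ (u w • m - m w • u)) ⟨Δ.faceCone_mem hτ hd, fun h => hw0 (by
      rw [h] at hwτ; exact latticeVec_eq_zero.mp ((Submodule.mem_bot _).mp hwτ))⟩ inf_le_left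
    have e : ∀ x ∈ s, u w * m x = m w * u x := by
      intro x hx
      have := (latticeVec_mem_faceCone.mp (hle (hsτ x hx))).2
      simp only [LinearMap.sub_apply, LinearMap.smul_apply, smul_eq_mul] at this
      linarith
    have h1 := e v hv
    have h2 := e v₁ hv₁
    have := (hpos' w hw hw0).ne'
    apply mul_left_cancel₀ this
    linear_combination u v₁ * h1 - u v * h2
  have hτ1 : τ = PointedCone.hull ℝ {latticeVec v₁} := by
    refine le_antisymm ?_ (Submodule.span_le.mpr ?_)
    · rw [hs]
      refine Submodule.span_le.mpr ?_
      rintro _ ⟨v, hv, rfl⟩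
      by_cases hv0 : v = 0
      · rw [hv0, (latticeVec_eq_zero (N := N)).mpr rfl]; exact SetLike.mem_coe.mpr (Submodule.zero_mem _)
      · have h : u v₁ • v = u v • v₁ := eq_of_forall_dual_eq fun (m : Module.Dual ℤ N) => by
          simpa using hprop v hv hv0 m
        rw [← hull_singleton_smul (hpos' v hv hv0), ← h,
          hull_singleton_smul (hpos' v₁ hv₁ hv₁0)]
        exact Submodule.mem_span_singleton_self _
    · rintro _ rfl
      exact hsτ v₁ hv₁
  obtain ⟨w, hw, d, hd, rfl⟩ := exists_primitive hv₁0
  rw [hull_singleton_smul hd] at hτ1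
  have hwτ : latticeVec w ∈ τ := by
    rw [hτ1]
    exact Submodule.mem_span_singleton_self _
  exact ⟨⟨w, hw, hτ1 ▸ hτ⟩, hτσ hwτ⟩

lemma IsPrimitiveVec.ne_zero {v : N} (hv : IsPrimitiveVec v) : v ≠ 0 := by
  rintro rfl
  obtain ⟨u, hu⟩ := hv.exists_dual
  simp at hu

/-- A cone of a fan is generated by its rays, in the dual formulation. -/
lemma Fan.mem_dualMonoid_iff (Δ : Fan N) {σ : PointedCone ℝ (ℝ ⊗[ℤ] N)} (hσ : σ ∈ Δ.cones)
    {m : Module.Dual ℤ N} :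
    m ∈ dualMonoid σ ↔ ∀ v : Δ.Ray, latticeVec v.1 ∈ σ → 0 ≤ m v.1 := by
  refine ⟨fun h v hv => nonneg_of_mem_dualMonoid h hv, fun hm => ?_⟩
  obtain ⟨s, hs⟩ := Δ.rational σ hσ
  have hsσ : ∀ v ∈ s, latticeVec v ∈ σ := fun v hv => hs ▸ Submodule.subset_span ⟨v, hv, rfl⟩
  obtain ⟨u, hu, hpos⟩ := Δ.exists_strictly_positive hσ
  have hpos' : ∀ v ∈ s, v ≠ 0 → 0 < u v := fun v hv => hpos v (hsσ v hv)
  rw [hs, mem_dualMonoid_hull]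
  intro v₀ hv₀
  by_contra! hneg
  have hv₀0 : v₀ ≠ 0 := by rintro rfl; simp at hneg
  obtain ⟨v, hv, hv0, hle, hd⟩ := exists_min_ratio hpos' hv₀ hv₀0 m
  rw [← hs] at hd
  have hmem : latticeVec v ∈ faceCone σ (u v • m - m v • u) := by
    rw [latticeVec_mem_faceCone]
    exact ⟨hsσ v hv, by simp [mul_comm]⟩
  -- On the face where `m / u` attains its negative minimum, `m` is negative at every nonzero
  -- lattice vector; a ray in that face contradicts `hm`.
  obtain ⟨r, hr⟩ := Δ.exists_ray_mem (Δ.faceCone_mem hσ hd) (fun h => hv0 (by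
      rw [h] at hmem; exact latticeVec_eq_zero.mp ((Submodule.mem_bot _).mp hmem)))
  obtain ⟨hrσ, hr0⟩ := latticeVec_mem_faceCone.mp hr
  simp only [LinearMap.sub_apply, LinearMap.smul_apply, smul_eq_mul] at hr0
  have h1 := hm r hrσ
  have h2 := hpos r.1 hrσ r.2.1.ne_zero
  have h3 := hpos' v hv hv0
  have h4 := hpos' v₀ hv₀ hv₀0
  have h5 : m v < 0 := by
    by_contra! h
    nlinarith [mul_nonneg h h4.le, mul_pos_of_neg_of_neg hneg (neg_neg_of_pos h3)]
  nlinarith [mul_nonneg h3.le h1, mul_pos_of_neg_of_neg h5 (neg_neg_of_pos h2)]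

end Convex

/-! ### The irrelevant ideal and the combinatorial core. -/

section Irrelevant

variable (k : Type u) [Field k] {N : Type u} [AddCommGroup N] [Module.Free ℤ N]
  [Module.Finite ℤ N] (Δ : Fan N)

open Classical in
/-- The exponent vector of the monomial `∏_{v ∉ σ} v`. -/
noncomputable def offExponent (σ : Δ.Cone) : Δ.Ray →₀ ℕ :=
  Finsupp.equivFunOnFinite.symm fun v => if latticeVec v.1 ∉ σ.1 then 1 else 0

open Classical in
lemma prod_X_eq_monomial (σ : Δ.Cone) :
    ∏ v with latticeVec v.1 ∉ σ.1, (MvPolynomial.X v : CoxRing k Δ) =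
      MvPolynomial.monomial (offExponent Δ σ) 1 := by
  rw [MvPolynomial.monomial_eq, map_one, one_mul, Finsupp.prod_fintype _ _ (fun _ => pow_zero _),
    Finset.prod_filter]
  refine Finset.prod_congr rfl fun v _ => ?_
  simp only [offExponent, Finsupp.equivFunOnFinite_symm_apply_apply]
  split_ifs <;> simp

lemma irrelevantIdeal_eq : irrelevantIdeal k Δ =
    Ideal.span ((fun e => MvPolynomial.monomial e (1 : k)) '' Set.range (offExponent Δ)) := by
  rw [irrelevantIdeal, ← Set.range_comp]
  congr 2
  funext σ
  exact prod_X_eq_monomial k Δ σ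

variable {k Δ}

lemma offExponent_le_iff {σ : Δ.Cone} {e : Δ.Ray →₀ ℕ} :
    offExponent Δ σ ≤ e ↔ ∀ v, latticeVec v.1 ∉ σ.1 → e v ≠ 0 := by
  rw [Finsupp.le_def]
  refine forall_congr' fun v => ?_
  simp only [offExponent, Finsupp.equivFunOnFinite_symm_apply_apply]
  split_ifs with h
  · simp [h]
  · simp [h, Nat.one_le_iff_ne_zero]

lemma mem_irrelevantIdeal {F : CoxRing k Δ} :
    F ∈ irrelevantIdeal k Δ ↔
      ∀ e ∈ F.support, ∃ σ : Δ.Cone, ∀ v, latticeVec v.1 ∉ σ.1 → e v ≠ 0 := by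
  rw [irrelevantIdeal_eq, MvPolynomial.mem_ideal_span_monomial_image]
  simp [offExponent_le_iff]

/-- The generators are squarefree. If a monomial `e` of `F` is divisible by no generator, setting
the variables absent from `e` to zero kills the ideal but keeps the coefficient of `F` at `e`; as
the target is a domain, no power of `F` is killed. -/
lemma irrelevantIdeal_isRadical : (irrelevantIdeal k Δ).IsRadical := by
  classical
  rintro F ⟨n, hn⟩
  by_contra hF
  rw [mem_irrelevantIdeal] at hF
  push Not at hF
  obtain ⟨e, he, hbad⟩ := hF
  let ψ : CoxRing k Δ →ₐ[k] CoxRing k Δ :=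
    MvPolynomial.aeval fun v => if e v = 0 then 0 else MvPolynomial.X v
  have hψ : ∀ (d : Δ.Ray →₀ ℕ) (c : k), ψ (MvPolynomial.monomial d c) =
      if ∃ v, e v = 0 ∧ d v ≠ 0 then 0 else MvPolynomial.monomial d c := by
    intro d c
    rw [MvPolynomial.aeval_monomial, MvPolynomial.algebraMap_eq,
      Finsupp.prod_fintype _ _ (fun _ => pow_zero _)]
    split_ifs with h
    · obtain ⟨v, hv, hd⟩ := h
      rw [Finset.prod_eq_zero (Finset.mem_univ v) (by rw [if_pos hv, zero_pow hd]), mul_zero]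
    · push Not at h
      rw [MvPolynomial.monomial_eq, Finsupp.prod_fintype _ _ (fun _ => pow_zero _)]
      congr 1
      refine Finset.prod_congr rfl fun v _ => ?_
      by_cases hv : e v = 0
      · rw [h v hv, pow_zero, pow_zero]
      · rw [if_neg hv]
  have hcoeff : (ψ F).coeff e = F.coeff e := by
    conv_lhs => rw [F.as_sum, map_sum, MvPolynomial.coeff_sum]
    rw [Finset.sum_eq_single e]
    · rw [hψ, if_neg (by push Not; exact fun v hv => hv), MvPolynomial.coeff_monomial, if_pos rfl]
    · intro d _ hd
      rw [hψ]
      split_ifs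
      · rw [MvPolynomial.coeff_zero]
      · rw [MvPolynomial.coeff_monomial, if_neg hd]
    · exact fun h => absurd he h
  have h0 : ψ (F ^ n) = 0 := by
    have hle : irrelevantIdeal k Δ ≤ RingHom.ker ψ := by
      rw [irrelevantIdeal_eq, Ideal.span_le]
      rintro _ ⟨_, ⟨σ, rfl⟩, rfl⟩
      rw [SetLike.mem_coe, RingHom.mem_ker, hψ, if_pos]
      obtain ⟨v, hv, hv0⟩ := hbad σ
      exact ⟨v, hv0, by simp [offExponent, hv]⟩
    exact hle hn
  rw [map_pow] at h0
  have h1 : ψ F = 0 := by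
    by_contra hne
    exact pow_ne_zero n hne h0
  exact MvPolynomial.mem_support_iff.mp he (hcoeff.symm.trans (by rw [h1, MvPolynomial.coeff_zero]))

lemma coeff_homogenize_ne_zero {a : Δ.Ray → ℤ} {p : ChartRing k Δ.zeroCone.1} {e : Δ.Ray →₀ ℕ}
    (he : e ∈ (homogenize k Δ a p).support) :
    ∃ u ∈ p.coeff.support, ∀ v, e v = (u.1 v.1 + a v).toNat := by
  classical
  obtain ⟨u, hu, he'⟩ := Finset.mem_biUnion.mp (MvPolynomial.support_sum he)
  have h1 := MvPolynomial.support_monomial_subset he'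
  rw [Finset.mem_singleton] at h1
  exact ⟨u, hu, fun v => by rw [h1]; rfl⟩

/-- `w` is a sum of rays on which `u` and the support function of `σ` agree; if `u` dominates the
latter on `σ`, then `u` and the support function agree at all these rays. -/
lemma eq_of_sum_eq (S : Finset Δ.Ray) (m : Module.Dual ℤ N) (h1 : ∀ v ∈ S, m v.1 ≤ 0)
    (h2 : 0 ≤ m (∑ v ∈ S, v.1)) : ∀ v ∈ S, m v.1 = 0 := by
  rw [map_sum] at h2
  exact (Finset.sum_eq_zero_iff_of_nonpos h1).mp (le_antisymm (Finset.sum_nonpos h1) h2)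

/-- The combinatorial core: the irrelevant ideal is the radical of the ideal generated by the
homogenizations of a set of Laurent polynomials whose exponents are the lattice points of the
polytope of a strictly convex support function on a complete fan. -/
theorem irrelevantIdeal_eq_radical_span (a : Δ.Ray → ℤ) (P : Set (ChartRing k Δ.zeroCone.1))
    (hP : ∀ p ∈ P, ∀ u ∈ p.coeff.support, ∀ v : Δ.Ray, 0 ≤ u.1 v.1 + a v)
    (hP' : ∀ u : dualMonoid Δ.zeroCone.1, (∀ v : Δ.Ray, 0 ≤ u.1 v.1 + a v) →
      AddMonoidAlgebra.single u 1 ∈ P)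
    (hample : ∀ σ : Δ.Cone, ∃ n : ℕ, 0 < n ∧ ∃ u : Module.Dual ℤ N,
      (∀ v : Δ.Ray, latticeVec v.1 ∈ σ.1 → u v.1 = -(n * a v)) ∧
      ∀ v : Δ.Ray, latticeVec v.1 ∉ σ.1 → -(n * a v) < u v.1)
    (hcartier : ∀ σ : Δ.Cone, ∃ u : Module.Dual ℤ N,
      ∀ v : Δ.Ray, latticeVec v.1 ∈ σ.1 → u v.1 = -a v)
    (hcomplete : ∀ (Γ : Type) [AddCommGroup Γ] [LinearOrder Γ] [IsOrderedAddMonoid Γ]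
      (φ : Module.Dual ℤ N →+ Γ), ∃ σ : Δ.Cone, ∀ u ∈ dualMonoid σ.1, 0 ≤ φ u) :
    irrelevantIdeal k Δ =
      (Ideal.span {F | ∃ p ∈ P, F = homogenize k Δ a p}).radical := by
  classical
  refine le_antisymm ?_ (irrelevantIdeal_isRadical.radical_le_iff.mpr (Ideal.span_le.mpr ?_))
  · rw [irrelevantIdeal_eq, Ideal.span_le]
    rintro _ ⟨_, ⟨σ, rfl⟩, rfl⟩
    let S : Finset Δ.Ray := Finset.univ.filter fun v => latticeVec v.1 ∈ σ.1
    let w : N := ∑ v ∈ S, v.1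
    let b := Module.finBasis ℤ N
    -- The weight of `w` plus an infinitesimal generic perturbation: the lexicographic tie-break by
    -- coordinates makes `φ` injective, which plays the role of `σ'` being full-dimensional.
    let φ : Module.Dual ℤ N →+ ℤ ×ₗ Lex (Fin (Module.finrank ℤ N) → ℤ) :=
      { toFun := fun u => toLex (u w, toLex fun i => u (b i))
        map_zero' := rfl
        map_add' := fun _ _ => rfl }
    obtain ⟨σ', hσ'⟩ := hcomplete _ φ
    have hφ : ∀ u, φ u = 0 → u = 0 := fun u h => b.ext fun i => by
      have h1 : (ofLex (φ u)).2 = 0 := by rw [h]; rfl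
      exact congrFun h1 i
    obtain ⟨u', hu'⟩ := hcartier σ'
    obtain ⟨n, hn, un, hun, hun'⟩ := hample σ'
    have hn' : (0 : ℤ) < n := by exact_mod_cast hn
    -- The difference vanishes on all rays of `σ'`, so it and its negative lie in the dual monoid;
    -- then `φ` of it is zero. This transfers the strict inequalities of the multiple `n` to `u'`
    -- itself.
    have heq : (n : ℤ) • u' = un := by
      have hz : ∀ v : Δ.Ray, latticeVec v.1 ∈ σ'.1 → ((n : ℤ) • u' - un) v.1 = 0 := by
        intro v hv
        simp only [LinearMap.sub_apply, LinearMap.smul_apply, smul_eq_mul, hu' v hv, hun v hv]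
        ring
      refine sub_eq_zero.mp (hφ _ (le_antisymm ?_ ?_))
      · have := hσ' (-((n : ℤ) • u' - un)) ((Δ.mem_dualMonoid_iff σ'.2).mpr fun v hv => by
          rw [LinearMap.neg_apply, hz v hv, neg_zero])
        rw [map_neg] at this
        exact neg_nonneg.mp this
      · exact hσ' _ ((Δ.mem_dualMonoid_iff σ'.2).mpr fun v hv => (hz v hv).ge)
    have hu'a : ∀ v : Δ.Ray, 0 ≤ u' v.1 + a v := by
      intro v
      by_cases hv : latticeVec v.1 ∈ σ'.1
      · rw [hu' v hv]; simp
      · have := hun' v hv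
        rw [← heq] at this
        simp only [LinearMap.smul_apply, smul_eq_mul] at this
        nlinarith
    -- `um - m u'` is nonnegative on `σ'`, so the leading coordinate of `φ` makes it nonnegative at
    -- `w`. It is nonpositive at each ray of `σ`, and these sum to `w`, so it vanishes at each of
    -- them.
    have hon : ∀ v : Δ.Ray, latticeVec v.1 ∈ σ.1 → u' v.1 + a v = 0 := by
      obtain ⟨m, hm, um, hum, hum'⟩ := hample σ
      have hm' : (0 : ℤ) < m := by exact_mod_cast hm
      have humle : ∀ v, -(m * a v) ≤ um v.1 := fun v => by
        by_cases hv : latticeVec v.1 ∈ σ.1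
        · exact (hum v hv).ge
        · exact (hum' v hv).le
      have hmem : um - (m : ℤ) • u' ∈ dualMonoid σ'.1 :=
        (Δ.mem_dualMonoid_iff σ'.2).mpr fun v hv => by
          have := humle v
          simp only [LinearMap.sub_apply, LinearMap.smul_apply, smul_eq_mul, hu' v hv]
          linarith
      have hw : 0 ≤ (um - (m : ℤ) • u') w := by
        have h := hσ' _ hmem
        by_contra! hlt
        exact absurd h (not_le.mpr (Prod.Lex.toLex_lt_toLex.mpr (Or.inl hlt)))
      intro v hv
      have := eq_of_sum_eq S (um - (m : ℤ) • u') (fun v hv => by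
        have h1 := hum v (Finset.mem_filter.mp hv).2
        have h2 := hu'a v
        simp only [LinearMap.sub_apply, LinearMap.smul_apply, smul_eq_mul, h1]
        nlinarith) hw v (Finset.mem_filter.mpr ⟨Finset.mem_univ _, hv⟩)
      simp only [LinearMap.sub_apply, LinearMap.smul_apply, smul_eq_mul, hum v hv] at this
      have h3 : (m : ℤ) * (u' v.1 + a v) = 0 := by linarith
      exact (mul_eq_zero.mp h3).resolve_left hm'.ne'
    -- A power large enough to dominate every exponent of the monomial of `u'`.
    let d : ℕ := 1 + ∑ v : Δ.Ray, (u' v.1 + a v).toNat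
    refine ⟨d, ?_⟩
    have hzero : u' ∈ dualMonoid Δ.zeroCone.1 := by
      intro x hx
      rw [(Submodule.mem_bot _).mp hx, map_zero]
    have hgen : homogenize k Δ a (AddMonoidAlgebra.single ⟨u', hzero⟩ 1) ∈
        Ideal.span {F | ∃ p ∈ P, F = homogenize k Δ a p} :=
      Ideal.subset_span ⟨_, hP' _ hu'a, rfl⟩
    refine Ideal.mem_of_dvd _ ?_ hgen
    rw [homogenize]
    have hs : (AddMonoidAlgebra.single (⟨u', hzero⟩ : dualMonoid Δ.zeroCone.1) (1 : k)).coeff =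
      Finsupp.single ⟨u', hzero⟩ 1 := rfl
    rw [hs, Finsupp.sum_single_index (by simp), MvPolynomial.monomial_pow, one_pow,
      MvPolynomial.monomial_dvd_monomial]
    refine ⟨Or.inr (Finsupp.le_def.mpr fun v => ?_), dvd_rfl⟩
    simp only [offExponent, Finsupp.smul_apply, Finsupp.equivFunOnFinite_symm_apply_apply]
    split_ifs with hv
    · rw [hon v hv]; simp
    · have := Finset.single_le_sum (f := fun v : Δ.Ray => (u' v.1 + a v).toNat)
        (fun _ _ => Nat.zero_le _) (Finset.mem_univ v)
      simp only [smul_eq_mul, mul_one, d]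
      omega
  · rintro F ⟨p, hp, rfl⟩
    rw [SetLike.mem_coe, mem_irrelevantIdeal]
    intro e he
    obtain ⟨u, hu, hue⟩ := coeff_homogenize_ne_zero he
    have hua := hP p hp u hu
    -- `S` consists of the rays at which the monomial has exponent zero. A cone whose dual monoid is
    -- nonnegative at their sum must contain them: `n u - un` is nonnegative at the sum, nonpositive
    -- on `S`, and strictly negative at any ray of `S` outside `σ`.
    let S : Finset Δ.Ray := Finset.univ.filter fun v => u.1 v.1 + a v = 0
    let w : N := ∑ v ∈ S, v.1
    obtain ⟨σ, hσ⟩ := hcomplete ℤ (LinearMap.applyₗ (R := ℤ) (M₂ := ℤ) w).toAddMonoidHom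
    obtain ⟨n, hn, un, hun, hun'⟩ := hample σ
    have hn' : (0 : ℤ) < n := by exact_mod_cast hn
    refine ⟨σ, fun v hv hev => ?_⟩
    rw [hue] at hev
    have hv0 : u.1 v.1 + a v = 0 := le_antisymm (Int.toNat_eq_zero.mp hev) (hua v)
    have hmem : (n : ℤ) • u.1 - un ∈ dualMonoid σ.1 :=
      (Δ.mem_dualMonoid_iff σ.2).mpr fun v hv => by
        have := hua v
        simp only [LinearMap.sub_apply, LinearMap.smul_apply, smul_eq_mul, hun v hv]
        nlinarith
    have hw : 0 ≤ ((n : ℤ) • u.1 - un) w := hσ _ hmem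
    have hle : ∀ v, -(n * a v) ≤ un v.1 := fun v => by
      by_cases hv : latticeVec v.1 ∈ σ.1
      · exact (hun v hv).ge
      · exact (hun' v hv).le
    have := eq_of_sum_eq S _ (fun v hv => by
        have h1 := hle v
        have h2 := (Finset.mem_filter.mp hv).2
        simp only [LinearMap.sub_apply, LinearMap.smul_apply, smul_eq_mul]
        have h3 : u.1 v.1 = -a v := by linarith
        rw [h3]; linarith) hw v (Finset.mem_filter.mpr ⟨Finset.mem_univ _, hv0⟩)
    simp only [LinearMap.sub_apply, LinearMap.smul_apply, smul_eq_mul] at this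
    have h4 := hun' v hv
    have h3 : u.1 v.1 = -a v := by linarith
    rw [h3] at this
    linarith

end Irrelevant

/-! ### Properness implies completeness, through Hahn series. -/

section Complete

variable (k : Type u) [Field k] {N : Type u} [AddCommGroup N] [Module.Finite ℤ N] (Δ : Fan N)

lemma chart_toSpec (σ : Δ.Cone) : chart k Δ σ ≫ toricVarietyToSpec k Δ =
    Spec.map (CommRingCat.ofHom (algebraMap k (ChartRing k σ.1))) :=
  Limits.colimit.ι_desc _ _

lemma chartMap_chart {τ σ : Δ.Cone} (h : τ ≤ σ) :
    Spec.map (CommRingCat.ofHom (chartMap k h)) ≫ chart k Δ σ = chart k Δ τ :=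
  chartDiagram_map_chart k Δ (homOfLE h)

lemma Fan.zeroCone_le (σ : Δ.Cone) : Δ.zeroCone ≤ σ := bot_le (a := σ.1)

variable {k Δ}

section Hahn

variable {Γ : Type} [AddCommGroup Γ] [LinearOrder Γ] [IsOrderedAddMonoid Γ]

/-- The ring homomorphism from a monoid algebra to Hahn series induced by a weight. -/
noncomputable def weightHom {M : Type u} [AddCommMonoid M] (φ : M →+ Γ) :
    AddMonoidAlgebra k M →ₐ[k] HahnSeries Γ k :=
  AddMonoidAlgebra.lift k _ _
    { toFun := fun u => HahnSeries.single (φ u.toAdd) 1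
      map_one' := by simp
      map_mul' := fun x y => by simp }

lemma weightHom_single {M : Type u} [AddCommMonoid M] (φ : M →+ Γ) (u : M) :
    weightHom (k := k) φ (.single u 1) = HahnSeries.single (φ u) 1 := by
  refine (AddMonoidAlgebra.lift_single _ _ _).trans ?_
  rw [one_smul]; rfl

/-- The Hahn series of nonnegative order. -/
noncomputable abbrev hahnIntegers (Γ : Type) [AddCommGroup Γ] [LinearOrder Γ]
    [IsOrderedAddMonoid Γ] (k : Type u) [Field k] : ValuationSubring (HahnSeries Γ k) :=
  (AddValuation.toValuation (HahnSeries.addVal Γ k)).valuationSubring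

lemma mem_hahnIntegers {x : HahnSeries Γ k} : x ∈ hahnIntegers Γ k ↔ 0 ≤ x.orderTop := by
  rw [← HahnSeries.addVal_apply]; rfl

lemma single_zero_mem_hahnIntegers (c : k) : HahnSeries.single (0 : Γ) c ∈ hahnIntegers Γ k := by
  rw [mem_hahnIntegers]
  by_cases hc : c = 0
  · rw [hc, HahnSeries.single_eq_zero, HahnSeries.orderTop_zero]; exact le_top
  · rw [HahnSeries.orderTop_single hc]; rfl

end Hahn

/-- The valuative criterion for a complete fan: for every weight on `M`, the corresponding monomial
valuation has a centre in one of the charts. -/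
lemma exists_cone_weight_nonneg (hX : IsProper (toricVarietyToSpec k Δ))
    (Γ : Type) [AddCommGroup Γ] [LinearOrder Γ] [IsOrderedAddMonoid Γ]
    (φ : Module.Dual ℤ N →+ Γ) : ∃ σ : Δ.Cone, ∀ u ∈ dualMonoid σ.1, 0 ≤ φ u := by
  let O := hahnIntegers Γ k
  -- The point `x^u ↦ t^(φ u)` of the torus with values in Hahn series; properness extends it over
  -- the valuation ring `O`.
  let ψ : ChartRing k Δ.zeroCone.1 →ₐ[k] HahnSeries Γ k :=
    weightHom (φ.comp (dualMonoid Δ.zeroCone.1).subtype)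
  let c : k →+* O := (HahnSeries.C (Γ := Γ) (R := k)).codRestrict O.toSubring
    fun x => single_zero_mem_hahnIntegers x
  have hex : ValuativeCriterion.Existence (toricVarietyToSpec k Δ) := by
    have : UniversallyClosed (toricVarietyToSpec k Δ) := inferInstance
    rw [UniversallyClosed.eq_valuativeCriterion] at this
    exact this.1
  let S : ValuativeCommSq (toricVarietyToSpec k Δ) :=
    { R := O
      K := HahnSeries Γ k
      i₁ := Spec.map (CommRingCat.ofHom ψ.toRingHom) ≫ chart k Δ Δ.zeroCone
      i₂ := Spec.map (CommRingCat.ofHom c)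
      commSq := ⟨by
        rw [Category.assoc, chart_toSpec, ← Spec.map_comp, ← Spec.map_comp]
        congr 1
        ext x : 2
        change ψ (algebraMap k _ x) = HahnSeries.C x
        rw [AlgHom.commutes]; rfl⟩ }
  obtain ⟨⟨l, hl, -⟩⟩ := (hex S).exists_lift
  change Spec (.of O) ⟶ toricVariety k Δ at l
  change Spec.map (CommRingCat.ofHom (algebraMap O (HahnSeries Γ k))) ≫ l =
    Spec.map (CommRingCat.ofHom ψ.toRingHom) ≫ chart k Δ Δ.zeroCone at hl
  obtain ⟨σ, y, hy⟩ := exists_chart k Δ (l (IsLocalRing.closedPoint O))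
  -- Every point of `Spec O` specializes to the closed point, so a chart containing the image of the
  -- closed point contains the whole image.
  have hrange : Set.range l ⊆ Set.range (chart k Δ σ) := by
    rintro _ ⟨x, rfl⟩
    have h1 : l x ⤳ l (IsLocalRing.closedPoint O) :=
      (IsLocalRing.specializes_closedPoint x).map l.continuous
    exact h1.mem_open (chart k Δ σ).isOpenEmbedding.isOpen_range ⟨y, hy⟩
  obtain ⟨θ, hθ⟩ : ∃ θ, Spec.map θ = IsOpenImmersion.lift (chart k Δ σ) l hrange :=
    ⟨_, Spec.map_preimage _⟩
  have hfac : Spec.map θ ≫ chart k Δ σ = l := by rw [hθ, IsOpenImmersion.lift_fac]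
  rw [← hfac, ← chartMap_chart k Δ (Δ.zeroCone_le σ), ← Category.assoc, ← Category.assoc,
    cancel_mono, ← Spec.map_comp, ← Spec.map_comp] at hl
  have hl' := Spec.map_injective hl
  refine ⟨σ, fun u hu => ?_⟩
  -- The extension sends `x^u` to `t^(φ u)`, which therefore lies in `O`; this says `0 ≤ φ u`.
  have h := congrArg (fun f => f.hom (AddMonoidAlgebra.single ⟨u, hu⟩ 1)) hl'
  change ((θ.hom (.single ⟨u, hu⟩ 1) : O) : HahnSeries Γ k) =
    ψ (chartMap k (Δ.zeroCone_le σ) (.single ⟨u, hu⟩ 1)) at h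
  rw [chartMap_single, weightHom_single] at h
  have hmem : HahnSeries.single (φ u) (1 : k) ∈ hahnIntegers Γ k := by
    have := (θ.hom (.single ⟨u, hu⟩ 1) : O).2
    rw [h] at this
    exact this
  rw [mem_hahnIntegers, HahnSeries.orderTop_single one_ne_zero] at hmem
  exact_mod_cast hmem

end Complete

/-! ### Local rings as subrings of the function field. -/

section Regular

variable {X : Scheme.{u}} [AlgebraicGeometry.IsIntegral X]

/-- The local ring of `X` at `y` as a subring of the function field. -/
noncomputable def regularAt (y : X) : Subring X.functionField :=
  (algebraMap (X.presheaf.stalk y) X.functionField).range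

lemma mem_regularAt {y : X} {f : X.functionField} :
    f ∈ regularAt y ↔ ∃ r, algebraMap (X.presheaf.stalk y) X.functionField r = f := Iff.rfl

lemma algebraMap_stalk_injective (y : X) :
    Function.Injective (algebraMap (X.presheaf.stalk y) X.functionField) :=
  IsFractionRing.injective _ _

/-- This expresses being a unit at `y` inside the function field. The case `r = 0` is excluded
because `0⁻¹ = 0` is regular. -/
lemma inv_mem_regularAt_iff {y : X} {r : X.presheaf.stalk y} (hr : r ≠ 0) :
    (algebraMap (X.presheaf.stalk y) X.functionField r)⁻¹ ∈ regularAt y ↔ IsUnit r := by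
  have hr' : algebraMap (X.presheaf.stalk y) X.functionField r ≠ 0 := by
    rwa [Ne, map_eq_zero_iff _ (algebraMap_stalk_injective y)]
  constructor
  · rintro ⟨s, hs⟩
    refine IsUnit.of_mul_eq_one s (algebraMap_stalk_injective y ?_)
    rw [map_mul, hs, map_one, mul_inv_cancel₀ hr']
  · rintro ⟨s, rfl⟩
    refine ⟨(s⁻¹ : (X.presheaf.stalk y)ˣ), eq_inv_of_mul_eq_one_left ?_⟩
    rw [← map_mul, Units.inv_mul, map_one]

/-- In a local ring, if a finite sum is a unit then so is one of the summands. -/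
lemma exists_inv_mem_regularAt {ι : Type*} {y : X} (s : Finset ι) (f : ι → X.functionField)
    (hf : ∀ i ∈ s, f i ∈ regularAt y) (h0 : ∑ i ∈ s, f i ≠ 0)
    (h : (∑ i ∈ s, f i)⁻¹ ∈ regularAt y) : ∃ i ∈ s, f i ≠ 0 ∧ (f i)⁻¹ ∈ regularAt y := by
  classical
  choose! r hr using hf
  have hsum : algebraMap (X.presheaf.stalk y) X.functionField (∑ i ∈ s, r i) = ∑ i ∈ s, f i := by
    rw [map_sum]; exact Finset.sum_congr rfl fun i hi => hr i hi
  have hne : ∑ i ∈ s, r i ≠ 0 := by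
    intro h; rw [h, map_zero] at hsum; exact h0 hsum.symm
  rw [← hsum, inv_mem_regularAt_iff hne] at h
  by_contra! hcon
  have hmem : ∑ i ∈ s, r i ∈ IsLocalRing.maximalIdeal (X.presheaf.stalk y) := by
    refine Ideal.sum_mem _ fun i hi => ?_
    rw [IsLocalRing.mem_maximalIdeal, mem_nonunits_iff]
    intro hu
    have hri : r i ≠ 0 := hu.ne_zero
    refine hcon i hi ?_ ?_
    · rw [← hr i hi]
      rwa [Ne, map_eq_zero_iff _ (algebraMap_stalk_injective y)]
    · rw [← hr i hi, inv_mem_regularAt_iff hri]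
      exact hu
  exact (IsLocalRing.mem_maximalIdeal _).mp hmem h

lemma regularAt_le_of_specializes {z y : X} (h : z ⤳ y) : regularAt y ≤ regularAt z := by
  rintro _ ⟨r, rfl⟩
  refine ⟨(X.presheaf.stalkSpecializes h).hom r, ?_⟩
  simp only [RingHom.algebraMap_toAlgebra]
  rw [← CommRingCat.comp_apply, TopCat.Presheaf.stalkSpecializes_comp]

lemma germToFunctionField_mem_regularAt {U : X.Opens} [Nonempty U] {y : X} (hy : y ∈ U)
    (h : Γ(X, U)) : X.germToFunctionField U h ∈ regularAt y :=
  ⟨X.presheaf.germ U y hy h, Scheme.algebraMap_germ_eq_germToFunctionField X hy h⟩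

lemma germToFunctionField_ne_zero {U : X.Opens} [Nonempty U] {h : Γ(X, U)} (h0 : h ≠ 0) :
    X.germToFunctionField U h ≠ 0 := by
  rwa [Ne, map_eq_zero_iff _ (Scheme.germToFunctionField_injective X U)]

lemma germToFunctionField_inv_mem_regularAt {U : X.Opens} [Nonempty U] {y : X} (hy : y ∈ U)
    {h : Γ(X, U)} (h0 : h ≠ 0) :
    (X.germToFunctionField U h)⁻¹ ∈ regularAt y ↔ y ∈ X.basicOpen h := by
  rw [← Scheme.algebraMap_germ_eq_germToFunctionField X hy, inv_mem_regularAt_iff,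
    Scheme.mem_basicOpen _ _ _ hy]
  rw [Ne, map_eq_zero_iff _ (germ_injective_of_isIntegral X y hy)]
  exact h0

lemma _root_.AlgebraicGeometry.IsAffineOpen.mem_primeIdealOf_iff {U : X.Opens} (hU : IsAffineOpen U)
    {y : X} (hy : y ∈ U) (b : Γ(X, U)) :
    b ∈ (hU.primeIdealOf ⟨y, hy⟩).asIdeal ↔ y ∉ X.basicOpen b := by
  rw [hU.primeIdealOf_eq_map_closedPoint, Scheme.mem_basicOpen _ _ _ hy]
  exact IsLocalRing.mem_maximalIdeal _

lemma mem_regularAt_iff_of_isAffineOpen {U : X.Opens} [Nonempty U] (hU : IsAffineOpen U) {y : X}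
    (hy : y ∈ U) {f : X.functionField} :
    f ∈ regularAt y ↔ ∃ a b : Γ(X, U), y ∈ X.basicOpen b ∧
      f = X.germToFunctionField U a / X.germToFunctionField U b := by
  constructor
  · rintro ⟨r, rfl⟩
    let := TopCat.Presheaf.algebra_section_stalk X.presheaf ⟨y, hy⟩
    have := hU.isLocalization_stalk ⟨y, hy⟩
    obtain ⟨a, ⟨b, hb⟩, rfl⟩ := IsLocalization.exists_mk'_eq
      (hU.primeIdealOf ⟨y, hy⟩).asIdeal.primeCompl r
    have hb' : y ∈ X.basicOpen b := by
      by_contra h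
      exact hb ((hU.mem_primeIdealOf_iff hy b).mpr h)
    have hb0 : b ≠ 0 := by
      rintro rfl
      exact hb (zero_mem _)
    refine ⟨a, b, hb', ?_⟩
    rw [eq_div_iff (germToFunctionField_ne_zero hb0)]
    rw [← Scheme.algebraMap_germ_eq_germToFunctionField X hy,
      ← Scheme.algebraMap_germ_eq_germToFunctionField X hy, ← map_mul]
    congr 1
    exact IsLocalization.mk'_spec _ _ _
  · rintro ⟨a, b, hb, rfl⟩
    rw [div_eq_mul_inv]
    refine mul_mem (germToFunctionField_mem_regularAt hy a) ?_
    by_cases hb0 : b = 0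
    · rw [hb0, map_zero, inv_zero]; exact zero_mem _
    · exact (germToFunctionField_inv_mem_regularAt hy hb0).mpr hb

/-- A rational function that is regular at all points of an affine open set comes from a section. -/
lemma exists_section_of_forall_regularAt {U : X.Opens} [Nonempty U] (hU : IsAffineOpen U)
    {f : X.functionField} (hf : ∀ y ∈ U, f ∈ regularAt y) :
    ∃ a : Γ(X, U), X.germToFunctionField U a = f := by
  let ψ := (X.germToFunctionField U).hom
  -- The ideal of denominators of `f`. If it were proper, `f` would fail to be regular at the point
  -- of a maximal ideal containing it.
  let I : Ideal Γ(X, U) :=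
    { carrier := {b | ∃ a, ψ a = ψ b * f}
      add_mem' := by
        rintro b b' ⟨a, ha⟩ ⟨a', ha'⟩
        exact ⟨a + a', by rw [map_add, map_add, ha, ha', add_mul]⟩
      zero_mem' := ⟨0, by rw [map_zero, zero_mul]⟩
      smul_mem' := by
        rintro c b ⟨a, ha⟩
        exact ⟨c * a, by rw [smul_eq_mul, map_mul, map_mul, ha, mul_assoc]⟩ }
  have hI : I = ⊤ := by
    by_contra hne
    obtain ⟨m, hm, hle⟩ := Ideal.exists_le_maximal I hne
    let P : PrimeSpectrum Γ(X, U) := ⟨m, hm.isPrime⟩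
    have hyU : hU.fromSpec P ∈ U := by
      have := hU.range_fromSpec
      exact this.le ⟨P, rfl⟩
    obtain ⟨a, b, hb, hab⟩ := (mem_regularAt_iff_of_isAffineOpen hU hyU).mp (hf _ hyU)
    have hb0 : ψ b ≠ 0 := by
      refine germToFunctionField_ne_zero ?_
      rintro rfl
      rw [Scheme.mem_basicOpen _ _ _ hyU, map_zero] at hb
      exact not_isUnit_zero hb
    have hbI : b ∈ I := ⟨a, by rw [hab, mul_div_cancel₀ _ hb0]⟩
    have hbP : P ∈ hU.fromSpec ⁻¹ᵁ X.basicOpen b := hb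
    rw [hU.fromSpec_preimage_basicOpen] at hbP
    exact hbP (hle hbI)
  obtain ⟨a, ha⟩ : (1 : Γ(X, U)) ∈ I := hI ▸ Submodule.mem_top
  exact ⟨a, by rw [map_one, one_mul] at ha; exact ha⟩

/-! ### Orders of vanishing at points of codimension one. -/

section Order

variable [IsLocallyNoetherian X]

lemma ord_one (z : X) : Scheme.ord (1 : X.functionField) z = 0 := by
  have := Scheme.ord_mul (x := z) (one_ne_zero (α := X.functionField)) one_ne_zero
  rw [mul_one] at this
  omega

lemma ord_inv (f : X.functionField) (z : X) : Scheme.ord f⁻¹ z = - Scheme.ord f z := by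
  by_cases hf : f = 0
  · rw [hf, inv_zero, Scheme.ord_zero]; rfl
  · have := Scheme.ord_mul (x := z) hf (inv_ne_zero hf)
    rw [mul_inv_cancel₀ hf, ord_one] at this
    omega

lemma ord_pow {f : X.functionField} (hf : f ≠ 0) (z : X) (n : ℕ) :
    Scheme.ord (f ^ n) z = n * Scheme.ord f z := by
  induction n with
  | zero => rw [pow_zero, ord_one]; simp
  | succ n ih => rw [pow_succ, Scheme.ord_mul (pow_ne_zero n hf) hf, ih]; push_cast; ring

lemma ord_div {f g : X.functionField} (hf : f ≠ 0) (hg : g ≠ 0) (z : X) :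
    Scheme.ord (f / g) z = Scheme.ord f z - Scheme.ord g z := by
  rw [div_eq_mul_inv, Scheme.ord_mul hf (inv_ne_zero hg), ord_inv, sub_eq_add_neg]

/-- The order of vanishing of a regular function is the length of the quotient. -/
lemma ord_algebraMap {z : X} (hz : Order.coheight z = 1) {r : X.presheaf.stalk z} (hr : r ≠ 0)
    {n : ℕ} (hn : Ring.ord (X.presheaf.stalk z) r = n) :
    Scheme.ord (algebraMap (X.presheaf.stalk z) X.functionField r) z = n := by
  have : Ring.KrullDimLE 1 (X.presheaf.stalk z) := krullDimLE_of_coheight_le hz.le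
  have hr' : algebraMap (X.presheaf.stalk z) X.functionField r ≠ 0 := by
    rwa [Ne, map_eq_zero_iff _ (algebraMap_stalk_injective z)]
  rw [Scheme.ord_eq_iff hz hr']
  refine (Ring.ordFrac_eq_ord _ hr).trans ?_
  exact Ring.ordMonoidWithZeroHom_eq_coe _ (mem_nonZeroDivisors_of_ne_zero hr) hn

lemma exists_ringOrd_eq {z : X} (hz : Order.coheight z = 1) {r : X.presheaf.stalk z}
    (hr : r ≠ 0) : ∃ n : ℕ, Ring.ord (X.presheaf.stalk z) r = n := by
  have : Ring.KrullDimLE 1 (X.presheaf.stalk z) := krullDimLE_of_coheight_le hz.le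
  obtain ⟨n, hn⟩ := ENat.ne_top_iff_exists.mp
    (Ring.ord_ne_top (mem_nonZeroDivisors_of_ne_zero hr))
  exact ⟨n, hn.symm⟩

/-- No condition on `z` or `f` is needed: the order is zero by convention outside codimension one
and for `f = 0`. -/
lemma ord_nonneg_of_mem_regularAt {z : X} {f : X.functionField} (hf : f ∈ regularAt z) :
    0 ≤ Scheme.ord f z := by
  by_cases hz : Order.coheight z = 1
  · obtain ⟨r, rfl⟩ := hf
    by_cases hr : r = 0
    · rw [hr, map_zero, Scheme.ord_zero]; rfl
    · obtain ⟨n, hn⟩ := exists_ringOrd_eq hz hr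
      rw [ord_algebraMap hz hr hn]
      exact Int.natCast_nonneg n
  · rw [Scheme.ord_eq_zero_of_coheight_neq_one hz]

lemma ord_eq_zero_of_inv_mem_regularAt {z : X} {f : X.functionField} (hf : f ∈ regularAt z)
    (hf' : f⁻¹ ∈ regularAt z) : Scheme.ord f z = 0 := by
  have h1 := ord_nonneg_of_mem_regularAt hf
  have h2 := ord_nonneg_of_mem_regularAt hf'
  rw [ord_inv] at h2
  omega

/-- Order zero would mean that the local ring modulo the function has length zero, so that the
function is a unit. -/
lemma ord_pos_of_inv_notMem_regularAt {z : X} (hz : Order.coheight z = 1) {f : X.functionField}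
    (hf : f ∈ regularAt z) (hf' : f⁻¹ ∉ regularAt z) : 0 < Scheme.ord f z := by
  obtain ⟨r, rfl⟩ := hf
  have hr : r ≠ 0 := by
    rintro rfl
    rw [map_zero, inv_zero] at hf'
    exact hf' (zero_mem _)
  rw [inv_mem_regularAt_iff hr] at hf'
  obtain ⟨n, hn⟩ := exists_ringOrd_eq hz hr
  rw [ord_algebraMap hz hr hn]
  have hn0 : n ≠ 0 := by
    rintro rfl
    rw [Ring.ord, Nat.cast_zero, Module.length_eq_zero_iff, Submodule.Quotient.subsingleton_iff] at hn
    exact hf' (Ideal.span_singleton_eq_top.mp hn)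
  exact_mod_cast Nat.pos_of_ne_zero hn0

lemma eq_of_specializes_of_coheight_eq_one {z y : X} (h : z ⤳ y) (hz : Order.coheight z = 1)
    (hy : Order.coheight y = 1) : z = y := by
  by_contra hne
  have hlt : y < z := lt_of_le_not_ge h fun h' =>
    hne (Specializes.antisymm h (Scheme.le_iff_specializes.mp h')).eq
  have := Order.coheight_strictAnti hlt (by rw [hz]; exact ENat.one_lt_top)
  rw [hz, hy] at this
  exact lt_irrefl _ this

/-- Write `f = a / b`. A pole of codimension one lies on `b = 0`, and there its prime is minimal
over `(b)`, having height one in a domain with `b ≠ 0`. A Noetherian ring has only finitely many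
such primes. -/
lemma finite_ord_neg_of_isAffineOpen {U : X.Opens} (hU : IsAffineOpen U) (f : X.functionField) :
    {z | z ∈ U ∧ Scheme.ord f z < 0}.Finite := by
  by_cases hne : Nonempty U
  swap
  · refine Set.Finite.subset Set.finite_empty ?_
    rintro z ⟨hz, -⟩
    exact hne ⟨⟨z, hz⟩⟩
  by_cases hf : f = 0
  · refine Set.Finite.subset Set.finite_empty ?_
    rintro z ⟨-, hz⟩
    rw [hf, Scheme.ord_zero] at hz
    exact absurd hz (lt_irrefl _)
  have := functionField_isFractionRing_of_isAffineOpen X U hU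
  have hnoeth : IsNoetherianRing Γ(X, U) := IsLocallyNoetherian.component_noetherian ⟨U, hU⟩
  obtain ⟨a, b, hb, hab⟩ := IsFractionRing.div_surjective (A := Γ(X, U)) f
  have hb0 : b ≠ 0 := nonZeroDivisors.ne_zero hb
  have hab' : X.germToFunctionField U a / X.germToFunctionField U b = f := hab
  have ha0 : a ≠ 0 := by
    rintro rfl
    rw [map_zero, zero_div] at hab'
    exact hf hab'.symm
  have hfin := Ideal.finite_minimalPrimes_of_isNoetherianRing _ (Ideal.span {b})
  let F : PrimeSpectrum Γ(X, U) → X := hU.fromSpec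
  have hfin' : {P : PrimeSpectrum Γ(X, U) | P.asIdeal ∈ (Ideal.span {b}).minimalPrimes}.Finite :=
    hfin.preimage (fun P _ Q _ h => PrimeSpectrum.ext h)
  refine (hfin'.image F).subset ?_
  rintro z ⟨hz, hord⟩
  have hz1 : Order.coheight z = 1 := by
    by_contra h
    rw [Scheme.ord_eq_zero_of_coheight_neq_one h] at hord
    exact lt_irrefl _ hord
  refine ⟨hU.primeIdealOf ⟨z, hz⟩, ?_, hU.fromSpec_primeIdealOf ⟨z, hz⟩⟩
  have hbz : b ∈ (hU.primeIdealOf ⟨z, hz⟩).asIdeal := by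
    rw [hU.mem_primeIdealOf_iff hz]
    intro hbz
    rw [← hab'] at hord
    have := ord_nonneg_of_mem_regularAt
      ((mem_regularAt_iff_of_isAffineOpen hU hz).mpr ⟨a, b, hbz, rfl⟩)
    omega
  have hheight : (hU.primeIdealOf ⟨z, hz⟩).asIdeal.height = 1 := by
    let := TopCat.Presheaf.algebra_section_stalk X.presheaf ⟨z, hz⟩
    have := hU.isLocalization_stalk ⟨z, hz⟩
    have h1 := IsLocalization.AtPrime.ringKrullDim_eq_height (hU.primeIdealOf ⟨z, hz⟩).asIdeal
      (X.presheaf.stalk z)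
    rw [ringKrullDim_stalk_eq_coheight, hz1] at h1
    exact_mod_cast h1.symm
  refine ⟨⟨inferInstance, (Ideal.span_singleton_le_iff_mem _).mpr hbz⟩, ?_⟩
  rintro Q ⟨hQ, hbQ⟩ hle
  by_contra hnle
  have hlt : Q < (hU.primeIdealOf ⟨z, hz⟩).asIdeal := lt_of_le_not_ge hle hnle
  have h2 := Ideal.height_strict_mono_of_isPrime_of_isPrime hlt
  rw [hheight, Order.lt_one_iff, Ideal.height_eq_zero_iff,
    IsDomain.minimalPrimes_eq_singleton_bot, Set.mem_singleton_iff] at h2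
  rw [h2, le_bot_iff, Ideal.span_singleton_eq_bot] at hbQ
  exact hb0 hbQ

/-- Finitely many affine open sets suffice, and zeros of `f` are poles of `f⁻¹`. -/
lemma finite_ord_ne_zero [CompactSpace X] (f : X.functionField) :
    {z : X | Scheme.ord f z ≠ 0}.Finite := by
  have hneg : ∀ f : X.functionField, {z : X | Scheme.ord f z < 0}.Finite := by
    intro f
    obtain ⟨s, hs, htop⟩ := isCompact_iff_finite_and_eq_biUnion_affineOpens.mp
      (show IsCompact ((⊤ : X.Opens) : Set X) from isCompact_univ)
    refine (hs.biUnion fun U _ => finite_ord_neg_of_isAffineOpen U.2 f).subset fun z hz => ?_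
    have hzU : z ∈ ⨆ i ∈ s, (i : X.Opens) := htop ▸ TopologicalSpace.Opens.mem_top z
    simp only [TopologicalSpace.Opens.mem_iSup] at hzU
    obtain ⟨U, hU, hzU⟩ := hzU
    exact Set.mem_biUnion hU ⟨hzU, hz⟩
  refine ((hneg f).union (hneg f⁻¹)).subset fun z hz => ?_
  rcases lt_or_gt_of_ne hz with h | h
  · exact Or.inl h
  · refine Or.inr ?_
    change Scheme.ord f⁻¹ z < 0
    rw [ord_inv]; omega

end Order

end Regular

/-- Restriction of sections to a smaller chart corresponds to pullback along the inclusion of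
charts; this makes the maps from chart rings to the function field compatible. -/
lemma appIso_inv_comp_map {X Y Z : Scheme.{u}} (g : X ⟶ Y) (f : Y ⟶ Z) (h : X ⟶ Z)
    (e : g ≫ f = h) [IsOpenImmersion f] [IsOpenImmersion h] (hle : h ''ᵁ ⊤ ≤ f ''ᵁ ⊤) :
    (f.appIso ⊤).inv ≫ Z.presheaf.map (homOfLE hle).op = g.appTop ≫ (h.appIso ⊤).inv := by
  subst e
  have hle' : (⊤ : X.Opens) ≤ g ⁻¹ᵁ ⊤ := le_rfl
  have htop : g.appTop = g.appLE ⊤ ⊤ hle' := Scheme.Hom.app_eq_appLE _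
  rw [htop, ← cancel_mono ((g ≫ f).appIso ⊤).hom, Category.assoc, Category.assoc, Iso.inv_hom_id,
    Category.comp_id, Scheme.Hom.appIso_hom', Scheme.Hom.map_appLE, Iso.inv_comp_eq,
    Scheme.Hom.appIso_hom']
  exact (Scheme.Hom.appLE_comp_appLE _ _ _ _ _ _ _).symm

/-! ### Points, local rings and regular functions in the charts. -/

section Chart

variable (k : Type u) [Field k] {N : Type u} [AddCommGroup N] [Module.Free ℤ N]
  [Module.Finite ℤ N] (Δ : Fan N)

/-- The affine open subset `U_σ` of `X(Δ)`. -/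
noncomputable abbrev chartOpen (σ : Δ.Cone) : (toricVariety k Δ).Opens := chart k Δ σ ''ᵁ ⊤

instance chartOpen_nonempty (σ : Δ.Cone) : Nonempty (chartOpen k Δ σ) :=
  chart_image_nonempty k Δ σ

lemma chartOpen_isAffineOpen (σ : Δ.Cone) : IsAffineOpen (chartOpen k Δ σ) :=
  (isAffineOpen_top _).image_of_isOpenImmersion _

/-- Regular functions on `U_σ`. -/
noncomputable def chartSections (σ : Δ.Cone) :
    CommRingCat.of (ChartRing k σ.1) ≅ Γ(toricVariety k Δ, chartOpen k Δ σ) :=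
  (Scheme.ΓSpecIso (.of (ChartRing k σ.1))).symm ≪≫ ((chart k Δ σ).appIso ⊤).symm

lemma chartToFunctionField_apply (σ : Δ.Cone) (a : ChartRing k σ.1) :
    chartToFunctionField k Δ σ a =
      (toricVariety k Δ).germToFunctionField (chartOpen k Δ σ) ((chartSections k Δ σ).hom a) :=
  rfl

variable {k Δ}

lemma mem_chartOpen {σ : Δ.Cone} {y : toricVariety k Δ} :
    y ∈ chartOpen k Δ σ ↔ ∃ P : PrimeSpectrum (ChartRing k σ.1), chart k Δ σ P = y := by
  constructor
  · rintro ⟨P, -, h⟩; exact ⟨P, h⟩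
  · rintro ⟨P, h⟩; exact ⟨P, trivial, h⟩

lemma chart_mem_chartOpen (σ : Δ.Cone) (P : PrimeSpectrum (ChartRing k σ.1)) :
    chart k Δ σ P ∈ chartOpen k Δ σ := mem_chartOpen.mpr ⟨P, rfl⟩

lemma chart_mem_basicOpen {σ : Δ.Cone} {P : PrimeSpectrum (ChartRing k σ.1)}
    {b : ChartRing k σ.1} :
    chart k Δ σ P ∈ (toricVariety k Δ).basicOpen ((chartSections k Δ σ).hom b) ↔
      b ∉ P.asIdeal := by
  have h : (chartSections k Δ σ).hom b = ((chart k Δ σ).appIso ⊤).inv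
    ((Scheme.ΓSpecIso (.of (ChartRing k σ.1))).inv b) := rfl
  rw [h, ← Scheme.image_basicOpen, basicOpen_eq_of_affine]
  constructor
  · rintro ⟨Q, hQ, hPQ⟩
    rw [(chart k Δ σ).isOpenEmbedding.injective hPQ] at hQ
    exact hQ
  · intro hP
    exact ⟨P, hP, rfl⟩

lemma chartSections_surjective (σ : Δ.Cone) :
    Function.Surjective (chartSections k Δ σ).hom :=
  (ConcreteCategory.bijective_of_isIso (chartSections k Δ σ).hom).2

lemma chartSections_injective (σ : Δ.Cone) :
    Function.Injective (chartSections k Δ σ).hom :=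
  (ConcreteCategory.bijective_of_isIso (chartSections k Δ σ).hom).1

lemma chartToFunctionField_injective (σ : Δ.Cone) :
    Function.Injective (chartToFunctionField k Δ σ) := fun _ _ h =>
  chartSections_injective σ (Scheme.germToFunctionField_injective _ _ h)

lemma chartToFunctionField_ne_zero {σ : Δ.Cone} {a : ChartRing k σ.1} (ha : a ≠ 0) :
    chartToFunctionField k Δ σ a ≠ 0 := by
  rwa [Ne, map_eq_zero_iff _ (chartToFunctionField_injective σ)]

lemma chartToFunctionField_mem_regularAt {σ : Δ.Cone} {y : toricVariety k Δ}
    (hy : y ∈ chartOpen k Δ σ) (a : ChartRing k σ.1) :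
    chartToFunctionField k Δ σ a ∈ regularAt y :=
  germToFunctionField_mem_regularAt hy _

lemma chartToFunctionField_inv_mem_regularAt {σ : Δ.Cone} {P : PrimeSpectrum (ChartRing k σ.1)}
    {b : ChartRing k σ.1} (hb : b ≠ 0) :
    (chartToFunctionField k Δ σ b)⁻¹ ∈ regularAt (chart k Δ σ P) ↔ b ∉ P.asIdeal := by
  rw [← chart_mem_basicOpen, ← germToFunctionField_inv_mem_regularAt (chart_mem_chartOpen σ P),
    chartToFunctionField_apply]
  rwa [Ne, map_eq_zero_iff _ (chartSections_injective σ)]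

lemma mem_regularAt_chart {σ : Δ.Cone} {P : PrimeSpectrum (ChartRing k σ.1)}
    {f : (toricVariety k Δ).functionField} :
    f ∈ regularAt (chart k Δ σ P) ↔ ∃ a b : ChartRing k σ.1, b ∉ P.asIdeal ∧
      f = chartToFunctionField k Δ σ a / chartToFunctionField k Δ σ b := by
  rw [mem_regularAt_iff_of_isAffineOpen (chartOpen_isAffineOpen k Δ σ) (chart_mem_chartOpen σ P)]
  constructor
  · rintro ⟨a, b, hb, rfl⟩
    obtain ⟨a, rfl⟩ := chartSections_surjective σ a
    obtain ⟨b, rfl⟩ := chartSections_surjective σ b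
    exact ⟨a, b, chart_mem_basicOpen.mp hb, rfl⟩
  · rintro ⟨a, b, hb, rfl⟩
    exact ⟨_, _, chart_mem_basicOpen.mpr hb, rfl⟩

lemma exists_chartToFunctionField_eq {σ : Δ.Cone} {f : (toricVariety k Δ).functionField}
    (hf : ∀ y ∈ chartOpen k Δ σ, f ∈ regularAt y) : ∃ a, chartToFunctionField k Δ σ a = f := by
  obtain ⟨a, ha⟩ := exists_section_of_forall_regularAt (chartOpen_isAffineOpen k Δ σ) hf
  obtain ⟨a, rfl⟩ := chartSections_surjective σ a
  exact ⟨a, ha⟩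

lemma chart_comp {τ σ : Δ.Cone} (h : τ ≤ σ) (P : PrimeSpectrum (ChartRing k τ.1)) :
    chart k Δ σ (P.comap (chartMap k h)) = chart k Δ τ P := by
  rw [← chartMap_chart k Δ h]; rfl

lemma chartOpen_mono {τ σ : Δ.Cone} (h : τ ≤ σ) : chartOpen k Δ τ ≤ chartOpen k Δ σ := by
  intro y hy
  obtain ⟨P, rfl⟩ := mem_chartOpen.mp hy
  rw [← chart_comp h]
  exact chart_mem_chartOpen σ _

lemma chartToFunctionField_chartMap {τ σ : Δ.Cone} (h : τ ≤ σ) (a : ChartRing k σ.1) :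
    chartToFunctionField k Δ τ (chartMap k h a) = chartToFunctionField k Δ σ a := by
  have key : (toricVariety k Δ).presheaf.map (homOfLE (chartOpen_mono (k := k) h)).op
      ((chartSections k Δ σ).hom a) = (chartSections k Δ τ).hom (chartMap k h a) := by
    have h1 : (chartSections k Δ σ).hom ≫ (toricVariety k Δ).presheaf.map
        (homOfLE (chartOpen_mono (k := k) h)).op =
        CommRingCat.ofHom (chartMap k h) ≫ (chartSections k Δ τ).hom := by
      simp only [chartSections, Iso.trans_hom, Iso.symm_hom, Category.assoc]
      rw [appIso_inv_comp_map _ _ _ (chartMap_chart k Δ h),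
        Scheme.ΓSpecIso_inv_naturality_assoc]
    exact congrArg (fun f => f.hom a) h1
  rw [chartToFunctionField_apply, chartToFunctionField_apply, ← key]
  exact TopCat.Presheaf.germ_res_apply (toricVariety k Δ).presheaf
    (homOfLE (chartOpen_mono (k := k) h)) _ _ _

lemma coheight_chart (σ : Δ.Cone) (P : PrimeSpectrum (ChartRing k σ.1)) :
    Order.coheight (chart k Δ σ P) = P.asIdeal.height := by
  rw [idealHeight_eq_coheight (.of (ChartRing k σ.1)) P]
  exact coheight_eq_of_isOpenImmersion (chart k Δ σ)

lemma specializes_chart {σ : Δ.Cone} {P Q : PrimeSpectrum (ChartRing k σ.1)} :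
    chart k Δ σ P ⤳ chart k Δ σ Q ↔ P ≤ Q := by
  rw [PrimeSpectrum.le_iff_specializes]
  exact (chart k Δ σ).isOpenEmbedding.isInducing.specializes_iff

end Chart

/-! ### Characters as rational functions. -/

section Characters

variable (k : Type u) [Field k] {N : Type u} [AddCommGroup N] [Module.Free ℤ N]
  [Module.Finite ℤ N] (Δ : Fan N)

lemma Fan.mem_dualMonoid_zeroCone (u : Module.Dual ℤ N) : u ∈ dualMonoid Δ.zeroCone.1 := by
  intro x hx
  rw [(Submodule.mem_bot _).mp hx, map_zero]

/-- The character `x^u` as a rational function on `X(Δ)`. -/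
noncomputable def character (u : Module.Dual ℤ N) : (toricVariety k Δ).functionField :=
  chartToFunctionField k Δ Δ.zeroCone (.single ⟨u, Δ.mem_dualMonoid_zeroCone u⟩ 1)

variable {k Δ}

lemma single_ne_zero' {M : Type u} [AddCommMonoid M] (u : M) :
    (AddMonoidAlgebra.single u 1 : AddMonoidAlgebra k M) ≠ 0 := by
  intro h
  have := congrArg (fun p => p.coeff u) h
  simp at this

lemma character_ne_zero (u : Module.Dual ℤ N) : character k Δ u ≠ 0 :=
  chartToFunctionField_ne_zero (single_ne_zero' _)

lemma character_add (u v : Module.Dual ℤ N) :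
    character k Δ (u + v) = character k Δ u * character k Δ v := by
  rw [character, character, character, ← map_mul, AddMonoidAlgebra.single_mul_single, one_mul]
  rfl

lemma character_zero : character k Δ 0 = 1 := by
  have := character_add (k := k) (Δ := Δ) 0 0
  rw [add_zero] at this
  exact (mul_eq_left₀ (character_ne_zero 0)).mp this.symm

lemma character_neg (u : Module.Dual ℤ N) : character k Δ (-u) = (character k Δ u)⁻¹ := by
  refine eq_inv_of_mul_eq_one_left ?_
  rw [← character_add, neg_add_cancel, character_zero]

lemma chartToFunctionField_single {σ : Δ.Cone} (u : dualMonoid σ.1) :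
    chartToFunctionField k Δ σ (.single u 1) = character k Δ u.1 := by
  rw [← chartToFunctionField_chartMap (Δ.zeroCone_le σ), chartMap_single]
  rfl

lemma character_mem_regularAt {σ : Δ.Cone} {y : toricVariety k Δ} (hy : y ∈ chartOpen k Δ σ)
    {u : Module.Dual ℤ N} (hu : u ∈ dualMonoid σ.1) : character k Δ u ∈ regularAt y := by
  rw [← chartToFunctionField_single (σ := σ) ⟨u, hu⟩]
  exact chartToFunctionField_mem_regularAt hy _

lemma ord_character_of_mem_torus {y : toricVariety k Δ} (hy : y ∈ chartOpen k Δ Δ.zeroCone)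
    (u : Module.Dual ℤ N) : Scheme.ord (character k Δ u) y = 0 := by
  refine ord_eq_zero_of_inv_mem_regularAt
    (character_mem_regularAt hy (Δ.mem_dualMonoid_zeroCone u)) ?_
  rw [← character_neg]
  exact character_mem_regularAt hy (Δ.mem_dualMonoid_zeroCone _)

/-- The order of characters at a point, as an additive map. -/
noncomputable def ordCharacter (y : toricVariety k Δ) : Module.Dual ℤ N →+ ℤ where
  toFun u := Scheme.ord (character k Δ u) y
  map_zero' := by rw [character_zero, ord_one]
  map_add' u v := by
    rw [character_add, Scheme.ord_mul (character_ne_zero u) (character_ne_zero v)]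

/-- A Laurent polynomial all of whose exponents lie in `m + σ^∨` is `x^m` times a regular function
on `U_σ`. -/
lemma exists_eq_character_mul {σ : Δ.Cone} (m : Module.Dual ℤ N) (p : ChartRing k Δ.zeroCone.1)
    (hp : ∀ u ∈ p.coeff.support, u.1 - m ∈ dualMonoid σ.1) :
    ∃ q : ChartRing k σ.1,
      chartToFunctionField k Δ Δ.zeroCone p = character k Δ m * chartToFunctionField k Δ σ q ∧
      ∀ w : dualMonoid σ.1, q.coeff w = p.coeff ⟨w.1 + m, Δ.mem_dualMonoid_zeroCone _⟩ := by
  let s : dualMonoid σ.1 → dualMonoid Δ.zeroCone.1 := fun w =>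
    ⟨w.1 + m, Δ.mem_dualMonoid_zeroCone _⟩
  have hs : Function.Injective s := fun w w' h =>
    Subtype.ext (add_right_cancel (congrArg Subtype.val h))
  have hmap : ∀ q : ChartRing k σ.1, AddMonoidAlgebra.mapDomain s q =
      .single ⟨m, Δ.mem_dualMonoid_zeroCone m⟩ 1 * chartMap k (Δ.zeroCone_le σ) q := by
    intro q
    induction q using AddMonoidAlgebra.induction_on with
    | of u =>
      rw [AddMonoidAlgebra.of_apply, AddMonoidAlgebra.mapDomain_single, chartMap_single,
        AddMonoidAlgebra.single_mul_single, one_mul]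
      congr 1
      exact Subtype.ext (add_comm _ _)
    | add x y hx hy => rw [AddMonoidAlgebra.mapDomain_add, hx, hy, map_add, mul_add]
    | smul r x hx =>
      have h1 : AddMonoidAlgebra.mapDomain s (r • x) = r • AddMonoidAlgebra.mapDomain s x := by
        ext
        simp [AddMonoidAlgebra.mapDomain, Finsupp.mapDomain_smul]
      have h2 : chartMap k (Δ.zeroCone_le σ) (r • x) = r • chartMap k (Δ.zeroCone_le σ) x := by
        have hr : chartMap k (Δ.zeroCone_le σ) (.single 0 r) = algebraMap k _ r := by
          rw [chartMap_single, map_zero]; rfl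
        rw [Algebra.smul_def, map_mul, Algebra.smul_def, ← hr]; rfl
      rw [h1, h2, hx, mul_smul_comm]
  have hq := AddMonoidAlgebra.mapDomain_comapDomain (f := s) (x := p) (fun u hu =>
    ⟨⟨u.1 - m, hp u hu⟩, Subtype.ext (sub_add_cancel _ _)⟩) hs
  refine ⟨AddMonoidAlgebra.comapDomain s hs p, ?_, fun w => rfl⟩
  conv_lhs => rw [← hq, hmap, map_mul, chartToFunctionField_chartMap]
  rfl

end Characters

/-! ### The valuation along the divisor of a ray. -/

section DivisorPoint

variable {k : Type u} [Field k] {N : Type u} [AddCommGroup N] [Module.Free ℤ N]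
  [Module.Finite ℤ N] {Δ : Fan N}

lemma mem_dualMonoid_rayCone {v : Δ.Ray} {u : Module.Dual ℤ N} :
    u ∈ dualMonoid (Δ.rayCone v).1 ↔ 0 ≤ u v.1 := by
  refine ⟨fun h => nonneg_of_mem_rayCone Δ v ⟨u, h⟩, fun h => ?_⟩
  have := mem_dualMonoid_hull (s := {v.1}) (u := u)
  rw [Set.image_singleton] at this
  exact this.mpr fun w hw => by rw [Set.mem_singleton_iff.mp hw]; exact h

/-- The ideal is spanned by monomials, and the condition `⟨u, v⟩ > 0` is stable under adding
elements of the dual monoid. -/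
lemma mem_rayIdeal {v : Δ.Ray} {a : ChartRing k (Δ.rayCone v).1} :
    a ∈ rayIdeal k Δ v ↔ ∀ u ∈ a.coeff.support, 0 < u.1 v.1 := by
  have h : rayIdeal k Δ v = Ideal.span (AddMonoidAlgebra.of' k _ ''
      {u : dualMonoid (Δ.rayCone v).1 | 0 < u.1 v.1}) := by
    rw [rayIdeal]
    congr 1
    ext x
    constructor
    · rintro ⟨u, hu, rfl⟩; exact ⟨u, hu, rfl⟩
    · rintro ⟨u, hu, rfl⟩; exact ⟨u, hu, rfl⟩
  rw [h, AddMonoidAlgebra.mem_ideal_span_of'_image]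
  refine forall₂_congr fun u _ => ⟨?_, fun hu => ⟨u, hu, 0, (zero_add _).symm⟩⟩
  rintro ⟨u', hu', d, rfl⟩
  exact add_pos_of_nonneg_of_pos (nonneg_of_mem_rayCone Δ v d) hu'

/-- The ideal of `Y(v)` in `U_v` is principal: if `⟨u, v⟩ > 0` then `⟨u, v⟩ ≥ 1` by integrality, so
`u - u₁` is still in the dual monoid. -/
lemma exists_eq_single_mul {v : Δ.Ray} {u₁ : Module.Dual ℤ N} (hu₁ : u₁ v.1 = 1)
    {a : ChartRing k (Δ.rayCone v).1} (ha : a ∈ rayIdeal k Δ v) :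
    ∃ b, a = .single ⟨u₁, mem_dualMonoid_rayCone.mpr (by rw [hu₁]; exact zero_le_one)⟩ 1 * b := by
  have hle : rayIdeal k Δ v ≤ Ideal.span
      {.single ⟨u₁, mem_dualMonoid_rayCone.mpr (by rw [hu₁]; exact zero_le_one)⟩ 1} := by
    rw [rayIdeal, Ideal.span_le]
    rintro _ ⟨u, hu, rfl⟩
    refine Ideal.mem_span_singleton.mpr ⟨.single ⟨u.1 - u₁, mem_dualMonoid_rayCone.mpr ?_⟩ 1, ?_⟩
    · rw [LinearMap.sub_apply, hu₁]; omega
    · rw [AddMonoidAlgebra.single_mul_single, one_mul]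
      congr 1
      exact Subtype.ext (add_sub_cancel _ _).symm
  exact Ideal.mem_span_singleton.mp (hle ha)

/-- Krull's principal ideal theorem bounds the height by one; it is not zero since the ideal
contains a nonzero character. -/
lemma coheight_divisorPoint (v : Δ.Ray) : Order.coheight (divisorPoint k Δ v) = 1 := by
  obtain ⟨u₁, hu₁⟩ := v.2.1.exists_dual
  have h1 : u₁ ∈ dualMonoid (Δ.rayCone v).1 :=
    mem_dualMonoid_rayCone.mpr (by rw [hu₁]; exact zero_le_one)
  have hmem : (.single ⟨u₁, h1⟩ 1 : ChartRing k (Δ.rayCone v).1) ∈ rayIdeal k Δ v :=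
    Ideal.subset_span ⟨_, by rw [hu₁]; exact one_pos, rfl⟩
  have hnoeth : IsNoetherianRing (ChartRing k (Δ.rayCone v).1) := by
    have h1 := dualMonoid_fg (Δ.rational _ (Δ.rayCone v).2)
    have : AddMonoid.FG (dualMonoid (Δ.rayCone v).1) :=
      (AddMonoid.fg_iff_addSubmonoid_fg _).mpr h1
    exact Algebra.FiniteType.isNoetherianRing k _
  refine (coheight_chart _ _).trans (le_antisymm ?_ ?_)
  · refine Ideal.height_le_one_of_isPrincipal_of_mem_minimalPrimes
      (Ideal.span {.single ⟨u₁, h1⟩ 1}) _ ⟨⟨inferInstance, ?_⟩, ?_⟩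
    · exact (Ideal.span_singleton_le_iff_mem _).mpr hmem
    · rintro Q ⟨-, hQ⟩ - a ha
      obtain ⟨b, rfl⟩ := exists_eq_single_mul hu₁ ha
      exact Ideal.mul_mem_right _ _ (hQ (Ideal.mem_span_singleton_self _))
  · rw [Order.one_le_iff_ne_zero, Ne, Ideal.height_eq_zero_iff,
      IsDomain.minimalPrimes_eq_singleton_bot, Set.mem_singleton_iff]
    intro h
    rw [show rayIdeal k Δ v = ⊥ from h] at hmem
    exact single_ne_zero' _ ((Submodule.mem_bot _).mp hmem)

lemma divisorPoint_mem_chartOpen (v : Δ.Ray) :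
    divisorPoint k Δ v ∈ chartOpen k Δ (Δ.rayCone v) := chart_mem_chartOpen _ _

/-- The character `x^{u₁}` generates the maximal ideal of the local ring at `Y(v)`, so the quotient
is simple, of length one. -/
lemma ord_character_uniformizer {v : Δ.Ray} {u₁ : Module.Dual ℤ N} (hu₁ : u₁ v.1 = 1) :
    Scheme.ord (character k Δ u₁) (divisorPoint k Δ v) = 1 := by
  have h1 : u₁ ∈ dualMonoid (Δ.rayCone v).1 :=
    mem_dualMonoid_rayCone.mpr (by rw [hu₁]; exact zero_le_one)
  obtain ⟨r, hr⟩ := character_mem_regularAt (divisorPoint_mem_chartOpen (k := k) v) h1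
  have hmem : (.single ⟨u₁, h1⟩ 1 : ChartRing k (Δ.rayCone v).1) ∈ rayIdeal k Δ v :=
    Ideal.subset_span ⟨_, by rw [hu₁]; exact one_pos, rfl⟩
  have hr0 : r ≠ 0 := by
    rintro rfl
    rw [map_zero] at hr
    exact character_ne_zero u₁ hr.symm
  have hru : ¬ IsUnit r := by
    rw [← inv_mem_regularAt_iff hr0, hr,
      ← chartToFunctionField_single (σ := Δ.rayCone v) ⟨u₁, h1⟩]
    exact fun h => (chartToFunctionField_inv_mem_regularAt (single_ne_zero' _)).mp h hmem
  rw [← hr]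
  refine ord_algebraMap (coheight_divisorPoint v) hr0 (n := 1) ?_
  rw [Ring.ord, Nat.cast_one, Module.length_eq_one_iff, isSimpleModule_iff_isCoatom]
  have hmax : Ideal.span {r} = IsLocalRing.maximalIdeal _ := by
    refine le_antisymm ?_ fun s hs => ?_
    · rw [Ideal.span_singleton_le_iff_mem, IsLocalRing.mem_maximalIdeal]
      exact hru
    -- A nonunit `a / b` of the local ring has its numerator in the ideal of `Y(v)`, which is
    -- generated by `x^{u₁}`.
    · obtain ⟨a, b, hb, hab⟩ := mem_regularAt_chart.mp
        (show algebraMap _ (toricVariety k Δ).functionField s ∈ regularAt (divisorPoint k Δ v)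
          from ⟨s, rfl⟩)
      have hb0 : b ≠ 0 := by rintro rfl; exact hb (zero_mem _)
      have ha : a ∈ rayIdeal k Δ v := by
        by_contra ha
        have ha0 : a ≠ 0 := by rintro rfl; exact ha (zero_mem _)
        have hs0 : s ≠ 0 := by
          rintro rfl
          rw [map_zero, eq_comm, div_eq_zero_iff] at hab
          exact hab.elim (chartToFunctionField_ne_zero ha0) (chartToFunctionField_ne_zero hb0)
        refine (IsLocalRing.mem_maximalIdeal _).mp hs ((inv_mem_regularAt_iff hs0).mp ?_)
        rw [hab, inv_div]
        exact mem_regularAt_chart.mpr ⟨b, a, ha, rfl⟩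
      obtain ⟨c, rfl⟩ := exists_eq_single_mul hu₁ ha
      obtain ⟨t, ht⟩ := show _ ∈ regularAt (divisorPoint k Δ v) from
        mem_regularAt_chart.mpr ⟨c, b, hb, rfl⟩
      refine Ideal.mem_span_singleton.mpr ⟨t, algebraMap_stalk_injective _ ?_⟩
      rw [map_mul, hab, hr, map_mul, chartToFunctionField_single, mul_div_assoc]
      congr 1
      exact ht.symm
  rw [hmax]
  exact Ideal.isMaximal_def.mp inferInstance

/-- Split off `⟨u, v⟩ u₁` with `⟨u₁, v⟩ = 1`: the remaining character pairs to zero with `v` and is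
a unit at the generic point of `Y(v)`. -/
lemma ord_character (v : Δ.Ray) (u : Module.Dual ℤ N) :
    Scheme.ord (character k Δ u) (divisorPoint k Δ v) = u v.1 := by
  obtain ⟨u₁, hu₁⟩ := v.2.1.exists_dual
  have h1 := ord_character_uniformizer (k := k) hu₁
  have h0 : ∀ w : Module.Dual ℤ N, w v.1 = 0 →
      Scheme.ord (character k Δ w) (divisorPoint k Δ v) = 0 := by
    intro w hw
    refine ord_eq_zero_of_inv_mem_regularAt
      (character_mem_regularAt (divisorPoint_mem_chartOpen v) (mem_dualMonoid_rayCone.mpr hw.ge)) ?_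
    rw [← character_neg]
    exact character_mem_regularAt (divisorPoint_mem_chartOpen v)
      (mem_dualMonoid_rayCone.mpr (by rw [LinearMap.neg_apply, hw, neg_zero]))
  have h2 : ordCharacter (divisorPoint k Δ v) u = ordCharacter (divisorPoint k Δ v)
      ((u - u v.1 • u₁) + u v.1 • u₁) := by rw [sub_add_cancel]
  rw [map_add, map_zsmul] at h2
  have h3 : ordCharacter (divisorPoint k Δ v) (u - u v.1 • u₁) = 0 := h0 _ (by simp [hu₁])
  have h4 : ordCharacter (divisorPoint k Δ v) u₁ = 1 := h1
  rw [h3, h4, zero_add, smul_eq_mul, mul_one] at h2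
  exact h2

/-- The order along `Y(v)` of a Laurent polynomial is the minimum of `⟨u, v⟩` over its exponents. -/
lemma le_ord_divisorPoint_iff {v : Δ.Ray} {p : ChartRing k Δ.zeroCone.1} (hp : p ≠ 0) {m : ℤ} :
    m ≤ Scheme.ord (chartToFunctionField k Δ Δ.zeroCone p) (divisorPoint k Δ v) ↔
      ∀ u ∈ p.coeff.support, m ≤ u.1 v.1 := by
  obtain ⟨u₁, hu₁⟩ := v.2.1.exists_dual
  have hne : p.coeff.support.Nonempty := by
    rw [Finsupp.support_nonempty_iff]
    exact fun h => hp (AddMonoidAlgebra.coeff_eq_zero.mp h)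
  obtain ⟨u₀, hu₀, hmin⟩ := p.coeff.support.exists_min_image (fun u => u.1 v.1) hne
  -- After dividing by the character of minimal weight, the quotient `q` has a term of weight zero;
  -- so it lies outside the prime of `Y(v)` and has order zero.
  obtain ⟨q, hq, hcoeff⟩ := exists_eq_character_mul (σ := Δ.rayCone v) (u₀.1 v.1 • u₁) p
    fun u hu => mem_dualMonoid_rayCone.mpr (by simp [hu₁, hmin u hu])
  have hw : u₀.1 - u₀.1 v.1 • u₁ ∈ dualMonoid (Δ.rayCone v).1 :=
    mem_dualMonoid_rayCone.mpr (by simp [hu₁])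
  have hqP : q ∉ rayIdeal k Δ v := by
    intro h
    have := mem_rayIdeal.mp h ⟨_, hw⟩ (by
      rw [Finsupp.mem_support_iff, hcoeff]
      simpa using Finsupp.mem_support_iff.mp hu₀)
    simp [hu₁] at this
  have hq0 : q ≠ 0 := by rintro rfl; exact hqP (zero_mem _)
  have hord : Scheme.ord (chartToFunctionField k Δ Δ.zeroCone p) (divisorPoint k Δ v) =
      u₀.1 v.1 := by
    rw [hq, Scheme.ord_mul (character_ne_zero _) (chartToFunctionField_ne_zero hq0), ord_character,
      ord_eq_zero_of_inv_mem_regularAt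
        (chartToFunctionField_mem_regularAt (divisorPoint_mem_chartOpen v) q)
        ((chartToFunctionField_inv_mem_regularAt hq0).mpr hqP)]
    simp [hu₁]
  rw [hord]
  exact ⟨fun h u hu => h.trans (hmin u hu), fun h => h u₀ hu₀⟩

/-- The orders of all characters along `Y(v)` recover `v`. -/
lemma divisorPoint_injective : Function.Injective (divisorPoint k Δ) := fun v w h =>
  Subtype.ext (eq_of_forall_dual_eq fun u => by
    rw [← ord_character (k := k) v u, h, ord_character])

lemma divisorPoint_notMem_torus (v : Δ.Ray) :
    divisorPoint k Δ v ∉ chartOpen k Δ Δ.zeroCone := by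
  intro h
  obtain ⟨u₁, hu₁⟩ := v.2.1.exists_dual
  have := ord_character_of_mem_torus h u₁
  rw [ord_character, hu₁] at this
  exact one_ne_zero this

open Classical in
lemma toricDivisor_apply (a : Δ.Ray → ℤ) (z : toricVariety k Δ) :
    toricDivisor k Δ a z = ∑ v, if z = divisorPoint k Δ v then a v else 0 := by
  simp only [toricDivisor, Function.locallyFinsuppWithin.coe_sum, Finset.sum_apply,
    Function.locallyFinsuppWithin.single_apply]

lemma toricDivisor_divisorPoint (a : Δ.Ray → ℤ) (v : Δ.Ray) :
    toricDivisor k Δ a (divisorPoint k Δ v) = a v := by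
  classical
  rw [toricDivisor_apply, Finset.sum_eq_single v]
  · rw [if_pos rfl]
  · exact fun w _ hw => if_neg fun h => hw (divisorPoint_injective h).symm
  · exact fun h => absurd (Finset.mem_univ v) h

lemma toricDivisor_of_mem_torus (a : Δ.Ray → ℤ) {z : toricVariety k Δ}
    (hz : z ∈ chartOpen k Δ Δ.zeroCone) : toricDivisor k Δ a z = 0 := by
  classical
  rw [toricDivisor_apply]
  refine Finset.sum_eq_zero fun v _ => if_neg ?_
  rintro rfl
  exact divisorPoint_notMem_torus v hz

lemma toricDivisor_nsmul (a : Δ.Ray → ℤ) (n : ℕ) (z : toricVariety k Δ) :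
    toricDivisor k Δ (fun v => n * a v) z = n * toricDivisor k Δ a z := by
  classical
  rw [toricDivisor_apply, toricDivisor_apply, Finset.mul_sum]
  simp

lemma hull_le_iff {v : Δ.Ray} {σ : Δ.Cone} : Δ.rayCone v ≤ σ ↔ latticeVec v.1 ∈ σ.1 := by
  constructor
  · exact fun h => h (Submodule.mem_span_singleton_self _)
  · exact fun h => Submodule.span_le.mpr (Set.singleton_subset_iff.mpr h)

end DivisorPoint

/-! ### Codimension-one points and distinguished points of the charts. -/

section Points

variable {k : Type u} [Field k] {N : Type u} [AddCommGroup N] [Module.Free ℤ N]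
  [Module.Finite ℤ N] {Δ : Fan N}

/-- The prime ideal of `Y(v)` in the chart `U_σ`, for a ray `v` of `σ`. -/
noncomputable def rayPrime {v : Δ.Ray} {σ : Δ.Cone} (h : latticeVec v.1 ∈ σ.1) :
    PrimeSpectrum (ChartRing k σ.1) :=
  PrimeSpectrum.comap (chartMap k (hull_le_iff.mpr h)) ⟨rayIdeal k Δ v, inferInstance⟩

lemma chart_rayPrime {v : Δ.Ray} {σ : Δ.Cone} (h : latticeVec v.1 ∈ σ.1) :
    chart k Δ σ (rayPrime h) = divisorPoint k Δ v :=
  chart_comp _ _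

lemma mem_rayPrime {v : Δ.Ray} {σ : Δ.Cone} (h : latticeVec v.1 ∈ σ.1) {a : ChartRing k σ.1} :
    a ∈ (rayPrime (k := k) h).asIdeal ↔ ∀ u ∈ a.coeff.support, 0 < u.1 v.1 := by
  classical
  change chartMap k (hull_le_iff.mpr h) a ∈ rayIdeal k Δ v ↔ _
  rw [mem_rayIdeal]
  have hc : (chartMap k (hull_le_iff.mpr h) a).coeff = Finsupp.mapDomain
    (AddSubmonoid.inclusion (dualMonoid_anti (hull_le_iff.mpr h))) a.coeff := rfl
  rw [hc, Finsupp.mapDomain_support_of_injective (AddSubmonoid.inclusion_injective _)]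
  constructor
  · exact fun h u hu => h _ (Finset.mem_image_of_mem _ hu)
  · intro h w hw
    obtain ⟨u, hu, rfl⟩ := Finset.mem_image.mp hw
    exact h u hu

lemma sum_single_mem {M : Type u} [AddCommMonoid M] (a : AddMonoidAlgebra k M)
    (I : Ideal (AddMonoidAlgebra k M))
    (h : ∀ u ∈ a.coeff.support, (.single u 1 : AddMonoidAlgebra k M) ∈ I) : a ∈ I := by
  have : a ∈ Ideal.span (AddMonoidAlgebra.of' k _ '' (a.coeff.support : Set M)) := by
    rw [AddMonoidAlgebra.mem_ideal_span_of'_image]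
    exact fun u hu => ⟨u, hu, 0, (zero_add _).symm⟩
  refine (Ideal.span_le.mpr ?_) this
  rintro _ ⟨u, hu, rfl⟩
  exact h u hu

/-- A functional strictly positive on all rays of `σ` cuts out the face `{0}`, so the torus is the
locus in `U_σ` where its character does not vanish. -/
lemma chart_mem_torus {σ : Δ.Cone} {P : PrimeSpectrum (ChartRing k σ.1)} {m : dualMonoid σ.1}
    (hm : ∀ v : Δ.Ray, latticeVec v.1 ∈ σ.1 → 0 < m.1 v.1) (hP : .single m 1 ∉ P.asIdeal) :
    chart k Δ σ P ∈ chartOpen k Δ Δ.zeroCone := by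
  obtain ⟨u₀, hu₀, h0⟩ := (Δ.isFace_of_le (Δ.zeroCone_le σ)).exists_dual (Δ.rational _ σ.2)
  have hface : ∀ x, x ∈ Δ.zeroCone.1 ↔ x ∈ σ.1 ∧ pairing m.1 x = 0 := by
    intro x
    constructor
    · intro hx
      exact ⟨Δ.zeroCone_le σ hx, by rw [(Submodule.mem_bot _).mp hx, map_zero]⟩
    · rintro ⟨hx, hmx⟩
      refine (h0 x).mpr ⟨hx, le_antisymm ?_ (hu₀ x hx)⟩
      let n : ℕ := ∑ v : Δ.Ray, (u₀ v.1).natAbs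
      -- A large multiple of `m` dominates `u₀` on the rays, hence on all of `σ`; where `m`
      -- vanishes, `u₀` must then be nonpositive.
      have hd : n • m.1 + -u₀ ∈ dualMonoid σ.1 := by
        refine (Δ.mem_dualMonoid_iff σ.2).mpr fun v hv => ?_
        have h1 := hm v hv
        have h2 : (u₀ v.1).natAbs ≤ n := Finset.single_le_sum
          (f := fun v : Δ.Ray => (u₀ v.1).natAbs) (fun _ _ => Nat.zero_le _) (Finset.mem_univ v)
        have h3 : u₀ v.1 ≤ (n : ℤ) := by omega
        simp only [LinearMap.add_apply, LinearMap.neg_apply, LinearMap.smul_apply, nsmul_eq_mul]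
        nlinarith
      have h4 := hd x hx
      have h5 : pairing (n • m.1) x = 0 := by
        clear hd h4
        induction n with
        | zero => rw [zero_smul, pairing_zero]
        | succ n ih => rw [succ_nsmul, pairing_add, ih, hmx, add_zero]
      rw [pairing_add, pairing_neg, h5, zero_add] at h4
      linarith
  have hr := chartDiagram_range k Δ (homOfLE (Δ.zeroCone_le σ)) m hface
  have hmem : P ∈ Set.range ((chartDiagram k Δ).map (homOfLE (Δ.zeroCone_le σ))) := by
    rw [hr]; exact hP
  obtain ⟨Q, hQ⟩ := hmem
  refine mem_chartOpen.mpr ⟨Q, ?_⟩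
  have h := chart_comp (k := k) (Δ.zeroCone_le σ) Q
  exact h.symm.trans (congrArg (chart k Δ σ) hQ)

/-- The points of codimension one of `U_σ` lie in the torus or are generic points of the divisors
`Y(v)`, `v ∈ σ`. -/
lemma mem_torus_or_eq_divisorPoint {σ : Δ.Cone} {z : toricVariety k Δ}
    (hz : z ∈ chartOpen k Δ σ) (hz1 : Order.coheight z = 1) :
    z ∈ chartOpen k Δ Δ.zeroCone ∨
      ∃ v : Δ.Ray, latticeVec v.1 ∈ σ.1 ∧ z = divisorPoint k Δ v := by
  classical
  obtain ⟨P, rfl⟩ := mem_chartOpen.mp hz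
  rw [coheight_chart] at hz1
  -- Either `P` contains the prime of some `Y(v)` and equals it, since `P` has height one and that
  -- prime is nonzero; or each ray has a character positive on it and outside `P`, and the product
  -- of these characters puts the point in the torus.
  by_cases h : ∃ v : Δ.Ray, latticeVec v.1 ∈ σ.1 ∧
      ∀ u : dualMonoid σ.1, 0 < u.1 v.1 → (.single u 1 : ChartRing k σ.1) ∈ P.asIdeal
  · obtain ⟨v, hv, hP⟩ := h
    refine Or.inr ⟨v, hv, ?_⟩
    rw [← chart_rayPrime hv]
    have hle : (rayPrime (k := k) hv).asIdeal ≤ P.asIdeal := fun a ha =>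
      sum_single_mem a _ fun u hu => hP u ((mem_rayPrime hv).mp ha u hu)
    congr 1
    by_contra hne
    have hlt : (rayPrime (k := k) hv).asIdeal < P.asIdeal :=
      lt_of_le_of_ne hle fun h => hne (PrimeSpectrum.ext h.symm)
    have : P.asIdeal.FiniteHeight := P.asIdeal.finiteHeight_iff.mpr (Or.inr (by
      rw [hz1]; exact ENat.one_ne_top))
    have h2 := Ideal.height_strict_mono_of_isPrime_of_isPrime hlt
    rw [hz1, Order.lt_one_iff, Ideal.height_eq_zero_iff, IsDomain.minimalPrimes_eq_singleton_bot,
      Set.mem_singleton_iff] at h2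
    obtain ⟨u, hu, hpos⟩ := Δ.exists_strictly_positive σ.2
    have hmem : (.single ⟨u, hu⟩ 1 : ChartRing k σ.1) ∈ (rayPrime (k := k) hv).asIdeal := by
      rw [mem_rayPrime]
      intro w hw
      rw [AddMonoidAlgebra.coeff_single] at hw
      rw [Finset.mem_singleton.mp (Finsupp.support_single_subset hw)]
      exact hpos _ hv v.2.1.ne_zero
    rw [h2] at hmem
    exact single_ne_zero' _ ((Submodule.mem_bot _).mp hmem)
  · push Not at h
    choose! u hu huP using h
    left
    let S : Finset Δ.Ray := Finset.univ.filter fun v => latticeVec v.1 ∈ σ.1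
    have hS : (.single (∑ v ∈ S, u v) 1 : ChartRing k σ.1) = ∏ v ∈ S, .single (u v) 1 := by
      induction S using Finset.induction_on with
      | empty => rw [Finset.sum_empty, Finset.prod_empty]; rfl
      | insert v S hv ih =>
        rw [Finset.sum_insert hv, Finset.prod_insert hv, ← ih, AddMonoidAlgebra.single_mul_single,
          one_mul]
    refine chart_mem_torus (m := ∑ v ∈ S, u v) (fun v hv => ?_) ?_
    · have hvS : v ∈ S := Finset.mem_filter.mpr ⟨Finset.mem_univ _, hv⟩
      have h1 : (∑ w ∈ S, u w).1 v.1 = ∑ w ∈ S, (u w).1 v.1 := by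
        rw [AddSubmonoid.coe_finsetSum, LinearMap.sum_apply]
      rw [h1]
      exact Finset.sum_pos' (fun w _ => nonneg_of_mem_dualMonoid (u w).2 hv) ⟨v, hvS, hu v hv⟩
    · rw [hS, P.2.prod_mem_iff]
      rintro ⟨v, hv, hvP⟩
      exact huP v (Finset.mem_filter.mp hv).2 hvP

lemma divisorPoint_mem_chartOpen_iff {v : Δ.Ray} {σ : Δ.Cone} :
    divisorPoint k Δ v ∈ chartOpen k Δ σ ↔ latticeVec v.1 ∈ σ.1 := by
  constructor
  · intro h
    rcases mem_torus_or_eq_divisorPoint h (coheight_divisorPoint v) with h | ⟨w, hw, h⟩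
    · exact absurd h (divisorPoint_notMem_torus v)
    · rwa [divisorPoint_injective h]
  · exact fun h => chartOpen_mono (hull_le_iff.mpr h) (divisorPoint_mem_chartOpen v)

variable (k) in
/-- Each chart `U_σ` has a point that lies on exactly those `Y(v)` with `v ∈ σ`. -/
lemma exists_distinguished_point (σ : Δ.Cone) : ∃ x ∈ chartOpen k Δ σ, ∀ v : Δ.Ray,
    divisorPoint k Δ v ⤳ x ↔ latticeVec v.1 ∈ σ.1 := by
  classical
  -- The distinguished `k`-point of `U_σ`: `x^u` goes to `1` if `u` vanishes on every ray of `σ` and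
  -- to `0` otherwise.
  let e : Multiplicative (dualMonoid σ.1) →* k :=
    { toFun := fun u => if ∀ v : Δ.Ray, latticeVec v.1 ∈ σ.1 → u.toAdd.1 v.1 = 0 then 1 else 0
      map_one' := by simp
      map_mul' := fun x y => by
        have hiff : (∀ v : Δ.Ray, latticeVec v.1 ∈ σ.1 → (x * y).toAdd.1 v.1 = 0) ↔
            (∀ v : Δ.Ray, latticeVec v.1 ∈ σ.1 → x.toAdd.1 v.1 = 0) ∧
            (∀ v : Δ.Ray, latticeVec v.1 ∈ σ.1 → y.toAdd.1 v.1 = 0) := by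
          rw [← forall_and]
          refine forall_congr' fun v => ?_
          rw [← imp_and]
          refine imp_congr_right fun hv => ?_
          exact add_eq_zero_iff_of_nonneg (nonneg_of_mem_dualMonoid x.toAdd.2 hv)
            (nonneg_of_mem_dualMonoid y.toAdd.2 hv)
        simp only [hiff]
        rw [ite_and]
        split_ifs <;> simp }
  let E : ChartRing k σ.1 →ₐ[k] k := AddMonoidAlgebra.lift k k _ e
  let P : PrimeSpectrum (ChartRing k σ.1) := ⟨RingHom.ker E.toRingHom, RingHom.ker_isPrime _⟩
  refine ⟨chart k Δ σ P, chart_mem_chartOpen σ P, fun v => ⟨fun h => ?_, fun hv => ?_⟩⟩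
  · exact divisorPoint_mem_chartOpen_iff.mp
      (h.mem_open (chartOpen k Δ σ).isOpen (chart_mem_chartOpen σ P))
  · rw [← chart_rayPrime hv, specializes_chart]
    intro a ha
    refine sum_single_mem a _ fun u hu => ?_
    have hpos := (mem_rayPrime hv).mp ha u hu
    change E (.single u 1) = 0
    refine (AddMonoidAlgebra.lift_single _ _ _).trans ?_
    change (1 : k) • (if ∀ v : Δ.Ray, latticeVec v.1 ∈ σ.1 → u.1 v.1 = 0 then (1 : k) else 0) = 0
    rw [if_neg fun h => hpos.ne' (h v hv), smul_zero]

end Points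

/-! ### Linear equivalence, and regularity in codimension one. -/

section Transfer

variable {X : Scheme.{u}} [AlgebraicGeometry.IsIntegral X] [IsLocallyNoetherian X]

section

variable {D D' : AlgebraicCycle X ℤ} {g : X.functionField} (hg : g ≠ 0)
  (h : ∀ z, Order.coheight z = 1 → D z = D' z + Scheme.ord g z)

include hg h

/-- In codimension one `div g = D - D'`, so multiplication by `g` is an isomorphism from `O_X(D)` to
`O_X(D')`. -/
lemma mul_mem_divisorSections_iff {V : X.Opens} {f : X.functionField} :
    f * g ∈ divisorSections D' V ↔ f ∈ divisorSections D V := by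
  simp only [divisorSections, Set.mem_ofPred_eq, mul_eq_zero, hg, or_false]
  by_cases hf : f = 0
  · simp only [hf, true_or]
  · simp only [hf, false_or]
    refine forall₃_congr fun z _ hz => ?_
    rw [Scheme.ord_mul hf hg, h z hz]
    constructor <;> intro h <;> omega

lemma generatesAt_mul_iff {x : X} {s : X.functionField} :
    GeneratesAt D' x (s * g) ↔ GeneratesAt D x s := by
  refine exists_congr fun U => and_congr_right fun _ => forall₂_congr fun V _ => ?_
  have key : ∀ f, (∀ y ∈ V, ∃ r, f * g = algebraMap (X.presheaf.stalk y) X.functionField r *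
      (s * g)) ↔ ∀ y ∈ V, ∃ r, f = algebraMap (X.presheaf.stalk y) X.functionField r * s := by
    intro f
    refine forall₂_congr fun y _ => exists_congr fun r => ?_
    rw [← mul_assoc, mul_left_inj' hg]
  constructor
  · intro H f
    rw [← mul_mem_divisorSections_iff hg h, H, key]
  · intro H f
    rw [← div_mul_cancel₀ f hg, mul_mem_divisorSections_iff hg h, H, key]

/-- The multiples `n D` and `n D'` differ by the divisor of `g ^ n`, so a section `s` corresponds to
`s * g ^ n` with the same open set `X_s`. -/
lemma IsAmple.of_linearEquiv (hD : IsAmple D) : IsAmple D' := by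
  have hn : ∀ n : ℕ, ∀ z, Order.coheight z = 1 →
      (n • D) z = (n • D') z + Scheme.ord (g ^ n) z := by
    intro n z hz
    rw [Function.locallyFinsuppWithin.coe_nsmul, Function.locallyFinsuppWithin.coe_nsmul,
      Pi.smul_apply, Pi.smul_apply, h z hz, ord_pow hg, nsmul_eq_mul, nsmul_eq_mul, mul_add]
  refine ⟨hD.compactSpace, fun x => ?_, fun x => ?_⟩
  · obtain ⟨s, hs⟩ := hD.isLineBundle x
    exact ⟨s * g, (generatesAt_mul_iff hg h).mpr hs⟩
  · obtain ⟨n, hn0, s, hs, U, hU, hx, hUs⟩ := hD.exists_affine x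
    refine ⟨n, hn0, s * g ^ n, (mul_mem_divisorSections_iff (pow_ne_zero n hg) (hn n)).mpr hs,
      U, hU, hx, fun y => ?_⟩
    rw [generatesAt_mul_iff (pow_ne_zero n hg) (hn n), hUs]

end

lemma finite_support_of_compactSpace [CompactSpace X] (D : AlgebraicCycle X ℤ) :
    {z | D z ≠ 0}.Finite := by
  have h : ∀ z : X, ∃ t ∈ nhds z, (t ∩ {z | D z ≠ 0}).Finite := fun z =>
    D.supportLocallyFiniteWithinDomain z trivial
  choose t ht hfin using h
  obtain ⟨s, hs⟩ := CompactSpace.elim_nhds_subcover t ht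
  refine (s.finite_toSet.biUnion fun z _ => hfin z).subset fun z hz => ?_
  have : z ∈ ⋃ x ∈ s, t x := hs ▸ trivial
  obtain ⟨x, hx, hzx⟩ := Set.mem_iUnion₂.mp this
  exact Set.mem_iUnion₂.mpr ⟨x, hx, hzx, hz⟩

/-- Rational functions without poles in codimension one are regular. -/
def RegularInCodimOne (X : Scheme.{u}) [AlgebraicGeometry.IsIntegral X] [IsLocallyNoetherian X] :
    Prop :=
  ∀ (V : X.Opens) (f : X.functionField),
    (∀ z ∈ V, Order.coheight z = 1 → 0 ≤ Scheme.ord f z) → ∀ y ∈ V, f ∈ regularAt y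

lemma isOpen_compl_closure_of_finite {S : Set X} (hS : S.Finite) :
    ∃ U : X.Opens, (∀ x, x ∈ U ↔ ∀ z ∈ S, ¬ z ⤳ x) := by
  refine ⟨⟨(⋃ z ∈ S, closure {z})ᶜ, (hS.isClosed_biUnion fun z _ => isClosed_closure).isOpen_compl⟩,
    fun x => ?_⟩
  change x ∉ ⋃ z ∈ S, closure {z} ↔ _
  simp only [Set.mem_iUnion, not_exists, specializes_iff_mem_closure]

/-- If `O_X(D)` is a line bundle then rational functions without poles in codimension one are
regular. -/
lemma regularInCodimOne_of_generatesAt {D : AlgebraicCycle X ℤ}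
    (hD : ∀ x, ∃ g, GeneratesAt D x g) {W : X.Opens} (hW : (W : Set X).Nonempty)
    (h1 : 1 ∈ divisorSections D W) : RegularInCodimOne X := by
  intro V f hf y hy
  obtain ⟨g, U, hyU, hU⟩ := hD y
  -- The sheaf is nonzero: `1` is a section over `U ⊓ W`, which is nonempty by irreducibility.
  have hg : g ≠ 0 := by
    rintro rfl
    obtain ⟨w, hwU, hwW⟩ := nonempty_preirreducible_inter U.isOpen W.isOpen ⟨y, hyU⟩ hW
    have h2 : (1 : X.functionField) ∈ divisorSections D (U ⊓ W) := by
      refine h1.imp_right fun h1 z hz => h1 z hz.2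
    obtain ⟨r, hr⟩ := (hU (U ⊓ W) inf_le_left 1).mp h2 w ⟨hwU, hwW⟩
    rw [mul_zero] at hr
    exact one_ne_zero hr
  by_cases hf0 : f = 0
  · rw [hf0]; exact zero_mem _
  have hgU := ((hU U le_rfl g).mpr fun y _ => ⟨1, by rw [map_one, one_mul]⟩).resolve_left hg
  -- Multiplying by a function without codimension-one poles keeps `g` in `O_X(D)`; as `g`
  -- generates, `f * g = r * g` with `r` regular, and `g` cancels.
  have hfg : f * g ∈ divisorSections D (U ⊓ V) := by
    refine Or.inr fun z hz hz1 => ?_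
    rw [Scheme.ord_mul hf0 hg]
    have h1 := hgU z hz.1 hz1
    have h2 := hf z hz.2 hz1
    omega
  obtain ⟨r, hr⟩ := (hU (U ⊓ V) inf_le_left _).mp hfg y ⟨hyU, hy⟩
  exact ⟨r, (mul_right_cancel₀ hg hr).symm⟩

/-- Only finitely many prime divisors are poles of `f`, and none passes through `y`; removing them
leaves an open neighbourhood of `y`. -/
lemma RegularInCodimOne.mem_regularAt [CompactSpace X] (hX : RegularInCodimOne X) {y : X}
    {f : X.functionField} (hf : ∀ z, Order.coheight z = 1 → z ⤳ y → 0 ≤ Scheme.ord f z) :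
    f ∈ regularAt y := by
  obtain ⟨U, hU⟩ := isOpen_compl_closure_of_finite (X := X)
    (S := {z | Order.coheight z = 1 ∧ Scheme.ord f z < 0})
    ((finite_ord_ne_zero f).subset fun z hz => hz.2.ne)
  refine hX U f (fun z hz hz1 => ?_) y ((hU y).mpr fun z hz h => absurd hz.2 (not_lt.mpr ?_))
  · by_contra hlt
    exact (hU z).mp hz z ⟨hz1, not_le.mp hlt⟩ specializes_rfl
  · exact hf z hz.1 h

/-- The orders of `s` and `-D` differ along finitely many prime divisors, none through `x`. Off
these, `f / s` has no codimension-one poles for every section `f`. -/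
lemma RegularInCodimOne.generatesAt [CompactSpace X] (hX : RegularInCodimOne X)
    {D : AlgebraicCycle X ℤ} {x : X} {s : X.functionField} (hs : s ≠ 0)
    (h : ∀ z, Order.coheight z = 1 → z ⤳ x → Scheme.ord s z = - D z) : GeneratesAt D x s := by
  have hfin : {z | Order.coheight z = 1 ∧ Scheme.ord s z ≠ - D z}.Finite := by
    refine ((finite_ord_ne_zero s).union (finite_support_of_compactSpace D)).subset ?_
    rintro z ⟨-, hz⟩
    by_cases h0 : Scheme.ord s z = 0
    · refine Or.inr fun h => hz ?_
      rw [h0, h, neg_zero]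
    · exact Or.inl h0
  obtain ⟨U, hU⟩ := isOpen_compl_closure_of_finite hfin
  have hord : ∀ z ∈ U, Order.coheight z = 1 → Scheme.ord s z = - D z := fun z hz hz1 => by
    by_contra hne
    exact (hU z).mp hz z ⟨hz1, hne⟩ specializes_rfl
  refine ⟨U, (hU x).mpr fun z hz hzx => hz.2 (h z hz.1 hzx), fun V hV f => ⟨fun hf => ?_, fun hf => ?_⟩⟩
  · rcases hf with rfl | hf
    · exact fun y _ => ⟨0, by rw [map_zero, zero_mul]⟩
    by_cases hf0 : f = 0
    · exact fun y _ => ⟨0, by rw [map_zero, zero_mul, hf0]⟩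
    intro y hy
    obtain ⟨r, hr⟩ := hX V (f / s) (fun z hz hz1 => by
      rw [ord_div hf0 hs, hord z (hV hz) hz1]
      have := hf z hz hz1
      omega) y hy
    exact ⟨r, by rw [hr, div_mul_cancel₀ _ hs]⟩
  · by_cases hf0 : f = 0
    · exact Or.inl hf0
    refine Or.inr fun z hz hz1 => ?_
    obtain ⟨r, hr⟩ := hf z hz
    have h1 := ord_nonneg_of_mem_regularAt (Toric.mem_regularAt.mpr ⟨r, rfl⟩)
    have h2 : algebraMap (X.presheaf.stalk z) X.functionField r ≠ 0 := by
      rintro h; rw [h, zero_mul] at hr; exact hf0 hr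
    rw [hr, Scheme.ord_mul h2 hs, hord z (hV hz) hz1]
    omega

end Transfer

/-! ### Sections and generators for torus-invariant divisors. -/

section Toric

variable {k : Type u} [Field k] {N : Type u} [AddCommGroup N] [Module.Free ℤ N]
  [Module.Finite ℤ N] {Δ : Fan N}

lemma eq_of_latticeVec_mem_rayCone {v w : Δ.Ray} (h : latticeVec w.1 ∈ (Δ.rayCone v).1) :
    w = v := by
  refine Subtype.ext (hull_injective_of_isPrimitiveVec w.2.1 v.2.1 (le_antisymm ?_ ?_))
  · exact Submodule.span_le.mpr (Set.singleton_subset_iff.mpr h)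
  · obtain ⟨c, hc⟩ := Submodule.mem_span_singleton.mp h
    have hc0 : c ≠ 0 := by
      rintro rfl
      rw [zero_smul] at hc
      exact w.2.1.ne_zero (latticeVec_eq_zero.mp hc.symm)
    refine Submodule.span_le.mpr (Set.singleton_subset_iff.mpr ?_)
    exact Submodule.mem_span_singleton.mpr ⟨c⁻¹, by
      rw [← hc]
      change (c : ℝ)⁻¹ • (c : ℝ) • latticeVec v.1 = _
      rw [inv_smul_smul₀ fun h => hc0 (Subtype.ext h)]⟩

lemma mem_chartOpen_ray_or {z : toricVariety k Δ} (hz : Order.coheight z = 1) :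
    z ∈ chartOpen k Δ Δ.zeroCone ∨ ∃ v : Δ.Ray, z = divisorPoint k Δ v := by
  obtain ⟨σ, P, rfl⟩ := exists_chart k Δ z
  exact (mem_torus_or_eq_divisorPoint (chart_mem_chartOpen σ P) hz).imp_right
    fun ⟨v, _, h⟩ => ⟨v, h⟩

lemma character_mem_divisorSections {b : Δ.Ray → ℤ} {u : Module.Dual ℤ N}
    {V : (toricVariety k Δ).Opens}
    (hu : ∀ v, divisorPoint k Δ v ∈ V → 0 ≤ u v.1 + b v) :
    character k Δ u ∈ divisorSections (toricDivisor k Δ b) V := by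
  refine Or.inr fun z hz hz1 => ?_
  rcases mem_chartOpen_ray_or hz1 with h | ⟨v, rfl⟩
  · rw [ord_character_of_mem_torus h, toricDivisor_of_mem_torus b h, add_zero]
  · rw [ord_character, toricDivisor_divisorPoint]
    exact hu v hz

lemma one_mem_divisorSections_torus (b : Δ.Ray → ℤ) :
    1 ∈ divisorSections (toricDivisor k Δ b) (chartOpen k Δ Δ.zeroCone) := by
  rw [← character_zero]
  exact character_mem_divisorSections fun v hv => absurd hv (divisorPoint_notMem_torus v)

lemma chartOpen_nonempty' (σ : Δ.Cone) : (chartOpen k Δ σ : Set (toricVariety k Δ)).Nonempty := by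
  obtain ⟨x⟩ := chartOpen_nonempty k Δ σ
  exact ⟨x.1, x.2⟩

lemma IsAmple.regularInCodimOne {b : Δ.Ray → ℤ} (h : IsAmple (toricDivisor k Δ b)) :
    RegularInCodimOne (toricVariety k Δ) :=
  regularInCodimOne_of_generatesAt h.isLineBundle (chartOpen_nonempty' _)
    (one_mem_divisorSections_torus b)

/-- A generator of `O_X(D)` at `x` has the same order as `-D` along all prime divisors through
`x`. -/
lemma ord_eq_of_generatesAt {b : Δ.Ray → ℤ} {x : toricVariety k Δ}
    {s : (toricVariety k Δ).functionField} (hs : GeneratesAt (toricDivisor k Δ b) x s) :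
    s ≠ 0 ∧ ∀ z, Order.coheight z = 1 → z ⤳ x → Scheme.ord s z = - toricDivisor k Δ b z := by
  obtain ⟨U, hxU, hU⟩ := hs
  have hs0 : s ≠ 0 := by
    rintro rfl
    obtain ⟨w, hwU, hwW⟩ := nonempty_preirreducible_inter U.isOpen
      (chartOpen k Δ Δ.zeroCone).isOpen ⟨x, hxU⟩ (chartOpen_nonempty' _)
    have h2 : (1 : (toricVariety k Δ).functionField) ∈
        divisorSections (toricDivisor k Δ b) (U ⊓ chartOpen k Δ Δ.zeroCone) :=
      (one_mem_divisorSections_torus b).imp_right fun h1 z hz => h1 z hz.2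
    obtain ⟨r, hr⟩ := (hU _ inf_le_left 1).mp h2 w ⟨hwU, hwW⟩
    rw [mul_zero] at hr
    exact one_ne_zero hr
  refine ⟨hs0, fun z hz hzx => ?_⟩
  have hzU : z ∈ U := hzx.mem_open U.isOpen hxU
  have hsU := ((hU U le_rfl s).mpr fun y _ => ⟨1, by rw [map_one, one_mul]⟩).resolve_left hs0
  have hge := hsU z hzU hz
  -- A local section with order exactly `-D` at `z` is a regular multiple of `s`, which bounds the
  -- order of `s` from above; `hge` is the bound from below. In the torus `1` serves, and at `Y(v)`
  -- a character of weight `-b v`.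
  suffices h : ∃ m : Module.Dual ℤ N, ∃ V : (toricVariety k Δ).Opens, z ∈ V ∧
      character k Δ m ∈ divisorSections (toricDivisor k Δ b) V ∧
      Scheme.ord (character k Δ m) z = - toricDivisor k Δ b z by
    obtain ⟨m, V, hzV, hm, hord⟩ := h
    have hm' : character k Δ m ∈ divisorSections (toricDivisor k Δ b) (U ⊓ V) :=
      hm.imp_right fun h1 z hz => h1 z hz.2
    obtain ⟨r, hr⟩ := (hU _ inf_le_left _).mp hm' z ⟨hzU, hzV⟩
    have h1 := ord_nonneg_of_mem_regularAt (Toric.mem_regularAt.mpr ⟨r, rfl⟩)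
    have h2 : algebraMap _ (toricVariety k Δ).functionField r ≠ 0 := by
      rintro h; rw [h, zero_mul] at hr; exact character_ne_zero m hr
    rw [hr, Scheme.ord_mul h2 hs0] at hord
    omega
  rcases mem_chartOpen_ray_or hz with h | ⟨v, rfl⟩
  · refine ⟨0, _, h, ?_, ?_⟩
    · rw [character_zero]; exact one_mem_divisorSections_torus b
    · rw [ord_character_of_mem_torus h, toricDivisor_of_mem_torus b h, neg_zero]
  · obtain ⟨u, hu⟩ := v.2.1.exists_dual
    refine ⟨-(b v) • u, _, divisorPoint_mem_chartOpen v, ?_, ?_⟩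
    · refine character_mem_divisorSections fun w hw => ?_
      obtain rfl := eq_of_latticeVec_mem_rayCone (divisorPoint_mem_chartOpen_iff.mp hw)
      rw [LinearMap.smul_apply, hu]
      simp
    · rw [ord_character, toricDivisor_divisorPoint, LinearMap.smul_apply, hu]
      simp

end Toric

/-! ### Regular functions avoiding a point and vanishing along given divisors. -/

section Avoidance

variable {X : Scheme.{u}} [AlgebraicGeometry.IsIntegral X] [IsLocallyNoetherian X]

/-- On an affine open set there is a regular function that does not vanish at a given point `x` and
vanishes along finitely many prime divisors not containing `x`. -/
lemma exists_unit_at_and_ord_pos {U : X.Opens} (hU : IsAffineOpen U) {x : X} (hx : x ∈ U)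
    {Z : Set X} (hZ : Z.Finite) (hZx : ∀ z ∈ Z, ¬ z ⤳ x) :
    ∃ f : X.functionField, f ≠ 0 ∧ (∀ y ∈ U, f ∈ regularAt y) ∧ f⁻¹ ∈ regularAt x ∧
      ∀ z ∈ Z, z ∈ U → Order.coheight z = 1 → 0 < Scheme.ord f z := by
  have : Nonempty U := ⟨⟨x, hx⟩⟩
  obtain ⟨W, hW⟩ := isOpen_compl_closure_of_finite hZ
  obtain ⟨h, hhW, hhx⟩ := hU.exists_basicOpen_le ⟨x, (hW x).mpr hZx⟩ hx
  have h0 : h ≠ 0 := by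
    rintro rfl
    rw [Scheme.basicOpen_zero] at hhx
    exact hhx
  refine ⟨X.germToFunctionField U h, germToFunctionField_ne_zero h0,
    fun y hy => germToFunctionField_mem_regularAt hy h,
    (germToFunctionField_inv_mem_regularAt hx h0).mpr hhx, fun z hz hzU hz1 => ?_⟩
  refine ord_pos_of_inv_notMem_regularAt hz1 (germToFunctionField_mem_regularAt hzU h) ?_
  rw [germToFunctionField_inv_mem_regularAt hzU h0]
  exact fun hzh => (hW z).mp (hhW hzh) z hz specializes_rfl

lemma exists_nat_bound {S : Set X} (hS : S.Finite) (F : X → ℤ) :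
    ∃ n : ℕ, ∀ z ∈ S, F z ≤ n := by
  obtain ⟨m, hm⟩ := (hS.image F).bddAbove
  exact ⟨m.toNat, fun z hz => (hm ⟨z, hz, rfl⟩).trans (Int.self_le_toNat m)⟩

end Avoidance

/-! ### From line bundles and ampleness to exponents of characters. -/

section Exponents

lemma single_ne_zero_of_ne_zero {R M : Type*} [Semiring R] [AddCommMonoid M] (u : M) {c : R}
    (hc : c ≠ 0) : (AddMonoidAlgebra.single u c : AddMonoidAlgebra R M) ≠ 0 := by
  intro h
  have := congrArg (fun p => p.coeff u) h
  simp [hc] at this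

variable {k : Type u} [Field k] {N : Type u} [AddCommGroup N] [Module.Free ℤ N]
  [Module.Finite ℤ N] {Δ : Fan N}

lemma le_of_mem_divisorSections {b : Δ.Ray → ℤ} {p : ChartRing k Δ.zeroCone.1}
    {V : (toricVariety k Δ).Opens}
    (hp : chartToFunctionField k Δ Δ.zeroCone p ∈ divisorSections (toricDivisor k Δ b) V)
    {v : Δ.Ray} (hv : divisorPoint k Δ v ∈ V) {u : dualMonoid Δ.zeroCone.1}
    (hu : u ∈ p.coeff.support) : -b v ≤ u.1 v.1 := by
  have hp0 : p ≠ 0 := by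
    rintro rfl
    rw [AddMonoidAlgebra.coeff_zero, Finsupp.support_zero] at hu
    exact Finset.notMem_empty _ hu
  have h := hp.resolve_left (chartToFunctionField_ne_zero hp0) _ hv (coheight_divisorPoint v)
  rw [toricDivisor_divisorPoint] at h
  exact (le_ord_divisorPoint_iff hp0).mp (by omega) u hu

/-- Sections of `O_X(D)` over the torus, for a torus-invariant divisor `D`, are Laurent
polynomials. -/
lemma exists_laurent_of_mem_divisorSections (hX : RegularInCodimOne (toricVariety k Δ))
    {b : Δ.Ray → ℤ} {V : (toricVariety k Δ).Opens} (hV : chartOpen k Δ Δ.zeroCone ≤ V)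
    {f : (toricVariety k Δ).functionField} (hf : f ∈ divisorSections (toricDivisor k Δ b) V) :
    ∃ p, chartToFunctionField k Δ Δ.zeroCone p = f := by
  rcases hf with rfl | hf
  · exact ⟨0, map_zero _⟩
  refine exists_chartToFunctionField_eq (hX _ f fun z hz hz1 => ?_)
  have h := hf z (hV hz) hz1
  rwa [toricDivisor_of_mem_torus b hz, add_zero] at h

lemma neg_le_ord_single {b : Δ.Ray → ℤ} {u : dualMonoid Δ.zeroCone.1} {c : k} (hc : c ≠ 0)
    {z : toricVariety k Δ} (hz : Order.coheight z = 1)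
    (hu : ∀ v, z = divisorPoint k Δ v → -b v ≤ u.1 v.1) :
    -toricDivisor k Δ b z ≤
      Scheme.ord (chartToFunctionField k Δ Δ.zeroCone (.single u c)) z := by
  rcases mem_chartOpen_ray_or hz with h | ⟨v, rfl⟩
  · rw [toricDivisor_of_mem_torus b h, neg_zero]
    exact ord_nonneg_of_mem_regularAt (chartToFunctionField_mem_regularAt h _)
  · rw [toricDivisor_divisorPoint, le_ord_divisorPoint_iff (single_ne_zero_of_ne_zero _ hc)]
    intro w hw
    rw [AddMonoidAlgebra.coeff_single] at hw
    rw [Finset.mem_singleton.mp (Finsupp.support_single_subset hw)]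
    exact hu v rfl

/-- If a Laurent polynomial `p` generates `O_X(D)` at the distinguished point of `U_σ` then one of
the characters occurring in it does. -/
lemma exists_exponent_eq [CompactSpace (toricVariety k Δ)]
    (hX : RegularInCodimOne (toricVariety k Δ)) {b : Δ.Ray → ℤ} {σ : Δ.Cone}
    {x : toricVariety k Δ} (hx : ∀ v : Δ.Ray, divisorPoint k Δ v ⤳ x ↔ latticeVec v.1 ∈ σ.1)
    {q : (toricVariety k Δ).functionField} (hq0 : q ≠ 0)
    (hq : ∀ z, Order.coheight z = 1 → z ⤳ x → Scheme.ord q z = - toricDivisor k Δ b z)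
    {p : ChartRing k Δ.zeroCone.1} (hp0 : p ≠ 0)
    (hp : ∀ u ∈ p.coeff.support, ∀ v : Δ.Ray, latticeVec v.1 ∈ σ.1 → -b v ≤ u.1 v.1)
    (hpq : (chartToFunctionField k Δ Δ.zeroCone p / q)⁻¹ ∈ regularAt x) :
    ∃ u ∈ p.coeff.support, ∀ v : Δ.Ray, latticeVec v.1 ∈ σ.1 → u.1 v.1 = -b v := by
  classical
  -- The unit `p / q` of the local ring at `x` is a sum of monomial terms, each regular at `x` by
  -- the bounds on its exponent; so one of the terms is a unit.
  have hsum : ∑ u ∈ p.coeff.support,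
      chartToFunctionField k Δ Δ.zeroCone (.single u (p.coeff u)) / q =
      chartToFunctionField k Δ Δ.zeroCone p / q := by
    rw [← Finset.sum_div, ← map_sum]
    congr 2
    exact AddMonoidAlgebra.sum_coeff_single p
  have hc : ∀ u ∈ p.coeff.support, p.coeff u ≠ 0 := fun u hu => Finsupp.mem_support_iff.mp hu
  have hι : ∀ u ∈ p.coeff.support,
      chartToFunctionField k Δ Δ.zeroCone (.single u (p.coeff u)) ≠ 0 := fun u hu =>
    chartToFunctionField_ne_zero (single_ne_zero_of_ne_zero _ (hc u hu))
  have hreg : ∀ u ∈ p.coeff.support,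
      chartToFunctionField k Δ Δ.zeroCone (.single u (p.coeff u)) / q ∈ regularAt x := by
    refine fun u hu => hX.mem_regularAt fun z hz hzx => ?_
    rw [ord_div (hι u hu) hq0, hq z hz hzx]
    have := neg_le_ord_single (b := b) (hc u hu) hz fun v hv =>
      hp u hu v ((hx v).mp (hv ▸ hzx))
    omega
  have hne : chartToFunctionField k Δ Δ.zeroCone p / q ≠ 0 :=
    div_ne_zero (chartToFunctionField_ne_zero hp0) hq0
  rw [← hsum] at hne
  obtain ⟨u, hu, -, hinv⟩ := exists_inv_mem_regularAt (y := x) p.coeff.support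
    (fun u => chartToFunctionField k Δ Δ.zeroCone (.single u (p.coeff u)) / q) hreg hne
    (by rwa [hsum])
  refine ⟨u, hu, fun v hv => le_antisymm ?_ (hp u hu v hv)⟩
  by_contra hlt
  have hinv' := ord_nonneg_of_mem_regularAt (regularAt_le_of_specializes ((hx v).mpr hv) hinv)
  rw [ord_inv, ord_div (hι u hu) hq0, hq _ (coheight_divisorPoint v) ((hx v).mpr hv),
    toricDivisor_divisorPoint] at hinv'
  -- Lowering `b` by one at `v` encodes the strict inequality `-b v < ⟨u, v⟩`.
  have h2 := neg_le_ord_single (u := u) (b := fun w => if w = v then b v - 1 else b w) (hc u hu)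
    (coheight_divisorPoint v) (fun w hw => by
      obtain rfl := divisorPoint_injective hw
      simp only [if_true]
      omega)
  rw [toricDivisor_divisorPoint, if_pos rfl] at h2
  omega

variable (k) in
/-- A torus-invariant Cartier divisor is principal on each chart, with a character as equation. -/
lemma exists_exponent_eq_of_isLineBundle [CompactSpace (toricVariety k Δ)]
    (hX : RegularInCodimOne (toricVariety k Δ)) {a : Δ.Ray → ℤ}
    (ha : ∀ x, ∃ g, GeneratesAt (toricDivisor k Δ a) x g) (σ : Δ.Cone) :
    ∃ u : Module.Dual ℤ N, ∀ v : Δ.Ray, latticeVec v.1 ∈ σ.1 → u v.1 = -a v := by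
  obtain ⟨x, hxσ, hx⟩ := exists_distinguished_point k σ
  obtain ⟨g, hg⟩ := ha x
  obtain ⟨hg0, hg⟩ := ord_eq_of_generatesAt hg
  have hfin : {z | Order.coheight z = 1 ∧
      Scheme.ord g z ≠ - toricDivisor k Δ a z}.Finite := by
    refine ((finite_ord_ne_zero g).union
      (finite_support_of_compactSpace (toricDivisor k Δ a))).subset ?_
    rintro z ⟨-, hz⟩
    by_cases h0 : Scheme.ord g z = 0
    · exact Or.inr fun h => hz (by rw [h0, h, neg_zero])
    · exact Or.inl h0
  -- The local generator `g` may have the wrong order along finitely many divisors away from `x`. A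
  -- power of `h`, which vanishes on those meeting `U_σ` but not at `x`, turns it into a section
  -- over all of `U_σ` that still generates at `x`.
  obtain ⟨h, h0, hreg, hinv, hpos⟩ := exists_unit_at_and_ord_pos (chartOpen_isAffineOpen k Δ σ)
    hxσ hfin fun z hz hzx => hz.2 (hg z hz.1 hzx)
  obtain ⟨n, hn⟩ := exists_nat_bound hfin fun z => -(Scheme.ord g z + toricDivisor k Δ a z)
  have hne : h ^ n * g ≠ 0 := mul_ne_zero (pow_ne_zero n h0) hg0
  have hmem : h ^ n * g ∈ divisorSections (toricDivisor k Δ a) (chartOpen k Δ σ) := by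
    refine Or.inr fun z hz hz1 => ?_
    rw [Scheme.ord_mul (pow_ne_zero n h0) hg0, ord_pow h0]
    by_cases hbad : Scheme.ord g z = - toricDivisor k Δ a z
    · have := mul_nonneg (Nat.cast_nonneg (α := ℤ) n) (ord_nonneg_of_mem_regularAt (hreg z hz))
      omega
    · have h1 := hn z ⟨hz1, hbad⟩
      have h2 := hpos z ⟨hz1, hbad⟩ hz hz1
      have h3 := mul_le_mul_of_nonneg_left (show (1 : ℤ) ≤ Scheme.ord h z by omega)
        (Nat.cast_nonneg (α := ℤ) n)
      omega
  obtain ⟨p, hp⟩ := exists_laurent_of_mem_divisorSections hX (chartOpen_mono (Δ.zeroCone_le σ)) hmem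
  rw [← hp] at hmem
  obtain ⟨u, -, hu⟩ := exists_exponent_eq (p := p) hX hx hg0 hg
    (by rintro rfl; exact hne (by rw [← hp, map_zero]))
    (fun u hu v hv => le_of_mem_divisorSections hmem (divisorPoint_mem_chartOpen_iff.mpr hv) hu)
    (by rw [hp, mul_div_cancel_right₀ _ hg0, ← inv_pow]; exact pow_mem hinv n)
  exact ⟨u.1, hu⟩

lemma nsmul_toricDivisor (a : Δ.Ray → ℤ) (n : ℕ) :
    n • toricDivisor k Δ a = toricDivisor k Δ fun v => n * a v := by
  refine DFunLike.ext _ _ fun z => ?_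
  rw [toricDivisor_nsmul, Function.locallyFinsuppWithin.coe_nsmul, Pi.smul_apply, nsmul_eq_mul]

variable (k) in
-- Strictness at a single ray `v₀`. Let `s` be a section whose nonvanishing locus `U` is an affine
-- neighbourhood of the distinguished point. If `Y(v₀)` misses `U`, then `s` already vanishes along
-- it; if it meets `U` and `v₀ ∉ σ`, multiply by a function on `U` vanishing along `Y(v₀)` and clear
-- its poles with a power of `s`.
lemma exists_exponent_lt_of_isAmple {a : Δ.Ray → ℤ} (ha : IsAmple (toricDivisor k Δ a))
    (σ : Δ.Cone) (v₀ : Δ.Ray) : ∃ n : ℕ, 0 < n ∧ ∃ u : Module.Dual ℤ N,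
      (∀ v : Δ.Ray, latticeVec v.1 ∈ σ.1 → u v.1 = -(n * a v)) ∧ (∀ v, -(n * a v) ≤ u v.1) ∧
      (latticeVec v₀.1 ∉ σ.1 → -(n * a v₀) < u v₀.1) := by
  have := ha.compactSpace
  have hX := ha.regularInCodimOne
  obtain ⟨x, hxσ, hx⟩ := exists_distinguished_point k σ
  obtain ⟨n, hn0, s, hs, U, hU, hxU, hUs⟩ := ha.exists_affine x
  rw [nsmul_toricDivisor] at hs hUs
  obtain ⟨hs0, hsx⟩ := ord_eq_of_generatesAt ((hUs x).mp hxU)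
  have hs := hs.resolve_left hs0
  -- If `s` had order exactly `-nD` at `z`, it would generate there, and `z` would lie in `U`.
  have hout : ∀ z, Order.coheight z = 1 → z ∉ U →
      0 < Scheme.ord s z + toricDivisor k Δ (fun v => n * a v) z := by
    intro z hz hzU
    refine lt_of_le_of_ne (hs z trivial hz) fun h => hzU ((hUs z).mpr ?_)
    refine hX.generatesAt hs0 fun w hw hwz => ?_
    obtain rfl := eq_of_specializes_of_coheight_eq_one hwz hw hz
    omega
  -- This set is empty when `v₀ ∈ σ`, so both cases are handled together.
  obtain ⟨h, h0, hreg, hinv, hpos⟩ := exists_unit_at_and_ord_pos hU hxU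
    (Z := {z | z = divisorPoint k Δ v₀ ∧ latticeVec v₀.1 ∉ σ.1})
    ((Set.finite_singleton (divisorPoint k Δ v₀)).subset fun z hz => hz.1)
    (by rintro _ ⟨rfl, hv⟩ h; exact hv ((hx v₀).mp h))
  obtain ⟨j₀, hj₀⟩ := exists_nat_bound (finite_ord_ne_zero h) fun z => -Scheme.ord h z
  -- Strictly larger than every pole order of `h`, so that `h * s ^ j` is not only a global section
  -- but vanishes along all divisors missing `U`.
  let j := j₀ + 1
  have hj : ∀ z, -Scheme.ord h z < (j : ℤ) := by
    intro z
    by_cases hz : Scheme.ord h z = 0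
    · rw [hz, neg_zero]; exact Int.natCast_pos.mpr (Nat.succ_pos _)
    · have := hj₀ z hz
      push_cast [j]
      exact Int.lt_add_one_of_le this
  let b : Δ.Ray → ℤ := fun v => j * (n * a v)
  have hb : ∀ z, toricDivisor k Δ b z = j * toricDivisor k Δ (fun v => n * a v) z :=
    toricDivisor_nsmul _ j
  have hsj : s ^ j ≠ 0 := pow_ne_zero j hs0
  have hne : h * s ^ j ≠ 0 := mul_ne_zero h0 hsj
  have hord : ∀ z, Scheme.ord (h * s ^ j) z + toricDivisor k Δ b z =
      Scheme.ord h z + j * (Scheme.ord s z + toricDivisor k Δ (fun v => n * a v) z) := by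
    intro z
    rw [Scheme.ord_mul h0 hsj, ord_pow hs0, hb]
    ring
  have houtpos : ∀ z, Order.coheight z = 1 → z ∉ U →
      0 < Scheme.ord (h * s ^ j) z + toricDivisor k Δ b z := by
    intro z hz hzU
    rw [hord]
    have h1 := mul_le_mul_of_nonneg_left (Int.add_one_le_of_lt (hout z hz hzU))
      (Nat.cast_nonneg (α := ℤ) j)
    have h2 := hj z
    linarith
  have hmem : h * s ^ j ∈ divisorSections (toricDivisor k Δ b) ⊤ := by
    refine Or.inr fun z _ hz => ?_
    by_cases hzU : z ∈ U
    · rw [hord]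
      exact add_nonneg (ord_nonneg_of_mem_regularAt (hreg z hzU))
        (mul_nonneg (Nat.cast_nonneg _) (hs z trivial hz))
    · exact (houtpos z hz hzU).le
  obtain ⟨p, hp⟩ := exists_laurent_of_mem_divisorSections hX le_top hmem
  have hp0 : p ≠ 0 := by rintro rfl; exact hne (by rw [← hp, map_zero])
  rw [← hp] at hmem
  have hle : ∀ u ∈ p.coeff.support, ∀ v : Δ.Ray, -b v ≤ u.1 v.1 := fun u hu v =>
    le_of_mem_divisorSections hmem trivial hu
  obtain ⟨u, hup, hu⟩ := exists_exponent_eq (p := p) (b := b) (q := s ^ j) hX hx hsj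
    (fun z hz hzx => by rw [ord_pow hs0, hsx z hz hzx, hb, mul_neg]) hp0
    (fun u hu v _ => hle u hu v)
    (by rw [hp, mul_div_cancel_right₀ _ hsj]; exact hinv)
  have hbn : ∀ v, ((j * n : ℕ) : ℤ) * a v = b v := fun v => by simp only [b]; push_cast; ring
  refine ⟨j * n, Nat.mul_pos (Nat.succ_pos _) hn0, u.1, fun v hv => by rw [hbn]; exact hu v hv,
    fun v => by rw [hbn]; exact hle u hup v, fun hv => ?_⟩
  have hlt : 0 < Scheme.ord (h * s ^ j) (divisorPoint k Δ v₀) +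
      toricDivisor k Δ b (divisorPoint k Δ v₀) := by
    by_cases hzU : divisorPoint k Δ v₀ ∈ U
    · rw [hord]
      exact add_pos_of_pos_of_nonneg (hpos _ ⟨rfl, hv⟩ hzU (coheight_divisorPoint v₀))
        (mul_nonneg (Nat.cast_nonneg _) (hs _ trivial (coheight_divisorPoint v₀)))
    · exact houtpos _ (coheight_divisorPoint v₀) hzU
  rw [toricDivisor_divisorPoint, ← hp] at hlt
  -- Vanishing of the whole Laurent polynomial along `Y(v₀)` raises the weight of each of its
  -- exponents, in particular of `u`.
  have := (le_ord_divisorPoint_iff (v := v₀) (m := -b v₀ + 1) hp0).mp (by omega) u hup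
  rw [hbn]
  omega

variable (k) in
/-- Ampleness provides, for each cone `σ`, a monomial section of a multiple of `D` that vanishes
exactly along the `Y(v)` with `v ∉ σ`. -/
lemma exists_exponent_of_isAmple {a : Δ.Ray → ℤ} (ha : IsAmple (toricDivisor k Δ a))
    (σ : Δ.Cone) : ∃ n : ℕ, 0 < n ∧ ∃ u : Module.Dual ℤ N,
      (∀ v : Δ.Ray, latticeVec v.1 ∈ σ.1 → u v.1 = -(n * a v)) ∧
      ∀ v, latticeVec v.1 ∉ σ.1 → -(n * a v) < u v.1 := by
  -- Without rays the sum of the `n w` below would be zero, which is not allowed.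
  rcases isEmpty_or_nonempty Δ.Ray with hE | hE
  · exact ⟨1, one_pos, 0, fun v => hE.elim v, fun v => hE.elim v⟩
  -- Summing over all rays makes the inequality strict at every ray off `σ`, since each summand
  -- satisfies the weak inequality everywhere.
  choose n hn u heq hle hlt using exists_exponent_lt_of_isAmple k ha σ
  have hsum : ∀ v : Δ.Ray, -(((∑ w, n w : ℕ) : ℤ) * a v) = ∑ w, -((n w : ℤ) * a v) := fun v => by
    push_cast
    rw [Finset.sum_mul, Finset.sum_neg_distrib]
  refine ⟨∑ w, n w, Finset.sum_pos (fun w _ => hn w) Finset.univ_nonempty, ∑ w, u w,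
    fun v hv => ?_, fun v hv => ?_⟩
  · rw [hsum, LinearMap.sum_apply]
    exact Finset.sum_congr rfl fun w _ => heq w v hv
  · rw [hsum, LinearMap.sum_apply]
    exact Finset.sum_lt_sum (fun w _ => hle w v) ⟨v, Finset.mem_univ v, hlt v hv⟩

end Exponents

end Toric

/-! ### Assembly of the theorem. -/

theorem mainTheorem4 {k N : Type u} [Field k] [IsAlgClosed k] [AddCommGroup N] [Module.Free ℤ N]
    [Module.Finite ℤ N] (Δ : Toric.Fan N)
    (hX : AlgebraicGeometry.IsProper (Toric.toricVarietyToSpec k Δ))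
    (D : AlgebraicGeometry.AlgebraicCycle (Toric.toricVariety k Δ) ℤ) (hD : Toric.IsAmple D)
    (a : Δ.Ray → ℤ) (g : (Toric.toricVariety k Δ).functionField) (hg : g ≠ 0)
    (hDa : ∀ z : Toric.toricVariety k Δ, Order.coheight z = 1 →
      D z = Toric.toricDivisor k Δ a z + AlgebraicGeometry.Scheme.ord g z) :
    Toric.irrelevantIdeal k Δ = (Toric.sectionIdeal k Δ D a g).radical := by
  have ha := hD.of_linearEquiv hg hDa
  have := ha.compactSpace
  have key := Toric.irrelevantIdeal_eq_radical_span (k := k) a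
    {p | ∃ f ∈ Toric.divisorSections D ⊤,
      Toric.chartToFunctionField k Δ Δ.zeroCone p = f * g} ?_ ?_
    (Toric.exists_exponent_of_isAmple k ha)
    (Toric.exists_exponent_eq_of_isLineBundle k ha.regularInCodimOne ha.isLineBundle)
    (Toric.exists_cone_weight_nonneg hX)
  · rw [key, Toric.sectionIdeal]
    congr 2
    ext F
    constructor
    · rintro ⟨p, ⟨f, hf, hp⟩, rfl⟩
      exact ⟨f, hf, p, hp, rfl⟩
    · rintro ⟨f, hf, p, hp, rfl⟩
      exact ⟨p, ⟨f, hf, hp⟩, rfl⟩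
  · rintro p ⟨f, hf, hp⟩ u hu v
    have hmem := (Toric.mul_mem_divisorSections_iff hg hDa).mpr hf
    rw [← hp] at hmem
    have := Toric.le_of_mem_divisorSections hmem (v := v) trivial hu
    omega
  · intro u hu
    -- Dividing by `g` returns from sections for `∑ a_v Y(v)` to sections for `D`.
    refine ⟨Toric.character k Δ u.1 / g, ?_, ?_⟩
    · rw [← Toric.mul_mem_divisorSections_iff hg hDa, div_mul_cancel₀ _ hg]
      exact Toric.character_mem_divisorSections fun v _ => hu v
    · rw [div_mul_cancel₀ _ hg, Toric.chartToFunctionField_single]
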